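/- Let $d\ge 1$, $t>0$, and let $V:\mathbb{R}^d\to\mathbb{R}$ satisfy $e^{-tV}\in L^1(\mathbb{R}^d)$. Consider the Schrödinger operator $-\Delta+V$ in $L^2(\mathbb{R}^d)$ defined through the quadratic form $\int_{\mathbb{R}^d}(|\nabla\psi|^2+V|\psi|^2)\,dx$ with form domain $\{\psi\in H^1(\mathbb{R}^d):\int V_+|\psi|^2\,dx<\infty\}$, where $V_+=\max\{V,0\}$, and assume that this form domain is not $\{0\}$ (which is automatic if, for instance, $V_+$ is locally integrable). Then $-\Delta+V$ has a lowest eigenvalue $E_0$, and $$E_0 \;\ge\; -t^{-1}\ln\int_{\mathbb{R}^d}e^{-tV(x)}\,dx + d\,t^{-1}\bigl(1+\tfrac12\ln(\pi t)\bigr).$$ Moreover, equality holds if and only if there are $b\in\mathbb{R}^d$ and $c\in\mathbb{R}$ such that $V(x)=t^{-2}|x-b|^2+c$ for almost every $x\in\mathbb{R}^d$. -/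

import Mathlib

open MeasureTheory
open scoped ContDiff

noncomputable section

namespace Schrodinger

/-- `G` is the weak gradient of `ψ` on `ℝ^d`: `∫ ψ ∂ᵢη = - ∫ Gᵢ η` for all `η ∈ C_c^∞(ℝ^d)` and
all `i`. (It is used only for `ψ` and `G` in `L²`, where all integrals converge.) -/
def HasWeakGradient {d : ℕ} (ψ : EuclideanSpace ℝ (Fin d) → ℂ)
    (G : EuclideanSpace ℝ (Fin d) → EuclideanSpace ℂ (Fin d)) : Prop :=
  ∀ η : EuclideanSpace ℝ (Fin d) → ℝ, ContDiff ℝ ∞ η → HasCompactSupport η → ∀ i : Fin d,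
    ∫ x, ψ x * ((fderiv ℝ η x (EuclideanSpace.single i 1) : ℝ) : ℂ) = - ∫ x, G x i * (η x : ℂ)

/-- The Sobolev space `H¹(ℝ^d)` of complex-valued functions: `ψ ∈ L²` with a weak gradient
in `L²`. -/
def MemH1 {d : ℕ} (ψ : EuclideanSpace ℝ (Fin d) → ℂ) : Prop :=
  MemLp ψ 2 volume ∧ ∃ G : EuclideanSpace ℝ (Fin d) → EuclideanSpace ℂ (Fin d),
    MemLp G 2 volume ∧ HasWeakGradient ψ G

open Classical in
/-- The weak gradient of `ψ` in `L²` (unique up to null sets); by convention `0` if there is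
none. -/
def weakGradient {d : ℕ} (ψ : EuclideanSpace ℝ (Fin d) → ℂ) :
    EuclideanSpace ℝ (Fin d) → EuclideanSpace ℂ (Fin d) :=
  if h : ∃ G : EuclideanSpace ℝ (Fin d) → EuclideanSpace ℂ (Fin d),
    MemLp G 2 volume ∧ HasWeakGradient ψ G then h.choose else 0

/-- The form domain of `-Δ + V`: all `ψ ∈ H¹(ℝ^d)` with `∫ V₊ |ψ|² < ∞`. -/
def formDomain {d : ℕ} (V : EuclideanSpace ℝ (Fin d) → ℝ) :
    Set (EuclideanSpace ℝ (Fin d) → ℂ) :=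
  {ψ | MemH1 ψ ∧ Integrable (fun x => max (V x) 0 * ‖ψ x‖ ^ 2) volume}

/-- The sesquilinear form `∫ (⟨∇φ, ∇ψ⟩ + V φ̄ ψ) dx` of `-Δ + V`, antilinear in `φ`. -/
def form {d : ℕ} (V : EuclideanSpace ℝ (Fin d) → ℝ)
    (φ ψ : EuclideanSpace ℝ (Fin d) → ℂ) : ℂ :=
  (∫ x, inner ℂ (weakGradient φ x) (weakGradient ψ x))
    + ∫ x, (V x : ℂ) * (starRingEnd ℂ (φ x) * ψ x)

/-- The graph of the operator `-Δ + V` associated with the form: `ψ` lies in the operator domain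
and `(-Δ + V) ψ = f`. -/
def IsImage {d : ℕ} (V : EuclideanSpace ℝ (Fin d) → ℝ)
    (ψ f : EuclideanSpace ℝ (Fin d) → ℂ) : Prop :=
  ψ ∈ formDomain V ∧ MemLp f 2 volume ∧
    ∀ φ ∈ formDomain V, form V φ ψ = ∫ x, starRingEnd ℂ (φ x) * f x

/-- The set of (real) eigenvalues of `-Δ + V`. -/
def eigenvalues {d : ℕ} (V : EuclideanSpace ℝ (Fin d) → ℝ) : Set ℝ :=
  {E | ∃ ψ : EuclideanSpace ℝ (Fin d) → ℂ,
    (¬ ψ =ᵐ[volume] 0) ∧ IsImage V ψ (fun x => (E : ℂ) * ψ x)}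

end Schrodinger

end

/-! Let u = |ψ|² for a normalised ψ, put Z = ∫ e^{-tV}, and multiply the form by t. The Gibbs
variational principle gives t∫Vu ≥ -∫ u log u - log Z, with equality only for u = e^{-tV}/Z. The
sharp Euclidean logarithmic Sobolev inequality `HasScore.logSobolev` with τ = t/4 gives t∫|∇ψ|² ≥ ∫
u log u + d + (d/2) log(πt), with equality only for Gaussian u. In the sum the entropy cancels
(`form_lower_bound`). If the ground state attains the bound, its density is both e^{-tV}/Z and a
Gaussian, so V is quadratic; conversely, for quadratic V a Gaussian trial function reaches the bound
(`groundState_le_of_quadratic`).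

The logarithmic Sobolev inequality comes from the heat flow u_s. The entropy ∫ u_s log u_s decreases
at a rate equal to the Fisher information of u_s, which the Stam-Blachman inequality
`HasScore.fisher_heat_le` bounds by α²I + β²d/(2s) whenever α + β = 1. Taking α = τ/(s+τ),
integrating over (0,S), comparing u_S with the heat kernel and letting S → ∞ gives the sharp
constant. To avoid assuming finite entropy along the flow, r log r is replaced by r log(1 + r/ε),
which is nonnegative and convex with second derivative at most 1/r. For the equality case the flow
is stopped at time τ and the inequality is applied again to u_τ with parameter 2τ. This forces
equality in Stam-Blachman with α = β = 1/2, so the score is affine and u is Gaussian.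

The ground state exists because integrability of e^{-tV} supplies both form boundedness and
compactness. Young's inequality for the pair r log r - r and exp makes the negative part of V form
bounded with arbitrarily small relative bound (`negPart_bound`) and makes the tails of functions of
bounded energy uniformly small (`exists_tail_le`). With mollification this gives compactness in L²
(`exists_convergent_subseq`). The form domain, realised as the closed subspace `formSpace`, is
complete, so the Rayleigh quotient has a minimiser (`exists_rayleigh_minimizer`), and the minimum is
the lowest eigenvalue. -/

namespace Schrodinger
open Filter Topology
open scoped ENNReal

/-! ### Convolution with probability kernels -/

variable {d : ℕ} {F : Type*} [NormedAddCommGroup F] [NormedSpace ℝ F]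

/-- Convolution of a scalar kernel with a vector-valued function. -/
noncomputable def cv (K : EuclideanSpace ℝ (Fin d) → ℝ) (f : EuclideanSpace ℝ (Fin d) → F)
    (x : EuclideanSpace ℝ (Fin d)) : F := ∫ y, K (x - y) • f y

lemma cv_eq_swap (K : EuclideanSpace ℝ (Fin d) → ℝ) (f : EuclideanSpace ℝ (Fin d) → F)
    (x : EuclideanSpace ℝ (Fin d)) : cv K f x = ∫ y, K y • f (x - y) := by
  rw [cv, ← integral_sub_left_eq_self _ _ x]
  simp

lemma cv_eq_convolution (K : EuclideanSpace ℝ (Fin d) → ℝ) (f : EuclideanSpace ℝ (Fin d) → F) :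
    cv K f = convolution K f (ContinuousLinearMap.lsmul ℝ ℝ) volume := by
  ext x
  rw [cv_eq_swap]; rfl

/-- Jensen's inequality for the power q, read off from the monotonicity of L^p norms in p on a
probability space. -/
lemma lintegral_rpow_le_of_prob {α : Type*} [MeasurableSpace α] {μ : Measure α}
    [IsProbabilityMeasure μ] {h : α → ℝ≥0∞} (hh : AEMeasurable h μ) {q : ℝ} (hq : 1 ≤ q) :
    (∫⁻ a, h a ∂μ) ^ q ≤ ∫⁻ a, h a ^ q ∂μ := by
  have h0 : 0 < q := by linarith
  have := eLpNorm'_le_eLpNorm'_of_exponent_le (μ := μ) (f := h) one_pos hq hh.aestronglyMeasurable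
  simp only [eLpNorm', enorm_eq_self, ENNReal.rpow_one, div_one] at this
  calc (∫⁻ a, h a ∂μ) ^ q ≤ ((∫⁻ a, h a ^ q ∂μ) ^ (1 / q)) ^ q := by gcongr
    _ = _ := by rw [← ENNReal.rpow_mul, one_div_mul_cancel h0.ne', ENNReal.rpow_one]

/-- Jensen's inequality and Tonelli's theorem for averages of a family of functions. -/
lemma lintegral_average_rpow_le {α β : Type*} [MeasurableSpace α] [MeasurableSpace β]
    {μ : Measure α} {ν : Measure β} [IsProbabilityMeasure μ] [SFinite ν]
    {H : β → α → ℝ≥0∞} (hH : AEMeasurable (Function.uncurry H) (ν.prod μ)) {q : ℝ} (hq : 1 ≤ q) :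
    ∫⁻ x, (∫⁻ a, H x a ∂μ) ^ q ∂ν ≤ ∫⁻ a, ∫⁻ x, H x a ^ q ∂ν ∂μ := by
  rw [← lintegral_lintegral_swap (f := fun x a => H x a ^ q) (hH.pow_const q)]
  refine lintegral_mono_ae ?_
  filter_upwards [hH.aestronglyMeasurable.prodMk_left] with x hx
  exact lintegral_rpow_le_of_prob hx.aemeasurable hq

/-- A nonnegative kernel with integral one. -/
structure IsProbKernel (K : EuclideanSpace ℝ (Fin d) → ℝ) : Prop where
  nonneg : ∀ x, 0 ≤ K x
  measurable : Measurable K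
  integrable : Integrable K
  integral_eq_one : ∫ x, K x = 1

lemma IsProbKernel.isProbabilityMeasure {K : EuclideanSpace ℝ (Fin d) → ℝ} (hK : IsProbKernel K) :
    IsProbabilityMeasure (volume.withDensity fun x => ENNReal.ofReal (K x)) := by
  refine ⟨?_⟩
  rw [withDensity_apply _ MeasurableSet.univ, Measure.restrict_univ,
    ← ofReal_integral_eq_lintegral_ofReal hK.integrable (.of_forall hK.nonneg),
    hK.integral_eq_one, ENNReal.ofReal_one]

lemma IsProbKernel.lintegral_eq {K : EuclideanSpace ℝ (Fin d) → ℝ} (hK : IsProbKernel K)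
    (h : EuclideanSpace ℝ (Fin d) → ℝ≥0∞) :
    ∫⁻ y, h y ∂(volume.withDensity fun x => ENNReal.ofReal (K x)) =
      ∫⁻ y, ENNReal.ofReal (K y) * h y := by
  rw [lintegral_withDensity_eq_lintegral_mul_non_measurable _ hK.measurable.ennreal_ofReal
    (.of_forall fun x => ENNReal.ofReal_lt_top)]
  rfl

omit [NormedSpace ℝ F] in
lemma aestronglyMeasurable_comp_sub {f : EuclideanSpace ℝ (Fin d) → F}
    (hf : AEStronglyMeasurable f) :
    AEStronglyMeasurable (fun z : EuclideanSpace ℝ (Fin d) × EuclideanSpace ℝ (Fin d) =>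
      f (z.1 - z.2)) (volume.prod volume) :=
  hf.comp_quasiMeasurePreserving (quasiMeasurePreserving_sub_of_right_invariant _ _)

/-- Measurability of (x, y) ↦ f (x - y) is known modulo Lebesgue null sets of the product; this
transfers it to the measure weighted by the kernel. -/
lemma IsProbKernel.prod_ac {K : EuclideanSpace ℝ (Fin d) → ℝ} (hK : IsProbKernel K) :
    (volume : Measure (EuclideanSpace ℝ (Fin d))).prod
      (volume.withDensity fun x => ENNReal.ofReal (K x)) ≪ volume.prod volume := by
  have := hK.isProbabilityMeasure
  exact Measure.AbsolutelyContinuous.rfl.prod (withDensity_absolutelyContinuous _ _)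

lemma enorm_cv_le {K : EuclideanSpace ℝ (Fin d) → ℝ} (hK : IsProbKernel K)
    (f : EuclideanSpace ℝ (Fin d) → F) (x : EuclideanSpace ℝ (Fin d)) :
    ‖cv K f x‖ₑ ≤ ∫⁻ y, ‖f (x - y)‖ₑ ∂(volume.withDensity fun x => ENNReal.ofReal (K x)) := by
  rw [cv_eq_swap, hK.lintegral_eq]
  refine (enorm_integral_le_lintegral_enorm _).trans (le_of_eq ?_)
  simp_rw [enorm_smul, Real.enorm_of_nonneg (hK.nonneg _)]

/-- Young's inequality for a probability kernel. -/
lemma lintegral_cv_rpow_le {K : EuclideanSpace ℝ (Fin d) → ℝ} (hK : IsProbKernel K)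
    {f : EuclideanSpace ℝ (Fin d) → F} (hf : AEStronglyMeasurable f) {q : ℝ} (hq : 1 ≤ q) :
    ∫⁻ x, ‖cv K f x‖ₑ ^ q ≤ ∫⁻ x, ‖f x‖ₑ ^ q := by
  have := hK.isProbabilityMeasure
  calc ∫⁻ x, ‖cv K f x‖ₑ ^ q
      ≤ ∫⁻ x, (∫⁻ y, ‖f (x - y)‖ₑ ∂(volume.withDensity fun x => ENNReal.ofReal (K x))) ^ q := by
        gcongr with x
        exact enorm_cv_le hK f x
    _ ≤ ∫⁻ y, ∫⁻ x, ‖f (x - y)‖ₑ ^ q ∂volume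
          ∂(volume.withDensity fun x => ENNReal.ofReal (K x)) :=
        lintegral_average_rpow_le (H := fun x y => ‖f (x - y)‖ₑ)
          ((aestronglyMeasurable_comp_sub hf).mono_ac hK.prod_ac).enorm hq
    _ = _ := by
        simp_rw [lintegral_sub_right_eq_self (fun x => ‖f x‖ₑ ^ q)]
        simp

lemma enorm_cv_sub_le {K : EuclideanSpace ℝ (Fin d) → ℝ} (hK : IsProbKernel K)
    [CompleteSpace F]
    {f : EuclideanSpace ℝ (Fin d) → F} (hf : AEStronglyMeasurable f)
    (x : EuclideanSpace ℝ (Fin d)) :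
    ‖cv K f x - f x‖ₑ ≤
      ∫⁻ y, ‖f (x - y) - f x‖ₑ ∂(volume.withDensity fun x => ENNReal.ofReal (K x)) := by
  rw [cv_eq_swap, hK.lintegral_eq]
  have hi : Integrable (fun y => K y • f x) := hK.integrable.smul_const _
  have hi' : ∫ y, K y • f x = f x := by rw [integral_smul_const, hK.integral_eq_one, one_smul]
  have hm : AEStronglyMeasurable (fun y => f (x - y)) :=
    hf.comp_quasiMeasurePreserving (quasiMeasurePreserving_sub_left_of_right_invariant _ _)
  have hm' : AEStronglyMeasurable (fun y => K y • (f (x - y) - f x)) :=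
    hK.measurable.aestronglyMeasurable.smul (hm.sub aestronglyMeasurable_const)
  have he : ∫⁻ y, ENNReal.ofReal (K y) * ‖f (x - y) - f x‖ₑ
      = ∫⁻ y, ‖K y • (f (x - y) - f x)‖ₑ := by
    simp_rw [enorm_smul, Real.enorm_of_nonneg (hK.nonneg _)]
  rw [he]
  -- No integrability of `f` is assumed. If the weighted difference is not integrable, the
  -- right-hand side is infinite.
  by_cases h : Integrable (fun y => K y • (f (x - y) - f x))
  · have h2 : Integrable (fun y => K y • f (x - y)) := by
      refine (h.add hi).congr (.of_forall fun y => ?_)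
      simp [smul_sub]
    have : (∫ y, K y • f (x - y)) - f x = ∫ y, K y • (f (x - y) - f x) := by
      simp_rw [smul_sub]
      rw [integral_sub h2 hi, hi']
    rw [this]
    exact enorm_integral_le_lintegral_enorm _
  · have : ∫⁻ y, ‖K y • (f (x - y) - f x)‖ₑ = ⊤ := by
      by_contra hne
      exact h ⟨hm', lt_top_iff_ne_top.2 hne⟩
    rw [this]; exact le_top

/-- The mollification error is controlled by the modulus of continuity of translations. -/
lemma lintegral_cv_sub_rpow_le {K : EuclideanSpace ℝ (Fin d) → ℝ} (hK : IsProbKernel K)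
    [CompleteSpace F]
    {f : EuclideanSpace ℝ (Fin d) → F} (hf : AEStronglyMeasurable f) {q : ℝ} (hq : 1 ≤ q) :
    ∫⁻ x, ‖cv K f x - f x‖ₑ ^ q ≤
      ∫⁻ y, ENNReal.ofReal (K y) * ∫⁻ x, ‖f (x - y) - f x‖ₑ ^ q := by
  have := hK.isProbabilityMeasure
  rw [← hK.lintegral_eq]
  calc ∫⁻ x, ‖cv K f x - f x‖ₑ ^ q
      ≤ ∫⁻ x, (∫⁻ y, ‖f (x - y) - f x‖ₑ
          ∂(volume.withDensity fun x => ENNReal.ofReal (K x))) ^ q := by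
        gcongr with x
        exact enorm_cv_sub_le hK hf x
    _ ≤ _ := lintegral_average_rpow_le (H := fun x y => ‖f (x - y) - f x‖ₑ)
          (((aestronglyMeasurable_comp_sub hf).sub hf.comp_fst).mono_ac hK.prod_ac).enorm hq

/-! ### Weak directional derivatives -/

/-- `g` is the weak derivative of `f` in the direction `v`. -/
def HasWeakDeriv (v : EuclideanSpace ℝ (Fin d)) (f g : EuclideanSpace ℝ (Fin d) → F) : Prop :=
  ∀ η : EuclideanSpace ℝ (Fin d) → ℝ, ContDiff ℝ ∞ η → HasCompactSupport η →
    ∫ x, fderiv ℝ η x v • f x = - ∫ x, η x • g x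

lemma integrable_smul_of_hasCompactSupport {η : EuclideanSpace ℝ (Fin d) → ℝ}
    (hη : Continuous η) (hc : HasCompactSupport η) {f : EuclideanSpace ℝ (Fin d) → F}
    (hf : LocallyIntegrable f) : Integrable (fun x => η x • f x) :=
  hf.integrable_smul_left_of_hasCompactSupport hη hc

lemma continuous_fderiv_dir {η : EuclideanSpace ℝ (Fin d) → ℝ} (hη : ContDiff ℝ ∞ η)
    (v : EuclideanSpace ℝ (Fin d)) : Continuous (fun x => fderiv ℝ η x v) :=
  (hη.continuous_fderiv (by simp)).clm_apply continuous_const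

lemma hasCompactSupport_fderiv_dir {η : EuclideanSpace ℝ (Fin d) → ℝ} (hc : HasCompactSupport η)
    (v : EuclideanSpace ℝ (Fin d)) : HasCompactSupport (fun x => fderiv ℝ η x v) :=
  hc.fderiv_apply ℝ v

lemma HasWeakDeriv.add_dir {v w : EuclideanSpace ℝ (Fin d)} {f g h : EuclideanSpace ℝ (Fin d) → F}
    (hf : LocallyIntegrable f) (hg : LocallyIntegrable g) (hh : LocallyIntegrable h)
    (h1 : HasWeakDeriv v f g) (h2 : HasWeakDeriv w f h) : HasWeakDeriv (v + w) f (g + h) := by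
  intro η hη hc
  simp only [map_add, add_smul, Pi.add_apply, smul_add]
  rw [integral_add, integral_add, h1 η hη hc, h2 η hη hc]
  · abel
  · exact integrable_smul_of_hasCompactSupport hη.continuous hc hg
  · exact integrable_smul_of_hasCompactSupport hη.continuous hc hh
  · exact integrable_smul_of_hasCompactSupport (continuous_fderiv_dir hη v)
      (hasCompactSupport_fderiv_dir hc v) hf
  · exact integrable_smul_of_hasCompactSupport (continuous_fderiv_dir hη w)
      (hasCompactSupport_fderiv_dir hc w) hf

lemma HasWeakDeriv.smul_dir {v : EuclideanSpace ℝ (Fin d)} {f g : EuclideanSpace ℝ (Fin d) → F}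
    (h1 : HasWeakDeriv v f g) (c : ℝ) : HasWeakDeriv (c • v) f (c • g) := by
  intro η hη hc
  simp only [map_smul, smul_eq_mul, mul_smul, Pi.smul_apply, smul_comm _ c]
  rw [integral_smul, integral_smul, h1 η hη hc, smul_neg]

lemma hasWeakDeriv_zero_dir (f : EuclideanSpace ℝ (Fin d) → F) :
    HasWeakDeriv 0 f 0 := by
  intro η hη hc
  simp

omit [NormedSpace ℝ F] in
lemma locallyIntegrable_finsetSum {ι : Type*} {s : Finset ι}
    {g : ι → EuclideanSpace ℝ (Fin d) → F} (hg : ∀ i ∈ s, LocallyIntegrable (g i)) :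
    LocallyIntegrable (∑ i ∈ s, g i) := by
  classical
  induction s using Finset.induction_on with
  | empty => simpa using! locallyIntegrable_zero
  | insert a s ha ih =>
    rw [Finset.sum_insert ha]
    exact (hg a (by simp)).add (ih fun i hi => hg i (by simp [hi]))

lemma HasWeakDeriv.sum_dir {ι : Type*} (s : Finset ι) {v : ι → EuclideanSpace ℝ (Fin d)}
    {f : EuclideanSpace ℝ (Fin d) → F} {g : ι → EuclideanSpace ℝ (Fin d) → F}
    (hf : LocallyIntegrable f) (hg : ∀ i ∈ s, LocallyIntegrable (g i))
    (h : ∀ i ∈ s, HasWeakDeriv (v i) f (g i)) : HasWeakDeriv (∑ i ∈ s, v i) f (∑ i ∈ s, g i) := by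
  classical
  induction s using Finset.induction_on with
  | empty => simpa using hasWeakDeriv_zero_dir f
  | insert a s ha ih =>
    rw [Finset.sum_insert ha, Finset.sum_insert ha]
    refine HasWeakDeriv.add_dir hf (hg a (by simp)) ?_ (h a (by simp))
      (ih (fun i hi => hg i (by simp [hi])) fun i hi => h i (by simp [hi]))
    exact locallyIntegrable_finsetSum fun i hi => hg i (by simp [hi])

lemma HasWeakDeriv.ae_unique [CompleteSpace F] {v : EuclideanSpace ℝ (Fin d)}
    {f g h : EuclideanSpace ℝ (Fin d) → F}
    (hg : LocallyIntegrable g) (hh : LocallyIntegrable h)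
    (h1 : HasWeakDeriv v f g) (h2 : HasWeakDeriv v f h) : g =ᵐ[volume] h :=
  ae_eq_of_integral_contDiff_smul_eq hg hh fun η hη hc => by
    have := (h1 η hη hc).symm.trans (h2 η hη hc)
    simpa using this

end Schrodinger

/-! ### Smooth mollifiers and translation estimates -/

namespace Schrodinger
open Filter Topology
open scoped ENNReal

variable {d : ℕ} {F : Type*} [NormedAddCommGroup F] [NormedSpace ℝ F]

/-- A smooth bump function on `ℝ^d` concentrated on the ball of radius `1 / (n + 1)`. -/
noncomputable def stdBump (d n : ℕ) : ContDiffBump (0 : EuclideanSpace ℝ (Fin d)) where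
  rIn := 1 / (2 * (n + 1))
  rOut := 1 / (n + 1)
  rIn_pos := by positivity
  rIn_lt_rOut := by
    have : (0 : ℝ) < n + 1 := by positivity
    gcongr
    linarith

/-- The standard sequence of smooth mollifiers. -/
noncomputable def moll (d n : ℕ) : EuclideanSpace ℝ (Fin d) → ℝ := (stdBump d n).normed volume

lemma moll_contDiff (d n : ℕ) : ContDiff ℝ ∞ (moll d n) := (stdBump d n).contDiff_normed

lemma moll_hasCompactSupport (d n : ℕ) : HasCompactSupport (moll d n) :=
  (stdBump d n).hasCompactSupport_normed

lemma moll_isProbKernel (d n : ℕ) : IsProbKernel (moll d n) where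
  nonneg := (stdBump d n).nonneg_normed
  measurable := (moll_contDiff d n).continuous.measurable
  integrable := (moll_contDiff d n).continuous.integrable_of_hasCompactSupport
    (moll_hasCompactSupport d n)
  integral_eq_one := (stdBump d n).integral_normed

lemma moll_eq_zero {d n : ℕ} {x : EuclideanSpace ℝ (Fin d)} (hx : 1 / ((n : ℝ) + 1) ≤ ‖x‖) :
    moll d n x = 0 := by
  have := (stdBump d n).support_normed_eq (μ := volume)
  by_contra h
  have hx' : x ∈ Function.support ((stdBump d n).normed volume) := h
  rw [this] at hx'
  simp only [Metric.mem_ball, dist_zero_right] at hx'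
  exact absurd hx' (not_lt.2 hx)

lemma tendsto_stdBump_rOut (d : ℕ) : Tendsto (fun n => (stdBump d n).rOut) atTop (𝓝 0) :=
  tendsto_one_div_add_atTop_nhds_zero_nat

lemma ae_tendsto_cv_moll [CompleteSpace F] {f : EuclideanSpace ℝ (Fin d) → F}
    (hf : LocallyIntegrable f) :
    ∀ᵐ x, Tendsto (fun n => cv (moll d n) f x) atTop (𝓝 (f x)) := by
  simp_rw [cv_eq_convolution]
  -- Lebesgue differentiation needs the ratio of outer to inner radius bounded; for `stdBump` it is
  -- exactly 2.
  refine ContDiffBump.ae_convolution_tendsto_right_of_locallyIntegrable (K := 2)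
    (tendsto_stdBump_rOut d) (.of_forall fun n => ?_) hf
  change 1 / ((n : ℝ) + 1) ≤ 2 * (1 / (2 * (n + 1)))
  have : (0 : ℝ) < n + 1 := by positivity
  field_simp
  exact le_rfl

lemma contDiff_cv_moll [CompleteSpace F] {f : EuclideanSpace ℝ (Fin d) → F}
    (hf : LocallyIntegrable f) (n : ℕ) : ContDiff ℝ ∞ (cv (moll d n) f) := by
  rw [cv_eq_convolution]
  exact (moll_hasCompactSupport d n).contDiff_convolution_left _ (moll_contDiff d n) hf

/-- For fixed x the function y ↦ `moll d n (x - y)` is itself a test function. The sign from the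
chain rule cancels the sign in the definition of the weak derivative. -/
lemma fderiv_cv_moll [CompleteSpace F] {f g : EuclideanSpace ℝ (Fin d) → F}
    {v : EuclideanSpace ℝ (Fin d)} (hf : LocallyIntegrable f) (h : HasWeakDeriv v f g) (n : ℕ)
    (x : EuclideanSpace ℝ (Fin d)) :
    fderiv ℝ (cv (moll d n) f) x v = cv (moll d n) g x := by
  have h1 := (moll_hasCompactSupport d n).hasFDerivAt_convolution_left
    (ContinuousLinearMap.lsmul ℝ ℝ) ((moll_contDiff d n).of_le (by simp)) hf x (μ := volume)
  have hex := (((moll_hasCompactSupport d n).fderiv ℝ).convolutionExists_left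
    ((ContinuousLinearMap.lsmul ℝ ℝ).precompL (EuclideanSpace ℝ (Fin d)))
    ((moll_contDiff d n).continuous_fderiv (by simp)) hf x :
      ConvolutionExistsAt (fderiv ℝ (moll d n)) f x _ volume)
  rw [cv_eq_convolution, h1.fderiv, convolution_def, ContinuousLinearMap.integral_apply hex]
  change ∫ t, fderiv ℝ (moll d n) t v • f (x - t) = _
  rw [← integral_sub_left_eq_self (fun t => fderiv ℝ (moll d n) t v • f (x - t)) _ x]
  simp only [sub_sub_cancel]
  have hη : ContDiff ℝ ∞ fun y => moll d n (x - y) :=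
    (moll_contDiff d n).comp (contDiff_const.sub contDiff_id)
  have hc : HasCompactSupport fun y => moll d n (x - y) :=
    (moll_hasCompactSupport d n).comp_homeomorph (Homeomorph.subLeft x)
  have hd : ∀ y, fderiv ℝ (fun y => moll d n (x - y)) y v = - fderiv ℝ (moll d n) (x - y) v := by
    intro y
    have h2 : HasFDerivAt (moll d n) (fderiv ℝ (moll d n) (x - y)) (x - y) :=
      ((moll_contDiff d n).differentiable (by simp) _).hasFDerivAt
    have h3 := h2.comp y ((hasFDerivAt_id y).const_sub x)
    have h4 := h3.fderiv
    rw [show moll d n ∘ HSub.hSub x = fun y => moll d n (x - y) from rfl] at h4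
    simp [h4]
  have := h _ hη hc
  simp_rw [hd, neg_smul, integral_neg, neg_inj] at this
  exact this

/-- The increment is the average over r in [0,1] of the derivative at x + r • v. Jensen's inequality
moves the power inside, and translation invariance removes r. -/
lemma lintegral_comp_add_le_of_contDiff [CompleteSpace F] {f : EuclideanSpace ℝ (Fin d) → F}
    (hf : ContDiff ℝ 1 f) (v : EuclideanSpace ℝ (Fin d)) {q : ℝ} (hq : 1 ≤ q) :
    ∫⁻ x, ‖f (x + v) - f x‖ₑ ^ q ≤ ∫⁻ x, ‖fderiv ℝ f x v‖ₑ ^ q := by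
  have hc : Continuous fun z : EuclideanSpace ℝ (Fin d) × ℝ => fderiv ℝ f (z.1 + z.2 • v) v :=
    ((hf.continuous_fderiv (by simp)).comp (by fun_prop)).clm_apply continuous_const
  have : IsProbabilityMeasure (volume.restrict (Set.Ioc (0 : ℝ) 1)) := ⟨by simp⟩
  have h1 : ∀ x, ‖f (x + v) - f x‖ₑ ≤ ∫⁻ r in Set.Ioc (0 : ℝ) 1, ‖fderiv ℝ f (x + r • v) v‖ₑ := by
    intro x
    have h2 : ∀ r : ℝ, HasDerivAt (fun r : ℝ => f (x + r • v)) (fderiv ℝ f (x + r • v) v) r := by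
      intro r
      have h3 : HasFDerivAt f (fderiv ℝ f (x + r • v)) (x + r • v) :=
        (hf.differentiable (by simp) _).hasFDerivAt
      have h4 : HasDerivAt (fun r : ℝ => x + r • v) v r := by
        simpa using ((hasDerivAt_id r).smul_const v).const_add x
      exact h3.comp_hasDerivAt r h4
    have h5 : ∫ r in (0 : ℝ)..1, fderiv ℝ f (x + r • v) v = f (x + v) - f x := by
      rw [intervalIntegral.integral_eq_sub_of_hasDerivAt (fun r _ => h2 r)
        (Continuous.intervalIntegrable (hc.comp (by fun_prop : Continuous fun r : ℝ => (x, r))) _ _)]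
      simp
    rw [← h5, intervalIntegral.integral_of_le zero_le_one]
    exact enorm_integral_le_lintegral_enorm _
  calc ∫⁻ x, ‖f (x + v) - f x‖ₑ ^ q
      ≤ ∫⁻ x, (∫⁻ r in Set.Ioc (0 : ℝ) 1, ‖fderiv ℝ f (x + r • v) v‖ₑ) ^ q := by
        gcongr with x
        exact h1 x
    _ ≤ ∫⁻ r in Set.Ioc (0 : ℝ) 1, ∫⁻ x, ‖fderiv ℝ f (x + r • v) v‖ₑ ^ q :=
        lintegral_average_rpow_le (H := fun x (r : ℝ) => ‖fderiv ℝ f (x + r • v) v‖ₑ)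
          hc.enorm.measurable.aemeasurable hq
    _ = _ := by
        simp_rw [lintegral_add_right_eq_self (fun x => ‖fderiv ℝ f x v‖ₑ ^ q)]
        simp

/-- The translation estimate for weakly differentiable functions. -/
lemma HasWeakDeriv.lintegral_translate_le [CompleteSpace F] {f g : EuclideanSpace ℝ (Fin d) → F}
    {v : EuclideanSpace ℝ (Fin d)} (hf : LocallyIntegrable f) (hg : LocallyIntegrable g)
    (h : HasWeakDeriv v f g) {q : ℝ} (hq : 1 ≤ q) :
    ∫⁻ x, ‖f (x + v) - f x‖ₑ ^ q ≤ ∫⁻ x, ‖g x‖ₑ ^ q := by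
  have h0 : 0 ≤ q := by linarith
  -- Mollification turns the weak derivative into a classical one and contracts L^q, so the bound is
  -- uniform in n; Fatou's lemma then passes to the limit.
  have h1 : ∀ n, ∫⁻ x, ‖cv (moll d n) f (x + v) - cv (moll d n) f x‖ₑ ^ q ≤ ∫⁻ x, ‖g x‖ₑ ^ q := by
    intro n
    refine (lintegral_comp_add_le_of_contDiff ((contDiff_cv_moll hf n).of_le (by simp)) v hq).trans ?_
    simp_rw [fderiv_cv_moll hf h n]
    exact lintegral_cv_rpow_le (moll_isProbKernel d n) hg.aestronglyMeasurable hq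
  have h2 := ae_tendsto_cv_moll hf
  have h3 : ∀ᵐ x, Tendsto (fun n => cv (moll d n) f (x + v)) atTop (𝓝 (f (x + v))) :=
    (measurePreserving_add_right volume v).quasiMeasurePreserving.ae h2
  have h4 : ∀ n, Measurable fun x => ‖cv (moll d n) f (x + v) - cv (moll d n) f x‖ₑ ^ q := by
    intro n
    have hc := (contDiff_cv_moll hf n).continuous
    exact ((hc.comp (continuous_add_const v)).sub hc).enorm.measurable.pow_const q
  calc ∫⁻ x, ‖f (x + v) - f x‖ₑ ^ q
      = ∫⁻ x, liminf (fun n => ‖cv (moll d n) f (x + v) - cv (moll d n) f x‖ₑ ^ q) atTop := by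
        refine lintegral_congr_ae ?_
        filter_upwards [h2, h3] with x hx hx'
        have := ((ENNReal.continuous_rpow_const (y := q)).tendsto _).comp (hx'.sub hx).enorm
        exact this.liminf_eq.symm
    _ ≤ liminf (fun n => ∫⁻ x, ‖cv (moll d n) f (x + v) - cv (moll d n) f x‖ₑ ^ q) atTop :=
        lintegral_liminf_le h4
    _ ≤ _ := by
        refine (liminf_le_liminf (.of_forall h1)).trans ?_
        simp

/-- A locally integrable function with vanishing weak gradient is almost everywhere constant. -/
lemma ae_const_of_hasWeakDeriv_zero [CompleteSpace F] {f : EuclideanSpace ℝ (Fin d) → F}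
    (hf : LocallyIntegrable f) (h : ∀ v, HasWeakDeriv v f 0) : ∃ c, ∀ᵐ x, f x = c := by
  -- Every mollification has zero derivative, hence is constant; convergence at a single point then
  -- fixes the limit almost everywhere.
  have h1 : ∀ n x, cv (moll d n) f x = cv (moll d n) f 0 := by
    intro n x
    refine is_const_of_fderiv_eq_zero (𝕜 := ℝ) ((contDiff_cv_moll hf n).differentiable (by simp)) ?_ x 0
    intro y
    ext v
    rw [fderiv_cv_moll hf (h v) n]
    simp [cv]
  have h2 := ae_tendsto_cv_moll hf
  obtain ⟨x₀, hx₀⟩ := h2.exists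
  refine ⟨f x₀, ?_⟩
  filter_upwards [h2] with x hx
  refine tendsto_nhds_unique hx ?_
  simp_rw [fun n => h1 n x, ← fun n => h1 n x₀]
  exact hx₀

end Schrodinger

/-! ### Mollification in `L²` and products of weakly differentiable functions -/

namespace Schrodinger
open Filter Topology
open scoped ENNReal

variable {d : ℕ} {F : Type*} [NormedAddCommGroup F] [NormedSpace ℝ F]

omit [NormedSpace ℝ F] in
/-- Translations are strongly continuous in `L^p`, `p < ∞`. -/
lemma tendsto_eLpNorm_translate {p : ℝ≥0∞} [Fact (1 ≤ p)] (hp : p ≠ ⊤)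
    {f : EuclideanSpace ℝ (Fin d) → F} (hf : MemLp f p) :
    Tendsto (fun y : EuclideanSpace ℝ (Fin d) => eLpNorm (fun x => f (x - y) - f x) p volume)
      (𝓝 0) (𝓝 0) := by
  let g : EuclideanSpace ℝ (Fin d) → C(EuclideanSpace ℝ (Fin d), EuclideanSpace ℝ (Fin d)) :=
    fun y => ⟨fun x => x - y, by fun_prop⟩
  have hg : Continuous g := ContinuousMap.continuous_of_continuous_uncurry _ (by
    change Continuous fun z : EuclideanSpace ℝ (Fin d) × EuclideanSpace ℝ (Fin d) => z.2 - z.1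
    fun_prop)
  have hgm : ∀ y, MeasurePreserving (g y) volume volume := fun y => measurePreserving_sub_right _ y
  have h1 : Continuous fun y => Lp.compMeasurePreserving (g y) (hgm y) hf.toLp :=
    continuous_const.compMeasurePreservingLp hg hgm hp
  have h2 := (h1.tendsto 0)
  have h3 := ((Lp.tendsto_Lp_iff_tendsto_eLpNorm' _ _).1 h2)
  refine h3.congr fun y => eLpNorm_congr_ae ?_
  have e1 : ∀ y, Lp.compMeasurePreserving (g y) (hgm y) hf.toLp =ᵐ[volume] fun x => f (x - y) :=
    fun y => (Lp.coeFn_compMeasurePreserving _ _).trans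
      ((hgm y).quasiMeasurePreserving.ae_eq_comp hf.coeFn_toLp)
  filter_upwards [e1 y, e1 0] with x hx hx'
  rw [Pi.sub_apply, hx, hx', sub_zero]

/-- The mollifier has mass one and vanishes outside the ball of radius 1/(n+1), so only the values
of `mo` on that ball are averaged. -/
lemma lintegral_moll_mul_le {n : ℕ} {mo : EuclideanSpace ℝ (Fin d) → ℝ≥0∞} {C : ℝ≥0∞}
    (h : ∀ y, ‖y‖ < 1 / ((n : ℝ) + 1) → mo y ≤ C) :
    ∫⁻ y, ENNReal.ofReal (moll d n y) * mo y ≤ C := by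
  have hK := moll_isProbKernel d n
  calc ∫⁻ y, ENNReal.ofReal (moll d n y) * mo y ≤ ∫⁻ y, ENNReal.ofReal (moll d n y) * C := by
        refine lintegral_mono fun y => ?_
        by_cases hy : ‖y‖ < 1 / ((n : ℝ) + 1)
        · exact mul_le_mul_right (h y hy) _
        · simp [moll_eq_zero (not_lt.1 hy)]
    _ = C := by
        rw [lintegral_mul_const _ hK.measurable.ennreal_ofReal,
          ← ofReal_integral_eq_lintegral_ofReal hK.integrable (.of_forall hK.nonneg),
          hK.integral_eq_one, ENNReal.ofReal_one, one_mul]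

lemma memLp_cv_moll [CompleteSpace F] {f : EuclideanSpace ℝ (Fin d) → F} (hf : MemLp f 2) (n : ℕ) :
    MemLp (cv (moll d n) f) 2 := by
  have hl : LocallyIntegrable f := hf.locallyIntegrable (by norm_num)
  refine ⟨(contDiff_cv_moll hl n).continuous.aestronglyMeasurable, ?_⟩
  have h1 := hf.2
  rw [eLpNorm_lt_top_iff_lintegral_rpow_enorm_lt_top (by norm_num) (by norm_num)] at h1 ⊢
  exact (lintegral_cv_rpow_le (moll_isProbKernel d n) hf.1 (by norm_num)).trans_lt h1

/-- Mollification converges in `L²`. -/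
lemma tendsto_eLpNorm_cv_moll_sub [CompleteSpace F] {f : EuclideanSpace ℝ (Fin d) → F}
    (hf : MemLp f 2) :
    Tendsto (fun n => eLpNorm (cv (moll d n) f - f) 2 volume) atTop (𝓝 0) := by
  have h1 := tendsto_eLpNorm_translate (by norm_num) hf
  rw [ENNReal.tendsto_nhds_zero] at h1 ⊢
  intro ε hε
  obtain ⟨δ, hδ, hball⟩ := Metric.eventually_nhds_iff_ball.1 (h1 ε hε)
  filter_upwards [(tendsto_one_div_add_atTop_nhds_zero_nat (𝕜 := ℝ)).eventually_lt_const hδ]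
    with n hn
  rw [eLpNorm_eq_lintegral_rpow_enorm_toReal (by norm_num) (by norm_num)]
  simp only [ENNReal.toReal_ofNat, Pi.sub_apply]
  rw [one_div, ENNReal.rpow_inv_le_iff (by norm_num)]
  refine (lintegral_cv_sub_rpow_le (moll_isProbKernel d n) hf.1 (by norm_num)).trans ?_
  refine lintegral_moll_mul_le fun y hy => ?_
  have := hball y (by simpa using hy.trans hn)
  rw [eLpNorm_eq_lintegral_rpow_enorm_toReal (by norm_num) (by norm_num)] at this
  simp only [ENNReal.toReal_ofNat] at this
  rwa [one_div, ENNReal.rpow_inv_le_iff (by norm_num)] at this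

/-- The integral is an inner product in L², hence continuous in its conjugated argument. -/
lemma tendsto_integral_mul_conj {α : Type*} [MeasurableSpace α] {μ : Measure α}
    {h k : α → ℂ} {kn : ℕ → α → ℂ} (hh : MemLp h 2 μ) (hk : MemLp k 2 μ)
    (hkn : ∀ n, MemLp (kn n) 2 μ) (hlim : Tendsto (fun n => eLpNorm (kn n - k) 2 μ) atTop (𝓝 0)) :
    Tendsto (fun n => ∫ x, h x * starRingEnd ℂ (kn n x) ∂μ) atTop
      (𝓝 (∫ x, h x * starRingEnd ℂ (k x) ∂μ)) := by
  have h1 : Tendsto (fun n => (hkn n).toLp) atTop (𝓝 hk.toLp) :=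
    (Lp.tendsto_Lp_iff_tendsto_eLpNorm'' _ hkn _ hk).2 hlim
  have h2 : Tendsto (fun n => inner ℂ (hkn n).toLp hh.toLp) atTop (𝓝 (inner ℂ hk.toLp hh.toLp)) :=
    h1.inner tendsto_const_nhds
  have e : ∀ {k : α → ℂ} (hk : MemLp k 2 μ),
      inner ℂ hk.toLp hh.toLp = ∫ x, h x * starRingEnd ℂ (k x) ∂μ := by
    intro k hk
    rw [L2.inner_def]
    refine integral_congr_ae ?_
    filter_upwards [hk.coeFn_toLp, hh.coeFn_toLp] with x hx hx'
    rw [hx, hx']; rfl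
  simpa only [e] using h2

/-- Real and imaginary parts of ζ are admissible separately. Complex test functions are needed
because the product rule tests against a conjugate of a mollified function. -/
lemma HasWeakDeriv.complex_test {v : EuclideanSpace ℝ (Fin d)}
    {f g : EuclideanSpace ℝ (Fin d) → ℂ} (hf : LocallyIntegrable f) (hg : LocallyIntegrable g)
    (h : HasWeakDeriv v f g) {ζ : EuclideanSpace ℝ (Fin d) → ℂ} (hζ : ContDiff ℝ ∞ ζ)
    (hc : HasCompactSupport ζ) :
    ∫ x, fderiv ℝ ζ x v * f x = - ∫ x, ζ x * g x := by
  have hre : ContDiff ℝ ∞ fun x => (ζ x).re := Complex.reCLM.contDiff.comp hζ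
  have him : ContDiff ℝ ∞ fun x => (ζ x).im := Complex.imCLM.contDiff.comp hζ
  have hcre : HasCompactSupport fun x => (ζ x).re := hc.comp_left (g := Complex.re) rfl
  have hcim : HasCompactSupport fun x => (ζ x).im := hc.comp_left (g := Complex.im) rfl
  have hdre : ∀ x, fderiv ℝ (fun x => (ζ x).re) x v = (fderiv ℝ ζ x v).re := fun x => by
    have := (Complex.reCLM.hasFDerivAt.comp x (hζ.differentiable (by simp) x).hasFDerivAt).fderiv
    rw [show (fun x => (ζ x).re) = Complex.reCLM ∘ ζ from rfl, this]; rfl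
  have hdim : ∀ x, fderiv ℝ (fun x => (ζ x).im) x v = (fderiv ℝ ζ x v).im := fun x => by
    have := (Complex.imCLM.hasFDerivAt.comp x (hζ.differentiable (by simp) x).hasFDerivAt).fderiv
    rw [show (fun x => (ζ x).im) = Complex.imCLM ∘ ζ from rfl, this]; rfl
  have e : ∀ (a b : ℂ), a * b = a.re • b + Complex.I * (a.im • b) := fun a b => by
    rw [Complex.real_smul, Complex.real_smul]
    linear_combination (-b) * Complex.re_add_im a
  have i1 := integrable_smul_of_hasCompactSupport hre.continuous hcre hg
  have i2 := integrable_smul_of_hasCompactSupport him.continuous hcim hg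
  have i3 := integrable_smul_of_hasCompactSupport (continuous_fderiv_dir hre v)
    (hasCompactSupport_fderiv_dir hcre v) hf
  have i4 := integrable_smul_of_hasCompactSupport (continuous_fderiv_dir him v)
    (hasCompactSupport_fderiv_dir hcim v) hf
  have t1 := h _ hre hcre
  have t2 := h _ him hcim
  simp_rw [hdre] at t1 i3
  simp_rw [hdim] at t2 i4
  simp_rw [e (fderiv ℝ ζ _ v), e (ζ _)]
  rw [integral_add i3 (i4.const_mul _), integral_add i1 (i2.const_mul _), integral_const_mul,
    integral_const_mul, t1, t2]
  ring

/-- The product rule for `|f|²`. -/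
lemma HasWeakDeriv.norm_sq {v : EuclideanSpace ℝ (Fin d)}
    {f g : EuclideanSpace ℝ (Fin d) → ℂ} (hf : MemLp f 2) (hg : MemLp g 2)
    (h : HasWeakDeriv v f g) :
    HasWeakDeriv v (fun x => ‖f x‖ ^ 2) (fun x => 2 * (starRingEnd ℂ (f x) * g x).re) := by
  intro η hη hc
  have hfl : LocallyIntegrable f := hf.locallyIntegrable (by norm_num)
  have hgl : LocallyIntegrable g := hg.locallyIntegrable (by norm_num)
  have hbd : ∀ {χ : EuclideanSpace ℝ (Fin d) → ℝ}, Continuous χ → HasCompactSupport χ →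
      MemLp (fun x => (χ x : ℂ)) ⊤ := fun {χ} hχ hcχ => by
    obtain ⟨C, hC⟩ := hcχ.exists_bound_of_continuous hχ
    exact memLp_top_of_bound (Complex.continuous_ofReal.comp hχ).aestronglyMeasurable C
      (.of_forall fun x => by simpa using hC x)
  have hη' := hbd hη.continuous hc
  have hD' := hbd (continuous_fderiv_dir hη v) (hasCompactSupport_fderiv_dir hc v)
  have m1 : MemLp (fun x => (fderiv ℝ η x v : ℂ) * f x) 2 := hf.mul hD'
  have m2 : MemLp (fun x => (η x : ℂ) * f x) 2 := hf.mul hη'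
  have m3 : MemLp (fun x => (η x : ℂ) * g x) 2 := hg.mul hη'
  -- The weak derivative of f is tested against η times the conjugate of the n-th mollification of
  -- f. All three integrals converge because mollifications converge in L².
  have key : ∀ n, (∫ x, (fderiv ℝ η x v : ℂ) * f x * starRingEnd ℂ (cv (moll d n) f x))
      + (∫ x, (η x : ℂ) * f x * starRingEnd ℂ (cv (moll d n) g x))
      = - ∫ x, (η x : ℂ) * g x * starRingEnd ℂ (cv (moll d n) f x) := by
    intro n
    have hfn := contDiff_cv_moll hfl n
    have hcf : ContDiff ℝ ∞ fun x => starRingEnd ℂ (cv (moll d n) f x) :=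
      Complex.conjCLE.contDiff.comp hfn
    have hηC : ContDiff ℝ ∞ fun x => (η x : ℂ) := Complex.ofRealCLM.contDiff.comp hη
    have hζ : ContDiff ℝ ∞ fun x => (η x : ℂ) * starRingEnd ℂ (cv (moll d n) f x) := hηC.mul hcf
    have hζc : HasCompactSupport fun x => (η x : ℂ) * starRingEnd ℂ (cv (moll d n) f x) :=
      (hc.comp_left (g := Complex.ofReal) rfl).mul_right
    have hd : ∀ x, fderiv ℝ (fun x => (η x : ℂ) * starRingEnd ℂ (cv (moll d n) f x)) x v
        = (fderiv ℝ η x v : ℂ) * starRingEnd ℂ (cv (moll d n) f x)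
          + (η x : ℂ) * starRingEnd ℂ (cv (moll d n) g x) := by
      intro x
      have a1 : HasFDerivAt (fun x => (η x : ℂ)) (Complex.ofRealCLM ∘L fderiv ℝ η x) x :=
        Complex.ofRealCLM.hasFDerivAt.comp x (hη.differentiable (by simp) x).hasFDerivAt
      have a2 : HasFDerivAt (fun x => starRingEnd ℂ (cv (moll d n) f x))
          ((Complex.conjCLE : ℂ →L[ℝ] ℂ) ∘L fderiv ℝ (cv (moll d n) f) x) x :=
        (Complex.conjCLE : ℂ →L[ℝ] ℂ).hasFDerivAt.comp x
          (hfn.differentiable (by simp) x).hasFDerivAt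
      rw [show (fun x => (η x : ℂ) * starRingEnd ℂ (cv (moll d n) f x)) = (fun x => (η x : ℂ)) *
        fun x => starRingEnd ℂ (cv (moll d n) f x) from rfl, (a1.mul a2).fderiv]
      simp [fderiv_cv_moll hfl h]
      ring
    have := h.complex_test hfl hgl hζ hζc
    simp_rw [hd] at this
    rw [← integral_add]
    · convert this using 1
      · refine integral_congr_ae (.of_forall fun x => ?_)
        ring
      · congr 1
        refine integral_congr_ae (.of_forall fun x => ?_)
        ring
    · exact m1.integrable_mul (memLp_cv_moll hf n).star
    · exact m2.integrable_mul (memLp_cv_moll hg n).star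
  have l1 := tendsto_integral_mul_conj m1 hf (memLp_cv_moll hf) (tendsto_eLpNorm_cv_moll_sub hf)
  have l2 := tendsto_integral_mul_conj m2 hg (memLp_cv_moll hg) (tendsto_eLpNorm_cv_moll_sub hg)
  have l3 := tendsto_integral_mul_conj m3 hf (memLp_cv_moll hf) (tendsto_eLpNorm_cv_moll_sub hf)
  have lim := tendsto_nhds_unique ((l1.add l2).congr key) l3.neg
  have j2 : Integrable fun x => (η x : ℂ) * f x * starRingEnd ℂ (g x) := m2.integrable_mul hg.star
  have j3 : Integrable fun x => (η x : ℂ) * g x * starRingEnd ℂ (f x) := m3.integrable_mul hf.star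
  have e1 : ∫ x, (fderiv ℝ η x v : ℂ) * f x * starRingEnd ℂ (f x)
      = ((∫ x, fderiv ℝ η x v • ‖f x‖ ^ 2 : ℝ) : ℂ) := by
    rw [← integral_complex_ofReal]
    refine integral_congr_ae (.of_forall fun x => ?_)
    simp only
    rw [mul_assoc, Complex.mul_conj, Complex.normSq_eq_norm_sq]
    simp
  have e2 : (∫ x, (η x : ℂ) * f x * starRingEnd ℂ (g x)) + ∫ x, (η x : ℂ) * g x * starRingEnd ℂ (f x)
      = ((∫ x, η x • (2 * (starRingEnd ℂ (f x) * g x).re) : ℝ) : ℂ) := by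
    rw [← integral_add j2 j3, ← integral_complex_ofReal]
    refine integral_congr_ae (.of_forall fun x => ?_)
    apply Complex.ext <;> simp <;> ring
  have : ((∫ x, fderiv ℝ η x v • ‖f x‖ ^ 2 : ℝ) : ℂ)
      = ((-∫ x, η x • (2 * (starRingEnd ℂ (f x) * g x).re) : ℝ) : ℂ) := by
    rw [← e1, Complex.ofReal_neg, ← e2]
    linear_combination lim
  exact_mod_cast this

/-- For integrable functions, the test function need only be bounded together with its
derivative. -/
lemma HasWeakDeriv.bounded_test {v : EuclideanSpace ℝ (Fin d)}
    {u g : EuclideanSpace ℝ (Fin d) → ℝ} (hu : Integrable u) (hg : Integrable g)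
    (h : HasWeakDeriv v u g) {η : EuclideanSpace ℝ (Fin d) → ℝ} (hη : ContDiff ℝ ∞ η) {C : ℝ}
    (hC : ∀ x, |η x| ≤ C) (hC' : ∀ x, |fderiv ℝ η x v| ≤ C) :
    ∫ x, fderiv ℝ η x v * u x = - ∫ x, η x * g x := by
  -- The cutoffs `χ n` are dilations of one bump, equal to 1 on balls of radius n+1, with
  -- derivatives of size O(1/n). Dominated convergence therefore removes them.
  let b : ContDiffBump (0 : EuclideanSpace ℝ (Fin d)) := ⟨1, 2, one_pos, one_lt_two⟩
  have hb : ContDiff ℝ ∞ b := b.contDiff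
  let χ : ℕ → EuclideanSpace ℝ (Fin d) → ℝ := fun n x => b (((n : ℝ) + 1)⁻¹ • x)
  have hχ : ∀ n, ContDiff ℝ ∞ (χ n) := fun n => hb.comp (contDiff_const_smul _)
  have hn : ∀ n : ℕ, ((n : ℝ) + 1)⁻¹ ≠ 0 := fun n => by positivity
  have hχc : ∀ n, HasCompactSupport (χ n) := fun n =>
    b.hasCompactSupport.comp_homeomorph (Homeomorph.smulOfNeZero _ (hn n))
  obtain ⟨D, hD⟩ := (hasCompactSupport_fderiv_dir b.hasCompactSupport v).exists_bound_of_continuous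
    (continuous_fderiv_dir hb v)
  have hdχ : ∀ n x, fderiv ℝ (χ n) x v
      = ((n : ℝ) + 1)⁻¹ * fderiv ℝ b (((n : ℝ) + 1)⁻¹ • x) v := by
    intro n x
    have h1 : HasFDerivAt b (fderiv ℝ b (((n : ℝ) + 1)⁻¹ • x)) (((n : ℝ) + 1)⁻¹ • x) :=
      (hb.differentiable (by simp) _).hasFDerivAt
    have h2 : HasFDerivAt (χ n) _ x := h1.comp x ((hasFDerivAt_id x).const_smul ((n : ℝ) + 1)⁻¹)
    rw [h2.fderiv]
    simp
  have hχ1 : ∀ x, Tendsto (fun n => χ n x) atTop (𝓝 1) := by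
    intro x
    have t1 : Tendsto (fun n : ℕ => ((n : ℝ) + 1)⁻¹ • x) atTop (𝓝 0) := by
      simpa using (tendsto_one_div_add_atTop_nhds_zero_nat (𝕜 := ℝ)).smul_const x
    have t2 := (hb.continuous.tendsto 0).comp t1
    rwa [b.one_of_mem_closedBall (by simp [b])] at t2
  have hC0 : 0 ≤ C := (abs_nonneg _).trans (hC 0)
  have hD0 : 0 ≤ D := (norm_nonneg _).trans (hD 0)
  have key : ∀ n, ∫ x, (fderiv ℝ η x v * χ n x + η x * fderiv ℝ (χ n) x v) * u x
      = - ∫ x, (η x * χ n x) * g x := by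
    intro n
    have := h (fun x => η x * χ n x) (hη.mul (hχ n)) (hχc n).mul_left
    simp only [smul_eq_mul] at this
    rw [← this]
    refine integral_congr_ae (.of_forall fun x => ?_)
    simp only
    have a := (hη.differentiable (by simp) x).hasFDerivAt.mul
      ((hχ n).differentiable (by simp) x).hasFDerivAt
    have e : fderiv ℝ (fun x => η x * χ n x) x v = fderiv ℝ η x v * χ n x
        + η x * fderiv ℝ (χ n) x v := by
      rw [show (fun x => η x * χ n x) = η * χ n from rfl, a.fderiv]
      simp
      ring
    rw [e]
  have l1 : Tendsto (fun n => ∫ x, (fderiv ℝ η x v * χ n x + η x * fderiv ℝ (χ n) x v) * u x)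
      atTop (𝓝 (∫ x, fderiv ℝ η x v * u x)) := by
    refine tendsto_integral_of_dominated_convergence (fun x => (C + C * D) * |u x|) ?_
      (hu.abs.const_mul _) ?_ ?_
    · intro n
      exact (((continuous_fderiv_dir hη v).mul (hχ n).continuous).add
        (hη.continuous.mul (continuous_fderiv_dir (hχ n) v))).aestronglyMeasurable.mul hu.1
    · intro n
      refine .of_forall fun x => ?_
      rw [Real.norm_eq_abs, abs_mul]
      gcongr
      refine (abs_add_le _ _).trans ?_
      rw [abs_mul, abs_mul]
      have b1 : |χ n x| ≤ 1 := by rw [abs_of_nonneg b.nonneg]; exact b.le_one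
      have b2 : |fderiv ℝ (χ n) x v| ≤ D := by
        rw [hdχ, abs_mul, abs_of_pos (by positivity)]
        calc _ ≤ 1 * D := by
              gcongr
              · apply inv_le_one_of_one_le₀; linarith [(n.cast_nonneg : (0 : ℝ) ≤ n)]
              · exact hD _
          _ = D := one_mul D
      have := mul_le_mul (hC' x) b1 (abs_nonneg _) hC0
      have := mul_le_mul (hC x) b2 (abs_nonneg _) hC0
      linarith
    · refine .of_forall fun x => ?_
      have t3 : Tendsto (fun n => fderiv ℝ (χ n) x v) atTop (𝓝 0) := by
        refine squeeze_zero_norm (a := fun n : ℕ => 1 / ((n : ℝ) + 1) * D) (fun n => ?_) ?_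
        · rw [hdχ, norm_mul, one_div, Real.norm_of_nonneg (by positivity)]
          gcongr
          exact hD _
        · simpa using (tendsto_one_div_add_atTop_nhds_zero_nat (𝕜 := ℝ)).mul_const D
      simpa using (((hχ1 x).const_mul (fderiv ℝ η x v)).add (t3.const_mul (η x))).mul_const (u x)
  have l2 : Tendsto (fun n => ∫ x, (η x * χ n x) * g x) atTop (𝓝 (∫ x, η x * g x)) := by
    refine tendsto_integral_of_dominated_convergence (fun x => C * |g x|) ?_
      (hg.abs.const_mul _) ?_ ?_
    · intro n
      exact (hη.continuous.mul (hχ n).continuous).aestronglyMeasurable.mul hg.1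
    · intro n
      refine .of_forall fun x => ?_
      rw [Real.norm_eq_abs, abs_mul, abs_mul]
      have b1 : |χ n x| ≤ 1 := by rw [abs_of_nonneg b.nonneg]; exact b.le_one
      gcongr
      exact (mul_le_mul (hC x) b1 (abs_nonneg _) hC0).trans (mul_one C).le
    · refine .of_forall fun x => ?_
      simpa using ((hχ1 x).const_mul (η x)).mul_const (g x)
  exact tendsto_nhds_unique (l1.congr key) l2.neg

end Schrodinger

namespace Schrodinger
open Filter Topology
open scoped ENNReal

variable {d : ℕ}

/-! ### The heat kernel -/

/-- The heat kernel on `ℝ^d`. -/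
noncomputable def heat (s : ℝ) (x : EuclideanSpace ℝ (Fin d)) : ℝ :=
  (4 * Real.pi * s) ^ (-(d / 2 : ℝ)) * Real.exp (-(1 / (4 * s)) * ‖x‖ ^ 2)

/-- The derivative of the heat kernel in the `i`-th direction. -/
noncomputable def heatD (i : Fin d) (s : ℝ) (x : EuclideanSpace ℝ (Fin d)) : ℝ :=
  -(x i / (2 * s)) * heat s x

/-- The second derivative of the heat kernel in the `i`-th direction. -/
noncomputable def heatDD (i : Fin d) (s : ℝ) (x : EuclideanSpace ℝ (Fin d)) : ℝ :=
  (x i ^ 2 / (4 * s ^ 2) - 1 / (2 * s)) * heat s x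

variable {s : ℝ}

lemma heat_const_pos (hs : 0 < s) : 0 < (4 * Real.pi * s) ^ (-(d / 2 : ℝ)) :=
  Real.rpow_pos_of_pos (by positivity) _

lemma heat_pos (hs : 0 < s) (x : EuclideanSpace ℝ (Fin d)) : 0 < heat s x :=
  mul_pos (heat_const_pos hs) (Real.exp_pos _)

lemma heat_le (hs : 0 < s) (x : EuclideanSpace ℝ (Fin d)) :
    heat s x ≤ (4 * Real.pi * s) ^ (-(d / 2 : ℝ)) := by
  refine mul_le_of_le_one_right (heat_const_pos hs).le (Real.exp_le_one_iff.2 ?_)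
  rw [neg_mul, neg_nonpos]
  positivity

lemma heat_contDiff (s : ℝ) : ContDiff ℝ ∞ (heat s : EuclideanSpace ℝ (Fin d) → ℝ) :=
  contDiff_const.mul ((contDiff_const.mul (contDiff_norm_sq ℝ)).exp)

lemma heat_continuous (s : ℝ) : Continuous (heat s : EuclideanSpace ℝ (Fin d) → ℝ) :=
  (heat_contDiff s).continuous

lemma heatD_continuous (i : Fin d) (s : ℝ) : Continuous (heatD i s) := by
  have := heat_continuous (d := d) s
  unfold heatD
  fun_prop

lemma heatDD_continuous (i : Fin d) (s : ℝ) : Continuous (heatDD i s) := by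
  have := heat_continuous (d := d) s
  unfold heatDD
  fun_prop

lemma integral_exp_neg_mul_sq {b : ℝ} (hb : 0 < b) :
    ∫ x : EuclideanSpace ℝ (Fin d), Real.exp (-b * ‖x‖ ^ 2) = (Real.pi / b) ^ (d / 2 : ℝ) := by
  have := GaussianFourier.integral_rexp_neg_mul_sq_norm (V := EuclideanSpace ℝ (Fin d)) hb
  simpa using this

lemma integrable_exp_neg_mul_sq {b : ℝ} (hb : 0 < b) :
    Integrable fun x : EuclideanSpace ℝ (Fin d) => Real.exp (-b * ‖x‖ ^ 2) := by
  refine Integrable.of_integral_ne_zero ?_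
  rw [integral_exp_neg_mul_sq hb]
  exact (Real.rpow_pos_of_pos (by positivity) _).ne'

lemma heat_isProbKernel (hs : 0 < s) :
    IsProbKernel (heat s : EuclideanSpace ℝ (Fin d) → ℝ) where
  nonneg x := (heat_pos hs x).le
  measurable := (heat_continuous s).measurable
  integrable := (integrable_exp_neg_mul_sq (by positivity)).const_mul _
  integral_eq_one := by
    unfold heat
    rw [integral_const_mul, integral_exp_neg_mul_sq (by positivity),
      show Real.pi / (1 / (4 * s)) = 4 * Real.pi * s by field_simp,
      ← Real.rpow_add (by positivity), neg_add_cancel, Real.rpow_zero]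

lemma hasLineDerivAt_norm_sq (i : Fin d) (x : EuclideanSpace ℝ (Fin d)) :
    HasLineDerivAt ℝ (fun x : EuclideanSpace ℝ (Fin d) => ‖x‖ ^ 2) (2 * x i) x
      (EuclideanSpace.single i 1) := by
  have h := (hasStrictFDerivAt_norm_sq x).hasFDerivAt.hasLineDerivAt (EuclideanSpace.single i 1)
  simpa [EuclideanSpace.inner_single_right] using h

lemma hasLineDerivAt_coord (i : Fin d) (x : EuclideanSpace ℝ (Fin d)) :
    HasLineDerivAt ℝ (fun x : EuclideanSpace ℝ (Fin d) => x i) 1 x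
      (EuclideanSpace.single i 1) := by
  have h := (EuclideanSpace.proj i : EuclideanSpace ℝ (Fin d) →L[ℝ] ℝ).hasFDerivAt (x := x)
  have h2 := h.hasLineDerivAt (EuclideanSpace.single i 1)
  have h3 : (EuclideanSpace.proj i : EuclideanSpace ℝ (Fin d) →L[ℝ] ℝ) (EuclideanSpace.single i 1)
      = 1 := by simp
  rw [h3] at h2
  exact h2

lemma hasLineDerivAt_heat (i : Fin d) (hs : 0 < s) (x : EuclideanSpace ℝ (Fin d)) :
    HasLineDerivAt ℝ (heat s) (heatD i s x) x (EuclideanSpace.single i 1) := by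
  have h := hasLineDerivAt_norm_sq i x
  unfold HasLineDerivAt at h ⊢
  have h2 := ((h.const_mul (-(1 / (4 * s)))).exp).const_mul ((4 * Real.pi * s) ^ (-(d / 2 : ℝ)))
  refine h2.congr_deriv ?_
  simp only [heatD, heat, zero_smul, add_zero]
  field_simp
  ring

lemma hasLineDerivAt_heatD (i : Fin d) (hs : 0 < s) (x : EuclideanSpace ℝ (Fin d)) :
    HasLineDerivAt ℝ (heatD i s) (heatDD i s x) x (EuclideanSpace.single i 1) := by
  have h := hasLineDerivAt_heat i hs x
  have h1 := hasLineDerivAt_coord i x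
  unfold HasLineDerivAt at h h1 ⊢
  refine (((h1.div_const (2 * s)).neg).mul h).congr_deriv ?_
  simp only [heatD, heatDD, zero_smul, add_zero, Pi.neg_apply]
  field_simp
  ring

lemma coord_sq_le (i : Fin d) (x : EuclideanSpace ℝ (Fin d)) : x i ^ 2 ≤ ‖x‖ ^ 2 := by
  have := EuclideanSpace.norm_sq_eq x
  rw [this]
  have h := Finset.single_le_sum (f := fun i => ‖x i‖ ^ 2) (fun j _ => sq_nonneg _)
    (Finset.mem_univ i)
  simpa using h

/-- The exponent is first weakened from s to S and then split in half; one half absorbs the factor 1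
+ r² through x + 1 ≤ exp x. -/
lemma sq_mul_exp_le {S s r : ℝ} (hs : 0 < s) (hS : s ≤ S) :
    (1 + r ^ 2) * Real.exp (-(1 / (4 * s)) * r ^ 2) ≤
      (1 + 8 * S) * Real.exp (-(1 / (8 * S)) * r ^ 2) := by
  have hS0 : 0 < S := hs.trans_le hS
  have h1 : Real.exp (-(1 / (4 * s)) * r ^ 2) ≤ Real.exp (-(1 / (4 * S)) * r ^ 2) := by
    gcongr
  have h2 : Real.exp (-(1 / (4 * S)) * r ^ 2)
      = Real.exp (-(1 / (8 * S)) * r ^ 2) * Real.exp (-(1 / (8 * S)) * r ^ 2) := by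
    rw [← Real.exp_add]; congr 1; field_simp; ring
  have h3 : (1 + r ^ 2) * Real.exp (-(1 / (8 * S)) * r ^ 2) ≤ 1 + 8 * S := by
    have h4 := Real.add_one_le_exp (1 / (8 * S) * r ^ 2)
    have h5 : r ^ 2 ≤ 8 * S * Real.exp (1 / (8 * S) * r ^ 2) := by
      have : r ^ 2 = 8 * S * (1 / (8 * S) * r ^ 2) := by field_simp
      nlinarith
    have h6 : 1 ≤ Real.exp (1 / (8 * S) * r ^ 2) := Real.one_le_exp (by positivity)
    calc (1 + r ^ 2) * Real.exp (-(1 / (8 * S)) * r ^ 2)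
        ≤ ((1 + 8 * S) * Real.exp (1 / (8 * S) * r ^ 2)) * Real.exp (-(1 / (8 * S)) * r ^ 2) := by
          gcongr; nlinarith
      _ = 1 + 8 * S := by rw [mul_assoc, ← Real.exp_add]; simp
  calc (1 + r ^ 2) * Real.exp (-(1 / (4 * s)) * r ^ 2)
      ≤ (1 + r ^ 2) * Real.exp (-(1 / (4 * S)) * r ^ 2) := by gcongr
    _ = ((1 + r ^ 2) * Real.exp (-(1 / (8 * S)) * r ^ 2)) * Real.exp (-(1 / (8 * S)) * r ^ 2) := by
        rw [h2]; ring
    _ ≤ _ := by gcongr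

/-- A Gaussian majorant of the heat kernel and its derivatives, uniform for times in `[s₀, S]`. -/
noncomputable def heatBound (s₀ S : ℝ) (x : EuclideanSpace ℝ (Fin d)) : ℝ :=
  (1 + 1 / s₀ + 1 / s₀ ^ 2) * (4 * Real.pi * s₀) ^ (-(d / 2 : ℝ)) * (1 + 8 * S)
    * Real.exp (-(1 / (8 * S)) * ‖x‖ ^ 2)

/-- On [s₀, S] the normalising constant is largest at s₀ and the Gaussian is widest at S. The factor
in 1/s₀ dominates the coefficients 1/(2s) and 1/(4s²) that differentiation produces. -/
lemma sq_mul_heat_le {s₀ S : ℝ} (h0 : 0 < s₀) (hs : s₀ ≤ s) (hS : s ≤ S)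
    (x : EuclideanSpace ℝ (Fin d)) :
    (1 + 1 / s₀ + 1 / s₀ ^ 2) * ((1 + ‖x‖ ^ 2) * heat s x) ≤ heatBound s₀ S x := by
  have hs0 : 0 < s := h0.trans_le hs
  have h1 := sq_mul_exp_le (r := ‖x‖) hs0 hS
  have h2 : (4 * Real.pi * s) ^ (-(d / 2 : ℝ)) ≤ (4 * Real.pi * s₀) ^ (-(d / 2 : ℝ)) :=
    Real.rpow_le_rpow_of_nonpos (by positivity) (by gcongr) (by
      have : (0 : ℝ) ≤ d := Nat.cast_nonneg d
      linarith)
  have h3 : (1 + ‖x‖ ^ 2) * heat s x = (4 * Real.pi * s) ^ (-(d / 2 : ℝ)) *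
      ((1 + ‖x‖ ^ 2) * Real.exp (-(1 / (4 * s)) * ‖x‖ ^ 2)) := by unfold heat; ring
  rw [h3, heatBound, mul_assoc (_ * _), mul_assoc (1 + 1 / s₀ + 1 / s₀ ^ 2)]
  have := heat_const_pos (d := d) h0
  gcongr

lemma abs_heat_le {s₀ S : ℝ} (h0 : 0 < s₀) (hs : s₀ ≤ s) (hS : s ≤ S)
    (x : EuclideanSpace ℝ (Fin d)) : |heat s x| ≤ heatBound s₀ S x := by
  refine le_trans ?_ (sq_mul_heat_le h0 hs hS x)
  have h1 := heat_pos (h0.trans_le hs) x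
  rw [abs_of_pos h1, ← mul_assoc]
  refine le_mul_of_one_le_left h1.le ?_
  refine one_le_mul_of_one_le_of_one_le ?_ ?_
  · have : 0 < 1 / s₀ := by positivity
    have : 0 < 1 / s₀ ^ 2 := by positivity
    linarith
  · have := sq_nonneg ‖x‖; linarith

lemma abs_heatD_le {s₀ S : ℝ} (i : Fin d) (h0 : 0 < s₀) (hs : s₀ ≤ s) (hS : s ≤ S)
    (x : EuclideanSpace ℝ (Fin d)) : |heatD i s x| ≤ heatBound s₀ S x := by
  refine le_trans ?_ (sq_mul_heat_le h0 hs hS x)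
  have hs0 := h0.trans_le hs
  have h1 := heat_pos hs0 x
  rw [heatD, abs_mul, abs_of_pos h1, ← mul_assoc, abs_neg, abs_div, abs_of_pos (by linarith : 0 < 2 * s)]
  gcongr
  have h2 : |x i| ≤ 1 + ‖x‖ ^ 2 := by
    have := coord_sq_le i x
    nlinarith [sq_nonneg (|x i| - 1), sq_abs (x i)]
  rw [div_eq_mul_one_div, mul_comm]
  have h3 : 1 / (2 * s) ≤ 1 / s₀ := one_div_le_one_div_of_le h0 (by linarith)
  have : 0 < 1 / s₀ := by positivity
  have : 0 < 1 / s₀ ^ 2 := by positivity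
  gcongr
  linarith

lemma abs_heatDD_le {s₀ S : ℝ} (i : Fin d) (h0 : 0 < s₀) (hs : s₀ ≤ s) (hS : s ≤ S)
    (x : EuclideanSpace ℝ (Fin d)) : |heatDD i s x| ≤ heatBound s₀ S x := by
  refine le_trans ?_ (sq_mul_heat_le h0 hs hS x)
  have hs0 := h0.trans_le hs
  have h1 := heat_pos hs0 x
  rw [heatDD, abs_mul, abs_of_pos h1, ← mul_assoc]
  gcongr
  have h2 := coord_sq_le i x
  have h3 : 1 / (2 * s) ≤ 1 / s₀ := one_div_le_one_div_of_le h0 (by linarith)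
  have h4 : 1 / (4 * s ^ 2) ≤ 1 / s₀ ^ 2 :=
    one_div_le_one_div_of_le (by positivity) (by nlinarith)
  have h5 : 0 < 1 / s₀ := by positivity
  have h6 : 0 < 1 / s₀ ^ 2 := by positivity
  have h7 : 0 < 1 / (2 * s) := by positivity
  have h8 : 0 ≤ x i ^ 2 / (4 * s ^ 2) := by positivity
  have h9 : x i ^ 2 / (4 * s ^ 2) ≤ ‖x‖ ^ 2 * (1 / s₀ ^ 2) := by
    rw [div_eq_mul_one_div]
    gcongr
  rw [abs_le]
  constructor <;> nlinarith [sq_nonneg ‖x‖]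

lemma heatBound_continuous (s₀ S : ℝ) :
    Continuous (heatBound s₀ S : EuclideanSpace ℝ (Fin d) → ℝ) := by
  unfold heatBound; fun_prop

lemma heatBound_integrable (s₀ : ℝ) {S : ℝ} (hS : 0 < S) :
    Integrable (heatBound s₀ S : EuclideanSpace ℝ (Fin d) → ℝ) :=
  (integrable_exp_neg_mul_sq (by positivity)).const_mul _

lemma heatBound_le {s₀ S : ℝ} (h0 : 0 < s₀) (hS : 0 < S) (x : EuclideanSpace ℝ (Fin d)) :
    heatBound s₀ S x ≤ heatBound s₀ S (0 : EuclideanSpace ℝ (Fin d)) := by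
  unfold heatBound
  have := heat_const_pos (d := d) h0
  refine mul_le_mul_of_nonneg_left (Real.exp_le_exp.2 ?_) (by positivity)
  have : 0 ≤ 1 / (8 * S) * ‖x‖ ^ 2 := by positivity
  simpa using this

lemma heatD_integrable (i : Fin d) (hs : 0 < s) : Integrable (heatD i s) :=
  (heatBound_integrable s hs).mono' (heatD_continuous i s).aestronglyMeasurable
    (.of_forall fun x => abs_heatD_le i hs le_rfl le_rfl x)

lemma heatDD_integrable (i : Fin d) (hs : 0 < s) : Integrable (heatDD i s) :=
  (heatBound_integrable s hs).mono' (heatDD_continuous i s).aestronglyMeasurable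
    (.of_forall fun x => abs_heatDD_le i hs le_rfl le_rfl x)

/-- Integration by parts against the constant function 1. -/
lemma integral_lineDeriv_eq_zero {f f' : EuclideanSpace ℝ (Fin d) → ℝ}
    {v : EuclideanSpace ℝ (Fin d)} (hf : Integrable f) (hf' : Integrable f')
    (h : ∀ x, HasLineDerivAt ℝ f (f' x) x v) : ∫ x, f' x = 0 := by
  have := integral_bilinear_hasLineDerivAt_right_eq_neg_left_of_integrable
    (f := fun _ => (1 : ℝ)) (f' := fun _ => (0 : ℝ)) (g := f) (g' := f') (v := v)
    (B := ContinuousLinearMap.mul ℝ ℝ) (μ := volume) (by simp) (by simpa using hf')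
    (by simpa using hf) (fun x _ => by
      unfold HasLineDerivAt; exact hasDerivAt_const _ _) (fun x _ => h x)
  simpa using this

lemma integral_heatD (i : Fin d) (hs : 0 < s) : ∫ x, heatD i s x = 0 :=
  integral_lineDeriv_eq_zero (heat_isProbKernel hs).integrable (heatD_integrable i hs)
    (hasLineDerivAt_heat i hs)

/-- The density of the Fisher information of the heat kernel in the `i`-th direction. -/
noncomputable def heatFisher (i : Fin d) (s : ℝ) (x : EuclideanSpace ℝ (Fin d)) : ℝ :=
  (x i / (2 * s)) ^ 2 * heat s x

lemma heatFisher_eq (i : Fin d) (hs : 0 < s) (x : EuclideanSpace ℝ (Fin d)) :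
    heatFisher i s x = heatDD i s x + 1 / (2 * s) * heat s x := by
  unfold heatFisher heatDD; field_simp; ring

lemma heatFisher_continuous (i : Fin d) (s : ℝ) : Continuous (heatFisher i s) := by
  have := heat_continuous (d := d) s
  unfold heatFisher
  fun_prop

lemma heatFisher_integrable (i : Fin d) (hs : 0 < s) : Integrable (heatFisher i s) := by
  simp_rw [funext fun x => heatFisher_eq i hs x]
  exact (heatDD_integrable i hs).add ((heat_isProbKernel hs).integrable.const_mul _)

/-- The second derivative of the kernel integrates to zero, which leaves 1/(2s) times the total
mass. -/
lemma integral_heatFisher (i : Fin d) (hs : 0 < s) : ∫ x, heatFisher i s x = 1 / (2 * s) := by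
  simp_rw [heatFisher_eq i hs]
  rw [integral_add (heatDD_integrable i hs) ((heat_isProbKernel hs).integrable.const_mul _),
    integral_const_mul, (heat_isProbKernel hs).integral_eq_one,
    integral_lineDeriv_eq_zero (heatD_integrable i hs) (heatDD_integrable i hs)
      (hasLineDerivAt_heatD i hs)]
  ring

lemma norm_sq_mul_heat (hs : 0 < s) (x : EuclideanSpace ℝ (Fin d)) :
    ‖x‖ ^ 2 * heat s x = 4 * s ^ 2 * ∑ i, heatFisher i s x := by
  rw [EuclideanSpace.norm_sq_eq, Finset.sum_mul, Finset.mul_sum]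
  refine Finset.sum_congr rfl fun i _ => ?_
  unfold heatFisher
  rw [Real.norm_eq_abs, sq_abs]
  field_simp
  norm_num

lemma integrable_norm_sq_mul_heat (hs : 0 < s) :
    Integrable fun x : EuclideanSpace ℝ (Fin d) => ‖x‖ ^ 2 * heat s x := by
  simp_rw [norm_sq_mul_heat hs]
  exact (integrable_finsetSum _ fun i _ => heatFisher_integrable i hs).const_mul _

lemma integral_norm_sq_mul_heat (hs : 0 < s) :
    ∫ x : EuclideanSpace ℝ (Fin d), ‖x‖ ^ 2 * heat s x = 2 * d * s := by
  simp_rw [norm_sq_mul_heat hs]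
  rw [integral_const_mul, integral_finsetSum _ fun i _ => heatFisher_integrable i hs]
  simp_rw [integral_heatFisher _ hs]
  simp
  field_simp
  ring

/-- This is the heat equation. Through it, integration by parts turns the time derivative of the
entropy into a Fisher information. -/
lemma hasDerivAt_heat_time (hs : 0 < s) (x : EuclideanSpace ℝ (Fin d)) :
    HasDerivAt (fun s => heat s x) (∑ i, heatDD i s x) s := by
  have h1 : HasDerivAt (fun s : ℝ => 4 * Real.pi * s) (4 * Real.pi) s := by
    simpa using (hasDerivAt_id s).const_mul (4 * Real.pi)
  have h2 := h1.rpow_const (p := -(d / 2 : ℝ)) (Or.inl (by positivity))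
  have h3 : HasDerivAt (fun s : ℝ => -(1 / (4 * s)) * ‖x‖ ^ 2) (1 / (4 * s ^ 2) * ‖x‖ ^ 2) s := by
    have := (((hasDerivAt_id s).const_mul 4).inv (by simpa using hs.ne')).neg.mul_const (‖x‖ ^ 2)
    simp only [one_div]
    refine this.congr_deriv ?_
    simp
    field_simp
  refine (h2.mul h3.exp).congr_deriv ?_
  unfold heatDD
  rw [← Finset.sum_mul, Finset.sum_sub_distrib, ← Finset.sum_div]
  have h4 : ∑ i, x i ^ 2 = ‖x‖ ^ 2 := by
    rw [EuclideanSpace.norm_sq_eq]; simp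
  rw [h4, Real.rpow_sub_one (by positivity)]
  simp only [Finset.sum_const, Finset.card_univ, Fintype.card_fin, nsmul_eq_mul, heat]
  field_simp
  ring

end Schrodinger

namespace Schrodinger
open Filter Topology
open scoped ENNReal

variable {d : ℕ}

/-! ### Convolution of integrable functions with smooth kernels -/

section cv
variable {K K' u : EuclideanSpace ℝ (Fin d) → ℝ} {C : ℝ}

lemma cv_integrable (hK : Integrable K) (hu : Integrable u) : Integrable (cv K u) := by
  rw [cv_eq_convolution]
  exact hK.integrable_convolution _ hu

lemma integral_cv (hK : Integrable K) (hu : Integrable u) :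
    ∫ x, cv K u x = (∫ x, K x) * ∫ x, u x := by
  rw [cv_eq_convolution, integral_convolution _ hK hu]
  simp

lemma cv_integrand_integrable (hK : Continuous K) (hC : ∀ x, |K x| ≤ C) (hu : Integrable u)
    (x : EuclideanSpace ℝ (Fin d)) : Integrable fun y => K (x - y) * u y :=
  hu.bdd_mul (c := C) (hK.comp (by fun_prop)).aestronglyMeasurable (.of_forall fun y => hC _)

lemma abs_cv_le (hK : Continuous K) (hC : ∀ x, |K x| ≤ C) (hu : Integrable u)
    (x : EuclideanSpace ℝ (Fin d)) : |cv K u x| ≤ C * ∫ y, |u y| := by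
  rw [← integral_const_mul]
  refine (abs_integral_le_integral_abs).trans ?_
  refine integral_mono (cv_integrand_integrable hK hC hu x).abs (hu.abs.const_mul C) fun y => ?_
  simp only [smul_eq_mul, abs_mul]
  exact mul_le_mul_of_nonneg_right (hC _) (abs_nonneg _)

/-- Differentiation under the integral sign, dominated by a bound on `K'` times |u|. -/
lemma hasLineDerivAt_cv {v : EuclideanSpace ℝ (Fin d)} {C' : ℝ} (hK : Continuous K)
    (hC : ∀ x, |K x| ≤ C)
    (hK' : Continuous K') (hC' : ∀ x, |K' x| ≤ C') (h : ∀ x, HasLineDerivAt ℝ K (K' x) x v)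
    (hu : Integrable u) (x : EuclideanSpace ℝ (Fin d)) :
    HasLineDerivAt ℝ (cv K u) (cv K' u x) x v := by
  -- `HasLineDerivAt` concerns the parameter value 0 only; moving the base point gives the
  -- derivative at every parameter of the line.
  have hd : ∀ z, ∀ t : ℝ, HasDerivAt (fun t : ℝ => K (z + t • v)) (K' (z + t • v)) t := by
    intro z t
    have h1 := h (z + t • v)
    unfold HasLineDerivAt at h1
    rw [← sub_self t] at h1
    refine (h1.comp_sub_const t t).congr_of_eventuallyEq (.of_forall fun r => ?_)
    simp only
    congr 1
    module
  unfold HasLineDerivAt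
  have hi : ∀ t : ℝ, Integrable fun y => K (x + t • v - y) • u y :=
    fun t => cv_integrand_integrable hK hC hu _
  have := (hasDerivAt_integral_of_dominated_loc_of_deriv_le (μ := volume)
    (F := fun (t : ℝ) y => K (x + t • v - y) • u y)
    (F' := fun (t : ℝ) y => K' (x + t • v - y) • u y) (x₀ := 0) (s := Set.univ)
    (bound := fun y => C' * |u y|) Filter.univ_mem
    (.of_forall fun t => (hi t).aestronglyMeasurable)
    (hi 0)
    (cv_integrand_integrable hK' hC' hu _).aestronglyMeasurable
    (.of_forall fun y t _ => by
      rw [norm_smul, Real.norm_eq_abs, Real.norm_eq_abs]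
      exact mul_le_mul_of_nonneg_right (hC' _) (abs_nonneg _))
    (hu.abs.const_mul C')
    (.of_forall fun y t _ => by
      have := hd (x - y) t
      simp only [smul_eq_mul]
      simp_rw [show ∀ t : ℝ, x + t • v - y = x - y + t • v from fun t => by abel]
      exact this.mul_const _)).2
  simpa [cv] using this

end cv

lemma abs_heat_le_self {s : ℝ} (hs : 0 < s) (x : EuclideanSpace ℝ (Fin d)) :
    |heat s x| ≤ heatBound s s (0 : EuclideanSpace ℝ (Fin d)) :=
  (abs_heat_le hs le_rfl le_rfl x).trans (heatBound_le hs hs x)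

lemma abs_heatD_le_self {s : ℝ} (i : Fin d) (hs : 0 < s) (x : EuclideanSpace ℝ (Fin d)) :
    |heatD i s x| ≤ heatBound s s (0 : EuclideanSpace ℝ (Fin d)) :=
  (abs_heatD_le i hs le_rfl le_rfl x).trans (heatBound_le hs hs x)

lemma abs_heatDD_le_self {s : ℝ} (i : Fin d) (hs : 0 < s) (x : EuclideanSpace ℝ (Fin d)) :
    |heatDD i s x| ≤ heatBound s s (0 : EuclideanSpace ℝ (Fin d)) :=
  (abs_heatDD_le i hs le_rfl le_rfl x).trans (heatBound_le hs hs x)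

lemma abs_heatFisher_le_self {s : ℝ} (i : Fin d) (hs : 0 < s) (x : EuclideanSpace ℝ (Fin d)) :
    |heatFisher i s x| ≤ (1 + 1 / (2 * s)) * heatBound s s (0 : EuclideanSpace ℝ (Fin d)) := by
  rw [heatFisher_eq i hs]
  refine (abs_add_le _ _).trans ?_
  rw [abs_mul, abs_of_pos (by positivity : 0 < 1 / (2 * s)), add_mul, one_mul]
  gcongr
  · exact abs_heatDD_le_self i hs x
  · exact abs_heat_le_self hs x

/-! ### The heat flow started at a probability density -/

section flow
variable {u : EuclideanSpace ℝ (Fin d) → ℝ} {s : ℝ}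

/-- The kernel is strictly positive, so vanishing at a single point would force u = 0 almost
everywhere, against mass one. -/
lemma cv_heat_pos (hs : 0 < s) (hu : Integrable u) (h0 : ∀ x, 0 ≤ u x) (h1 : ∫ x, u x = 1)
    (x : EuclideanSpace ℝ (Fin d)) : 0 < cv (heat s) u x := by
  have hi := cv_integrand_integrable (heat_continuous s) (abs_heat_le_self hs) hu x
  have hn : 0 ≤ᵐ[volume] fun y => heat s (x - y) * u y :=
    .of_forall fun y => mul_nonneg (heat_pos hs _).le (h0 y)
  refine lt_of_le_of_ne (integral_nonneg_of_ae hn) fun h => ?_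
  have h2 := (integral_eq_zero_iff_of_nonneg_ae hn hi).1 h.symm
  have h3 : u =ᵐ[volume] 0 := by
    filter_upwards [h2] with y hy
    simpa [(heat_pos hs (x - y)).ne'] using hy
  rw [integral_congr_ae h3] at h1
  simp at h1

lemma cv_heat_le (hs : 0 < s) (hu : Integrable u) (h0 : ∀ x, 0 ≤ u x) (h1 : ∫ x, u x = 1)
    (x : EuclideanSpace ℝ (Fin d)) : cv (heat s) u x ≤ (4 * Real.pi * s) ^ (-(d / 2 : ℝ)) := by
  have := abs_cv_le (heat_continuous s) (C := (4 * Real.pi * s) ^ (-(d / 2 : ℝ)))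
    (fun x => by rw [abs_of_pos (heat_pos hs x)]; exact heat_le hs x) hu x
  simp_rw [abs_of_nonneg (h0 _), h1, mul_one] at this
  exact (le_abs_self _).trans this

lemma hasLineDerivAt_cv_heat (i : Fin d) (hs : 0 < s) (hu : Integrable u)
    (x : EuclideanSpace ℝ (Fin d)) :
    HasLineDerivAt ℝ (cv (heat s) u) (cv (heatD i s) u x) x (EuclideanSpace.single i 1) :=
  hasLineDerivAt_cv (heat_continuous s) (abs_heat_le_self hs) (heatD_continuous i s)
    (abs_heatD_le_self i hs) (hasLineDerivAt_heat i hs) hu x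

lemma hasLineDerivAt_cv_heatD (i : Fin d) (hs : 0 < s) (hu : Integrable u)
    (x : EuclideanSpace ℝ (Fin d)) :
    HasLineDerivAt ℝ (cv (heatD i s) u) (cv (heatDD i s) u x) x (EuclideanSpace.single i 1) :=
  hasLineDerivAt_cv (heatD_continuous i s) (abs_heatD_le_self i hs) (heatDD_continuous i s)
    (abs_heatDD_le_self i hs) (hasLineDerivAt_heatD i hs) hu x

/-- The majorant is integrable and independent of s in [s₀, S], which is what differentiating the
entropy under the integral requires. -/
lemma abs_cv_heatDD_le {s₀ S : ℝ} (i : Fin d) (h0 : 0 < s₀) (hs : s₀ ≤ s) (hS : s ≤ S)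
    (hu : Integrable u) (hu0 : ∀ x, 0 ≤ u x) (x : EuclideanSpace ℝ (Fin d)) :
    |cv (heatDD i s) u x| ≤ cv (heatBound s₀ S) u x := by
  have hs0 := h0.trans_le hs
  refine abs_integral_le_integral_abs.trans (integral_mono
    (cv_integrand_integrable (heatDD_continuous i s) (abs_heatDD_le_self i hs0) hu x).abs
    (cv_integrand_integrable (C := heatBound s₀ S (0 : EuclideanSpace ℝ (Fin d)))
      (heatBound_continuous s₀ S) (fun y => ?_) hu x) fun y => ?_)
  · rw [abs_of_nonneg ((abs_nonneg _).trans (abs_heat_le h0 hs hS y))]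
    exact heatBound_le h0 (hs0.trans_le hS) y
  · simp only [smul_eq_mul, abs_mul, abs_of_nonneg (hu0 y)]
    exact mul_le_mul_of_nonneg_right (abs_heatDD_le i h0 hs hS _) (hu0 y)

lemma hasDerivAt_cv_heat_time (hs : 0 < s) (hu : Integrable u)
    (x : EuclideanSpace ℝ (Fin d)) :
    HasDerivAt (fun s => cv (heat s) u x) (∑ i, cv (heatDD i s) u x) s := by
  have hi : ∀ s : ℝ, 0 < s → Integrable fun y => heat s (x - y) • u y :=
    fun t ht => cv_integrand_integrable (heat_continuous t) (abs_heat_le_self ht) hu _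
  have hii : ∀ i, Integrable fun y => heatDD i s (x - y) • u y := fun i =>
    cv_integrand_integrable (heatDD_continuous i s) (abs_heatDD_le_self i hs) hu _
  -- The kernel is singular at time 0, so a uniform majorant is available only on times bounded away
  -- from 0.
  have hmem : Set.Ioo (s / 2) (2 * s) ∈ 𝓝 s := Ioo_mem_nhds (by linarith) (by linarith)
  have := (hasDerivAt_integral_of_dominated_loc_of_deriv_le (μ := volume)
    (F := fun (t : ℝ) y => heat t (x - y) • u y)
    (F' := fun (t : ℝ) y => (∑ i, heatDD i t (x - y)) • u y) (x₀ := s)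
    (s := Set.Ioo (s / 2) (2 * s))
    (bound := fun y => (d * heatBound (s / 2) (2 * s) (0 : EuclideanSpace ℝ (Fin d))) * |u y|) hmem
    (by filter_upwards [hmem] with t ht
        exact (hi t (by linarith [ht.1])).aestronglyMeasurable)
    (hi s hs)
    (by
      simp_rw [Finset.sum_smul]
      exact (integrable_finsetSum _ fun i _ => hii i).aestronglyMeasurable)
    (.of_forall fun y t ht => by
      rw [norm_smul, Real.norm_eq_abs, Real.norm_eq_abs]
      refine mul_le_mul_of_nonneg_right ?_ (abs_nonneg _)
      refine (Finset.abs_sum_le_sum_abs _ _).trans ?_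
      refine (Finset.sum_le_sum fun i _ => (abs_heatDD_le i (half_pos hs) ht.1.le ht.2.le _).trans
        (heatBound_le (half_pos hs) (by linarith) _)).trans ?_
      simp)
    (hu.abs.const_mul _)
    (.of_forall fun y t ht => by
      simp only [smul_eq_mul]
      exact (hasDerivAt_heat_time (by linarith [ht.1, half_pos hs]) (x - y)).mul_const _)).2
  refine this.congr_deriv ?_
  simp_rw [Finset.sum_smul]
  rw [integral_finsetSum _ fun i _ => hii i]
  rfl

/-! ### The regularised entropy -/

/-- A regularisation of the entropy density `r log r`. -/
noncomputable def phi (ε r : ℝ) : ℝ := r * Real.log (1 + r / ε)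

/-- The derivative of `phi`. -/
noncomputable def dphi (ε r : ℝ) : ℝ := Real.log (1 + r / ε) + r / (ε + r)

/-- The second derivative of `phi`. -/
noncomputable def ddphi (ε r : ℝ) : ℝ := (r + 2 * ε) / (r + ε) ^ 2

variable {ε r : ℝ}

lemma hasDerivAt_log_one_add (hε : 0 < ε) (hr : 0 ≤ r) :
    HasDerivAt (fun r => Real.log (1 + r / ε)) (1 / (ε + r)) r := by
  have h1 : HasDerivAt (fun r => 1 + r / ε) (1 / ε) r :=
    ((hasDerivAt_id r).div_const ε).const_add 1
  have h2 : (0 : ℝ) < 1 + r / ε := by positivity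
  refine (h1.log h2.ne').congr_deriv ?_
  field_simp

lemma hasDerivAt_phi (hε : 0 < ε) (hr : 0 ≤ r) : HasDerivAt (phi ε) (dphi ε r) r := by
  refine ((hasDerivAt_id r).mul (hasDerivAt_log_one_add hε hr)).congr_deriv ?_
  simp [dphi]
  ring

lemma hasDerivAt_dphi (hε : 0 < ε) (hr : 0 ≤ r) : HasDerivAt (dphi ε) (ddphi ε r) r := by
  have h1 : HasDerivAt (fun r => ε + r) 1 r := (hasDerivAt_id r).const_add ε
  have h2 : ε + r ≠ 0 := by positivity
  have h3 : r + ε ≠ 0 := by positivity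
  refine ((hasDerivAt_log_one_add hε hr).add ((hasDerivAt_id r).div h1 h2)).congr_deriv ?_
  simp [ddphi]
  field_simp
  ring

lemma phi_nonneg (hε : 0 < ε) (hr : 0 ≤ r) : 0 ≤ phi ε r :=
  mul_nonneg hr (Real.log_nonneg (by have : 0 ≤ r / ε := by positivity
                                     linarith))

lemma log_one_add_le (hε : 0 < ε) (hr : 0 ≤ r) : Real.log (1 + r / ε) ≤ r / ε := by
  have := Real.log_le_sub_one_of_pos (by positivity : 0 < 1 + r / ε)
  linarith

lemma phi_le (hε : 0 < ε) (hr : 0 ≤ r) {M : ℝ} (hM : r ≤ M) : phi ε r ≤ M / ε * r := by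
  rw [phi, mul_comm]
  gcongr
  exact (log_one_add_le hε hr).trans (by gcongr)

lemma dphi_nonneg (hε : 0 < ε) (hr : 0 ≤ r) : 0 ≤ dphi ε r :=
  add_nonneg (Real.log_nonneg (by have : 0 ≤ r / ε := by positivity
                                  linarith)) (by positivity)

lemma dphi_le (hε : 0 < ε) (hr : 0 ≤ r) {M : ℝ} (hM : r ≤ M) : dphi ε r ≤ M / ε + 1 := by
  refine add_le_add ((log_one_add_le hε hr).trans (by gcongr)) ?_
  rw [div_le_one (by positivity)]
  linarith

lemma ddphi_nonneg (hε : 0 < ε) (hr : 0 ≤ r) : 0 ≤ ddphi ε r := by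
  unfold ddphi; positivity

/-- The bound 1/r is the second derivative of r log r. It ensures that the regularised entropy is
dissipated no faster than the Fisher information allows, for every ε. -/
lemma ddphi_le_inv (hε : 0 < ε) (hr : 0 < r) : ddphi ε r ≤ 1 / r := by
  unfold ddphi
  rw [div_le_div_iff₀ (by positivity) hr]
  nlinarith [sq_nonneg ε]

lemma ddphi_le (hε : 0 < ε) (hr : 0 ≤ r) : ddphi ε r ≤ 2 / ε := by
  unfold ddphi
  rw [div_le_div_iff₀ (by positivity) hε]
  nlinarith [sq_nonneg r, mul_nonneg hr hε.le]

lemma measurable_phi (ε : ℝ) : Measurable (phi ε) := by unfold phi; fun_prop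
lemma measurable_dphi (ε : ℝ) : Measurable (dphi ε) := by unfold dphi; fun_prop
lemma measurable_ddphi (ε : ℝ) : Measurable (ddphi ε) := by unfold ddphi; fun_prop

lemma dphi_mono (hε : 0 < ε) {a b : ℝ} (ha : 0 ≤ a) (hab : a ≤ b) : dphi ε a ≤ dphi ε b := by
  have hm : MonotoneOn (dphi ε) (Set.Ici 0) := by
    refine monotoneOn_of_deriv_nonneg (convex_Ici 0)
      (fun r hr => (hasDerivAt_dphi hε hr).continuousAt.continuousWithinAt)
      (fun r hr => ?_) fun r hr => ?_
    all_goals rw [interior_Ici] at hr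
    · exact (hasDerivAt_dphi hε (le_of_lt hr)).differentiableAt.differentiableWithinAt
    · rw [(hasDerivAt_dphi hε (le_of_lt hr)).deriv]
      exact ddphi_nonneg hε (le_of_lt hr)
  exact hm ha (ha.trans hab) hab

/-- The tangent line inequality for the convex function `phi`. -/
lemma phi_tangent (hε : 0 < ε) {a b : ℝ} (ha : 0 ≤ a) (hb : 0 ≤ b) :
    phi ε a + dphi ε a * (b - a) ≤ phi ε b := by
  have hc : ConvexOn ℝ (Set.Ici 0) (phi ε) := by
    refine MonotoneOn.convexOn_of_deriv (convex_Ici 0)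
      (fun r hr => (hasDerivAt_phi hε hr).continuousAt.continuousWithinAt)
      (fun r hr => ?_) ?_
    · rw [interior_Ici] at hr
      exact (hasDerivAt_phi hε (le_of_lt hr)).differentiableAt.differentiableWithinAt
    · intro r hr t ht hrt
      rw [interior_Ici] at hr ht
      rw [(hasDerivAt_phi hε (le_of_lt hr)).deriv, (hasDerivAt_phi hε (le_of_lt ht)).deriv]
      exact dphi_mono hε (le_of_lt hr) hrt
  rcases lt_trichotomy a b with h | h | h
  · have := hc.le_slope_of_hasDerivAt ha hb h (hasDerivAt_phi hε ha)
    rw [slope_def_field, le_div_iff₀ (by linarith)] at this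
    linarith
  · simp [h]
  · have := hc.slope_le_of_hasDerivAt hb ha h (hasDerivAt_phi hε ha)
    rw [slope_def_field, div_le_iff₀ (by linarith)] at this
    linarith

end flow

end Schrodinger

/-! ### Entropy production and Fisher information along the heat flow -/

namespace Schrodinger
open Filter Topology
open scoped ENNReal

variable {d : ℕ} {u : EuclideanSpace ℝ (Fin d) → ℝ} {s ε : ℝ}

lemma integrable_phi_cv_heat (hε : 0 < ε) (hs : 0 < s) (hu : Integrable u) (h0 : ∀ x, 0 ≤ u x)
    (h1 : ∫ x, u x = 1) : Integrable fun x => phi ε (cv (heat s) u x) := by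
  have hi := cv_integrable (heat_isProbKernel hs).integrable hu
  refine (hi.const_mul ((4 * Real.pi * s) ^ (-(d / 2 : ℝ)) / ε)).mono'
    ((measurable_phi ε).comp_aemeasurable hi.1.aemeasurable).aestronglyMeasurable
    (.of_forall fun x => ?_)
  have hp := cv_heat_pos hs hu h0 h1 x
  rw [Real.norm_of_nonneg (phi_nonneg hε hp.le)]
  exact phi_le hε hp.le (cv_heat_le hs hu h0 h1 x)

/-- Integration by parts in one coordinate. The flow is bounded, so `dphi` and `ddphi` are bounded
on its range and all the products are integrable. -/
lemma integral_dphi_mul_cv_heatDD (i : Fin d) (hε : 0 < ε) (hs : 0 < s) (hu : Integrable u)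
    (h0 : ∀ x, 0 ≤ u x) (h1 : ∫ x, u x = 1) :
    ∫ x, dphi ε (cv (heat s) u x) * cv (heatDD i s) u x =
      - ∫ x, ddphi ε (cv (heat s) u x) * cv (heatD i s) u x ^ 2 := by
  have hi := cv_integrable (heat_isProbKernel hs).integrable hu
  have hiD := cv_integrable (heatD_integrable i hs) hu
  have hiDD := cv_integrable (heatDD_integrable i hs) hu
  have hp := cv_heat_pos hs hu h0 h1
  have b1 : ∀ x, ‖dphi ε (cv (heat s) u x)‖ ≤ (4 * Real.pi * s) ^ (-(d / 2 : ℝ)) / ε + 1 :=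
    fun x => by
      rw [Real.norm_of_nonneg (dphi_nonneg hε (hp x).le)]
      exact dphi_le hε (hp x).le (cv_heat_le hs hu h0 h1 x)
  have b2 : ∀ x, ‖ddphi ε (cv (heat s) u x)‖ ≤ 2 / ε := fun x => by
      rw [Real.norm_of_nonneg (ddphi_nonneg hε (hp x).le)]
      exact ddphi_le hε (hp x).le
  have m1 : AEStronglyMeasurable (fun x => dphi ε (cv (heat s) u x)) :=
    ((measurable_dphi ε).comp_aemeasurable hi.1.aemeasurable).aestronglyMeasurable
  have m2 : AEStronglyMeasurable (fun x => ddphi ε (cv (heat s) u x)) :=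
    ((measurable_ddphi ε).comp_aemeasurable hi.1.aemeasurable).aestronglyMeasurable
  have i2 : Integrable fun x => cv (heatD i s) u x * cv (heatD i s) u x :=
    hiD.bdd_mul hiD.1 (.of_forall fun x =>
      abs_cv_le (heatD_continuous i s) (abs_heatD_le_self i hs) hu x)
  have := integral_bilinear_hasLineDerivAt_right_eq_neg_left_of_integrable
    (B := ContinuousLinearMap.mul ℝ ℝ) (μ := volume) (v := EuclideanSpace.single i 1)
    (f := fun x => dphi ε (cv (heat s) u x))
    (f' := fun x => ddphi ε (cv (heat s) u x) * cv (heatD i s) u x)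
    (g := cv (heatD i s) u) (g' := cv (heatDD i s) u)
    (by simpa [mul_assoc] using i2.bdd_mul m2 (.of_forall b2))
    (hiDD.bdd_mul m1 (.of_forall b1))
    (hiD.bdd_mul m1 (.of_forall b1))
    (fun x _ => by
      have h := hasLineDerivAt_cv_heat i hs hu x
      unfold HasLineDerivAt at h ⊢
      have hd := hasDerivAt_dphi hε (hp x).le
      exact HasDerivAt.comp (h₂ := dphi ε) 0 (by simpa using hd) h)
    (fun x _ => hasLineDerivAt_cv_heatD i hs hu x)
  simpa [mul_assoc, sq] using this

/-- The derivative of the regularised entropy along the heat flow. -/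
lemma hasDerivAt_integral_phi_cv_heat (hε : 0 < ε) (hs : 0 < s) (hu : Integrable u)
    (h0 : ∀ x, 0 ≤ u x) (h1 : ∫ x, u x = 1) :
    HasDerivAt (fun s => ∫ x, phi ε (cv (heat s) u x))
      (- ∑ i, ∫ x, ddphi ε (cv (heat s) u x) * cv (heatD i s) u x ^ 2) s := by
  have hp : ∀ t, 0 < t → ∀ x, 0 < cv (heat t) u x := fun t ht => cv_heat_pos ht hu h0 h1
  have hmem : Set.Ioo (s / 2) (2 * s) ∈ 𝓝 s := Ioo_mem_nhds (by linarith) (by linarith)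
  have hi := cv_integrable (heat_isProbKernel hs).integrable hu
  have hiDD := fun i => cv_integrable (heatDD_integrable i hs) hu
  have b1 : ∀ t ∈ Set.Ioo (s / 2) (2 * s), ∀ x, |dphi ε (cv (heat t) u x)| ≤
      (4 * Real.pi * (s / 2)) ^ (-(d / 2 : ℝ)) / ε + 1 := fun t ht x => by
    have ht0 : 0 < t := by linarith [ht.1]
    rw [abs_of_nonneg (dphi_nonneg hε (hp t ht0 x).le)]
    refine dphi_le hε (hp t ht0 x).le ((cv_heat_le ht0 hu h0 h1 x).trans ?_)
    refine Real.rpow_le_rpow_of_nonpos (by positivity) (by have := ht.1; gcongr) ?_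
    have : (0 : ℝ) ≤ d := Nat.cast_nonneg d
    linarith
  have m1 : AEStronglyMeasurable (fun x => dphi ε (cv (heat s) u x)) :=
    ((measurable_dphi ε).comp_aemeasurable hi.1.aemeasurable).aestronglyMeasurable
  have i1 : ∀ i, Integrable fun x => dphi ε (cv (heat s) u x) * cv (heatDD i s) u x := fun i =>
    (hiDD i).bdd_mul m1 (.of_forall fun x => b1 s ⟨by linarith, by linarith⟩ x)
  have := (hasDerivAt_integral_of_dominated_loc_of_deriv_le (μ := volume)
    (F := fun (t : ℝ) x => phi ε (cv (heat t) u x))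
    (F' := fun (t : ℝ) x => dphi ε (cv (heat t) u x) * ∑ i, cv (heatDD i t) u x) (x₀ := s)
    (s := Set.Ioo (s / 2) (2 * s))
    (bound := fun x => ((4 * Real.pi * (s / 2)) ^ (-(d / 2 : ℝ)) / ε + 1) *
      (d * cv (heatBound (s / 2) (2 * s)) u x)) hmem
    (by filter_upwards [hmem] with t ht
        exact (integrable_phi_cv_heat hε (by linarith [ht.1]) hu h0 h1).aestronglyMeasurable)
    (integrable_phi_cv_heat hε hs hu h0 h1)
    (by
      simp_rw [Finset.mul_sum]
      exact (integrable_finsetSum _ fun i _ => i1 i).aestronglyMeasurable)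
    (.of_forall fun x t ht => by
      rw [norm_mul, Real.norm_eq_abs, Real.norm_eq_abs]
      have hsum : |∑ i, cv (heatDD i t) u x| ≤ d * cv (heatBound (s / 2) (2 * s)) u x := by
        refine (Finset.abs_sum_le_sum_abs _ _).trans ?_
        refine (Finset.sum_le_sum fun i _ =>
          abs_cv_heatDD_le i (half_pos hs) ht.1.le ht.2.le hu h0 x).trans ?_
        simp
      exact mul_le_mul (b1 t ht x) hsum (abs_nonneg _) ((abs_nonneg _).trans (b1 t ht x)))
    (((cv_integrable (heatBound_integrable _ (by linarith)) hu).const_mul _).const_mul _)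
    (.of_forall fun x t ht => by
      have ht0 : 0 < t := by linarith [ht.1, half_pos hs]
      exact (hasDerivAt_phi hε (hp t ht0 x).le).comp t (hasDerivAt_cv_heat_time ht0 hu x))).2
  refine this.congr_deriv ?_
  simp_rw [Finset.mul_sum]
  rw [integral_finsetSum _ fun i _ => i1 i, ← Finset.sum_neg_distrib]
  exact Finset.sum_congr rfl fun i _ => integral_dphi_mul_cv_heatDD i hε hs hu h0 h1

/-! ### Densities with finite Fisher information -/

/-- `u` is a probability density on `ℝ^d` with weak logarithmic gradient `p` and finite Fisher
information. -/
structure HasScore (u : EuclideanSpace ℝ (Fin d) → ℝ)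
    (p : Fin d → EuclideanSpace ℝ (Fin d) → ℝ) : Prop where
  nonneg : ∀ x, 0 ≤ u x
  integrable : Integrable u
  integral_eq_one : ∫ x, u x = 1
  measurable : ∀ i, AEStronglyMeasurable (p i)
  integrable_sq : ∀ i, Integrable fun x => p i x ^ 2 * u x
  weakDeriv : ∀ i, HasWeakDeriv (EuclideanSpace.single i 1) u fun x => p i x * u x

/-- The Fisher information. -/
noncomputable def fisher (u : EuclideanSpace ℝ (Fin d) → ℝ)
    (p : Fin d → EuclideanSpace ℝ (Fin d) → ℝ) : ℝ := ∑ i, ∫ x, p i x ^ 2 * u x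

lemma integrable_mul_of_sq {u p : EuclideanSpace ℝ (Fin d) → ℝ} (hu : Integrable u)
    (h0 : ∀ x, 0 ≤ u x) (hp : AEStronglyMeasurable p)
    (hp2 : Integrable fun x => p x ^ 2 * u x) : Integrable fun x => p x * u x := by
  refine (hp2.add hu).mono' (hp.mul hu.1) (.of_forall fun x => ?_)
  rw [norm_mul, Real.norm_eq_abs, Real.norm_of_nonneg (h0 x)]
  have : |p x| ≤ p x ^ 2 + 1 := by nlinarith [sq_nonneg (|p x| - 1), sq_abs (p x)]
  have := mul_le_mul_of_nonneg_right this (h0 x)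
  simp only [Pi.add_apply]
  linarith

/-- The expansion of the weighted square underlying the convolution inequality for the Fisher
information. -/
lemma integral_score_sq {p : EuclideanSpace ℝ (Fin d) → ℝ} (i : Fin d) (hs : 0 < s)
    (hu : Integrable u) (h0 : ∀ x, 0 ≤ u x) (hp : AEStronglyMeasurable p)
    (hp2 : Integrable fun x => p x ^ 2 * u x) (α β r : ℝ) (x : EuclideanSpace ℝ (Fin d)) :
    Integrable (fun y => (α * p y - β * ((x - y) i / (2 * s)) - r) ^ 2 * (heat s (x - y) * u y)) ∧
    ∫ y, (α * p y - β * ((x - y) i / (2 * s)) - r) ^ 2 * (heat s (x - y) * u y) =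
      α ^ 2 * cv (heat s) (fun y => p y ^ 2 * u y) x
      + 2 * α * β * cv (heatD i s) (fun y => p y * u y) x
      + β ^ 2 * cv (heatFisher i s) u x
      - 2 * r * (α * cv (heat s) (fun y => p y * u y) x + β * cv (heatD i s) u x)
      + r ^ 2 * cv (heat s) u x := by
  have hpu := integrable_mul_of_sq hu h0 hp hp2
  have j1 := cv_integrand_integrable (heat_continuous s) (abs_heat_le_self hs) hp2 x
  have j2 := cv_integrand_integrable (heatD_continuous i s) (abs_heatD_le_self i hs) hpu x
  have j3 := cv_integrand_integrable (heatFisher_continuous i s) (abs_heatFisher_le_self i hs) hu x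
  have j4 := cv_integrand_integrable (heat_continuous s) (abs_heat_le_self hs) hpu x
  have j5 := cv_integrand_integrable (heatD_continuous i s) (abs_heatD_le_self i hs) hu x
  have j6 := cv_integrand_integrable (heat_continuous s) (abs_heat_le_self hs) hu x
  have e : (fun y => (α * p y - β * ((x - y) i / (2 * s)) - r) ^ 2 * (heat s (x - y) * u y)) =
      fun y => α ^ 2 * (heat s (x - y) * (p y ^ 2 * u y))
      + 2 * α * β * (heatD i s (x - y) * (p y * u y))
      + β ^ 2 * (heatFisher i s (x - y) * u y)
      - (2 * r * α * (heat s (x - y) * (p y * u y)) + 2 * r * β * (heatD i s (x - y) * u y))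
      + r ^ 2 * (heat s (x - y) * u y) := by
    ext y
    unfold heatD heatFisher
    ring
  have k1 := ((j1.const_mul (α ^ 2)).add (j2.const_mul (2 * α * β))).add (j3.const_mul (β ^ 2))
  have k2 := (j4.const_mul (2 * r * α)).add (j5.const_mul (2 * r * β))
  have k3 := j6.const_mul (r ^ 2)
  have k := (k1.sub k2).add k3
  rw [e]
  refine ⟨k, (integral_add' (k1.sub k2) k3).trans ?_⟩
  rw [integral_sub' k1 k2, integral_add' ((j1.const_mul _).add (j2.const_mul _)) (j3.const_mul _),
    integral_add' (j1.const_mul _) (j2.const_mul _),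
    integral_add' (j4.const_mul _) (j5.const_mul _)]
  simp only [integral_const_mul, cv, smul_eq_mul]
  ring

/-- The pointwise bound for the Fisher information density of a convolution. -/
noncomputable def stam (i : Fin d) (s α β : ℝ) (u p : EuclideanSpace ℝ (Fin d) → ℝ)
    (x : EuclideanSpace ℝ (Fin d)) : ℝ :=
  α ^ 2 * cv (heat s) (fun y => p y ^ 2 * u y) x
    + 2 * α * β * cv (heatD i s) (fun y => p y * u y) x
    + β ^ 2 * cv (heatFisher i s) u x

variable {p : Fin d → EuclideanSpace ℝ (Fin d) → ℝ}

lemma HasScore.integrable_mul (h : HasScore u p) (i : Fin d) :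
    Integrable fun x => p i x * u x :=
  integrable_mul_of_sq h.integrable h.nonneg (h.measurable i) (h.integrable_sq i)

lemma HasScore.cv_pos (h : HasScore u p) (hs : 0 < s) (x : EuclideanSpace ℝ (Fin d)) :
    0 < cv (heat s) u x := cv_heat_pos hs h.integrable h.nonneg h.integral_eq_one x

/-- The derivative moves from the kernel to u. The kernel is not compactly supported, hence the
appeal to `HasWeakDeriv.bounded_test`. -/
lemma HasScore.cv_heatD (h : HasScore u p) (i : Fin d) (hs : 0 < s)
    (x : EuclideanSpace ℝ (Fin d)) :
    cv (heatD i s) u x = cv (heat s) (fun y => p i y * u y) x := by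
  have hη : ContDiff ℝ ∞ fun y => heat s (x - y) :=
    (heat_contDiff s).comp (contDiff_const.sub contDiff_id)
  have hd : ∀ y, fderiv ℝ (fun y => heat s (x - y)) y (EuclideanSpace.single i 1)
      = - heatD i s (x - y) := by
    intro y
    have h2 : HasFDerivAt (heat s) (fderiv ℝ (heat s) (x - y)) (x - y) :=
      ((heat_contDiff s).differentiable (by simp) _).hasFDerivAt
    have h3 := (h2.comp y ((hasFDerivAt_id y).const_sub x)).fderiv
    rw [show (heat s) ∘ HSub.hSub x = fun y => heat s (x - y) from rfl] at h3
    have h4 := (hasLineDerivAt_heat i hs (x - y)).lineDeriv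
    rw [(h2.hasLineDerivAt _).lineDeriv] at h4
    simp [h3, h4]
  have := (h.weakDeriv i).bounded_test h.integrable (h.integrable_mul i) hη
    (C := heatBound s s (0 : EuclideanSpace ℝ (Fin d))) (fun y => abs_heat_le_self hs _)
    (fun y => by rw [hd, abs_neg]; exact abs_heatD_le_self i hs _)
  simp_rw [hd, neg_mul, integral_neg, neg_inj] at this
  exact this

/-- Weight y by the density heat(x - y) u(y) divided by its mass. Under it both p(y) and -(x -
y)ᵢ/(2s) have mean equal to the score of the flow at x. As α + β = 1, so does their combination, and
the identity is second moment minus squared mean, multiplied by the mass. -/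
lemma HasScore.stam_sub (h : HasScore u p) (i : Fin d) (hs : 0 < s) {α β : ℝ} (hαβ : α + β = 1)
    (x : EuclideanSpace ℝ (Fin d)) :
    ∫ y, (α * p i y - β * ((x - y) i / (2 * s)) - cv (heatD i s) u x / cv (heat s) u x) ^ 2 *
      (heat s (x - y) * u y) =
    stam i s α β u (p i) x - cv (heatD i s) u x ^ 2 / cv (heat s) u x := by
  rw [(integral_score_sq i hs h.integrable h.nonneg (h.measurable i) (h.integrable_sq i) α β _ x).2,
    ← h.cv_heatD i hs, ← add_mul, hαβ, stam]
  have := (h.cv_pos hs x).ne'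
  field_simp
  ring

lemma HasScore.sq_div_le_stam (h : HasScore u p) (i : Fin d) (hs : 0 < s) {α β : ℝ}
    (hαβ : α + β = 1) (x : EuclideanSpace ℝ (Fin d)) :
    cv (heatD i s) u x ^ 2 / cv (heat s) u x ≤ stam i s α β u (p i) x := by
  rw [← sub_nonneg, ← h.stam_sub i hs hαβ]
  exact integral_nonneg fun y =>
    mul_nonneg (sq_nonneg _) (mul_nonneg (heat_pos hs _).le (h.nonneg y))

lemma HasScore.integrable_stam (h : HasScore u p) (i : Fin d) (hs : 0 < s) (α β : ℝ) :
    Integrable (stam i s α β u (p i)) :=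
  (((cv_integrable (heat_isProbKernel hs).integrable (h.integrable_sq i)).const_mul _).add
    ((cv_integrable (heatD_integrable i hs) (h.integrable_mul i)).const_mul _)).add
    ((cv_integrable (heatFisher_integrable i hs) h.integrable).const_mul _)

/-- The cross term drops out because the derivative of the heat kernel has integral zero. -/
lemma HasScore.integral_stam (h : HasScore u p) (i : Fin d) (hs : 0 < s) (α β : ℝ) :
    ∫ x, stam i s α β u (p i) x = α ^ 2 * (∫ x, p i x ^ 2 * u x) + β ^ 2 * (1 / (2 * s)) := by
  have j1 := (cv_integrable (heat_isProbKernel hs).integrable (h.integrable_sq i)).const_mul (α ^ 2)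
  have j2 := (cv_integrable (heatD_integrable i hs) (h.integrable_mul i)).const_mul (2 * α * β)
  have j3 := (cv_integrable (heatFisher_integrable i hs) h.integrable).const_mul (β ^ 2)
  refine (integral_add' (j1.add j2) j3).trans ?_
  rw [integral_add' j1 j2, integral_const_mul, integral_const_mul,
    integral_const_mul, integral_cv (heat_isProbKernel hs).integrable (h.integrable_sq i),
    integral_cv (heatD_integrable i hs) (h.integrable_mul i),
    integral_cv (heatFisher_integrable i hs) h.integrable, integral_heatD i hs,
    integral_heatFisher i hs, (heat_isProbKernel hs).integral_eq_one, h.integral_eq_one]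
  ring

/-- The score of the heat flow started at `u`. -/
noncomputable def heatScore (s : ℝ) (u : EuclideanSpace ℝ (Fin d) → ℝ) (i : Fin d)
    (x : EuclideanSpace ℝ (Fin d)) : ℝ := cv (heatD i s) u x / cv (heat s) u x

lemma HasScore.heatScore_sq_mul (h : HasScore u p) (i : Fin d) (hs : 0 < s)
    (x : EuclideanSpace ℝ (Fin d)) :
    heatScore s u i x ^ 2 * cv (heat s) u x = cv (heatD i s) u x ^ 2 / cv (heat s) u x := by
  have := (h.cv_pos hs x).ne'
  unfold heatScore
  field_simp

lemma HasScore.heat (h : HasScore u p) (hs : 0 < s) :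
    HasScore (cv (heat s) u) (heatScore s u) where
  nonneg x := (h.cv_pos hs x).le
  integrable := cv_integrable (heat_isProbKernel hs).integrable h.integrable
  integral_eq_one := by
    rw [integral_cv (heat_isProbKernel hs).integrable h.integrable, h.integral_eq_one,
      (heat_isProbKernel hs).integral_eq_one, one_mul]
  measurable i := by
    have m1 := (cv_integrable (heatD_integrable i hs) h.integrable).1.aemeasurable
    have m2 := (cv_integrable (heat_isProbKernel hs).integrable h.integrable).1.aemeasurable
    exact (m1.div m2).aestronglyMeasurable
  integrable_sq i := by
    have m1 := (cv_integrable (heatD_integrable i hs) h.integrable).1.aemeasurable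
    have m2 := (cv_integrable (heat_isProbKernel hs).integrable h.integrable).1.aemeasurable
    simp_rw [h.heatScore_sq_mul i hs]
    -- The choice α = 0, β = 1 bounds the Fisher density by a convolution of u with `heatFisher`.
    refine (h.integrable_stam i hs 0 1).mono'
      ((m1.pow_const 2).div m2).aestronglyMeasurable (.of_forall fun x => ?_)
    rw [Real.norm_of_nonneg (div_nonneg (sq_nonneg _) (h.cv_pos hs x).le)]
    exact h.sq_div_le_stam i hs (by norm_num) x
  weakDeriv i := by
    intro η hη hc
    have e : ∀ x, heatScore s u i x * cv (Schrodinger.heat s) u x = cv (heatD i s) u x := fun x =>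
      div_mul_cancel₀ _ (h.cv_pos hs x).ne'
    simp_rw [e]
    have i1 := cv_integrable (heat_isProbKernel hs).integrable h.integrable
    have i2 := cv_integrable (heatD_integrable i hs) h.integrable
    have := integral_bilinear_hasLineDerivAt_right_eq_neg_left_of_integrable
      (B := ContinuousLinearMap.mul ℝ ℝ) (μ := volume) (v := EuclideanSpace.single i 1)
      (f := η) (f' := fun x => fderiv ℝ η x (EuclideanSpace.single i 1))
      (g := cv (Schrodinger.heat s) u) (g' := cv (heatD i s) u)
      (integrable_smul_of_hasCompactSupport (continuous_fderiv_dir hη _)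
        (hasCompactSupport_fderiv_dir hc _) i1.locallyIntegrable)
      (integrable_smul_of_hasCompactSupport hη.continuous hc i2.locallyIntegrable)
      (integrable_smul_of_hasCompactSupport hη.continuous hc i1.locallyIntegrable)
      (fun x _ => (hη.differentiable (by simp) x).hasFDerivAt.hasLineDerivAt _)
      (fun x _ => hasLineDerivAt_cv_heat i hs h.integrable x)
    simp only [ContinuousLinearMap.mul_apply'] at this
    simp only [smul_eq_mul]
    rw [this, neg_neg]

/-- The convolution inequality of Stam and Blachman for the heat flow. -/
lemma HasScore.fisher_heat_le (h : HasScore u p) (hs : 0 < s) {α β : ℝ} (hαβ : α + β = 1) :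
    fisher (cv (Schrodinger.heat s) u) (heatScore s u) ≤
      α ^ 2 * fisher u p + β ^ 2 * (d / (2 * s)) := by
  have e : α ^ 2 * fisher u p + β ^ 2 * (d / (2 * s)) = ∑ i, ∫ x, stam i s α β u (p i) x := by
    simp_rw [h.integral_stam _ hs]
    rw [Finset.sum_add_distrib, ← Finset.mul_sum, fisher]
    simp
    ring
  rw [e]
  refine Finset.sum_le_sum fun i _ => integral_mono ((h.heat hs).integrable_sq i)
    (h.integrable_stam i hs α β) fun x => ?_
  simp only
  rw [h.heatScore_sq_mul i hs]
  exact h.sq_div_le_stam i hs hαβ x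

/-- The equality case of the convolution inequality: the score is affine. -/
lemma HasScore.eq_of_fisher_heat_eq (h : HasScore u p) (hs : 0 < s) {α β : ℝ} (hαβ : α + β = 1)
    (heq : α ^ 2 * fisher u p + β ^ 2 * (d / (2 * s)) ≤
      fisher (cv (Schrodinger.heat s) u) (heatScore s u)) (i : Fin d) :
    ∃ c : ℝ, ∀ᵐ y, α * (p i y * u y) = (c - β * (y i / (2 * s))) * u y := by
  have hle : ∀ i, ∀ x, heatScore s u i x ^ 2 * cv (Schrodinger.heat s) u x
      ≤ stam i s α β u (p i) x := fun i x => by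
    rw [h.heatScore_sq_mul i hs]
    exact h.sq_div_le_stam i hs hαβ x
  have hint : ∀ i, ∫ x, heatScore s u i x ^ 2 * cv (Schrodinger.heat s) u x
      ≤ ∫ x, stam i s α β u (p i) x := fun i =>
    integral_mono ((h.heat hs).integrable_sq i) (h.integrable_stam i hs α β) (hle i)
  have e : α ^ 2 * fisher u p + β ^ 2 * (d / (2 * s)) = ∑ i, ∫ x, stam i s α β u (p i) x := by
    simp_rw [h.integral_stam _ hs]
    rw [Finset.sum_add_distrib, ← Finset.mul_sum, fisher]
    simp
    ring
  rw [e] at heq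
  -- Each coordinate satisfies the inequality, so equality of the sums forces equality coordinate by
  -- coordinate, and then almost everywhere in x.
  have heq' : ∫ x, heatScore s u i x ^ 2 * cv (Schrodinger.heat s) u x
      = ∫ x, stam i s α β u (p i) x :=
    (Finset.sum_eq_sum_iff_of_le fun i _ => hint i).1
      (le_antisymm (Finset.sum_le_sum fun i _ => hint i) heq) i (Finset.mem_univ i)
  have hae : (fun x => stam i s α β u (p i) x
      - heatScore s u i x ^ 2 * cv (Schrodinger.heat s) u x) =ᵐ[volume] 0 := by
    refine (integral_eq_zero_iff_of_nonneg (fun x => sub_nonneg.2 (hle i x))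
      ((h.integrable_stam i hs α β).sub ((h.heat hs).integrable_sq i))).1 ?_
    rw [integral_sub (h.integrable_stam i hs α β) ((h.heat hs).integrable_sq i), heq', sub_self]
  -- A single x suffices: there the weighted variance is zero, and since the heat kernel never
  -- vanishes, the score is affine wherever u is nonzero.
  obtain ⟨x, hx⟩ := hae.exists
  simp only [Pi.zero_apply] at hx
  rw [h.heatScore_sq_mul i hs, ← h.stam_sub i hs hαβ] at hx
  have hz := (integral_eq_zero_iff_of_nonneg
    (fun y => mul_nonneg (sq_nonneg _) (mul_nonneg (heat_pos hs _).le (h.nonneg y)))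
    (integral_score_sq i hs h.integrable h.nonneg (h.measurable i) (h.integrable_sq i) α β _ x).1).1 hx
  refine ⟨cv (heatD i s) u x / cv (Schrodinger.heat s) u x + β * (x i / (2 * s)), ?_⟩
  filter_upwards [hz] with y hy
  simp only [Pi.zero_apply, mul_eq_zero, (heat_pos hs _).ne', false_or, pow_eq_zero_iff two_ne_zero]
    at hy
  rcases hy with hy | hy
  · rw [PiLp.sub_apply] at hy
    linear_combination u y * hy
  · simp [hy]

end Schrodinger

/-! ### Entropy dissipation from time zero and comparison with the heat kernel -/

namespace Schrodinger
open Filter Topology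
open scoped ENNReal

variable {d : ℕ} {u : EuclideanSpace ℝ (Fin d) → ℝ} {s ε : ℝ}

/-- The heat flow converges to its initial datum in `L¹`. -/
lemma tendsto_lintegral_cv_heat_sub (hu : Integrable u) :
    Tendsto (fun s => ∫⁻ x, ‖cv (heat s) u x - u x‖ₑ) (𝓝[>] 0) (𝓝 0) := by
  have : Fact (1 ≤ (1 : ℝ≥0∞)) := ⟨le_rfl⟩
  have h1 := tendsto_eLpNorm_translate (p := 1) (by norm_num) (memLp_one_iff_integrable.2 hu)
  simp_rw [eLpNorm_one_eq_lintegral_enorm] at h1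
  set D : ℝ≥0∞ := ∫⁻ x, ‖u x‖ₑ with hD
  have hDtop : D ≠ ⊤ := hu.2.ne
  have hbd : ∀ y, ∫⁻ x, ‖u (x - y) - u x‖ₑ ≤ 2 * D := fun y => by
    calc ∫⁻ x, ‖u (x - y) - u x‖ₑ ≤ ∫⁻ x, (‖u (x - y)‖ₑ + ‖u x‖ₑ) :=
          lintegral_mono fun x => enorm_sub_le
      _ = 2 * D := by
          rw [lintegral_add_right' _ hu.1.enorm, lintegral_sub_right_eq_self (fun x => ‖u x‖ₑ),
            two_mul]
  rw [ENNReal.tendsto_nhds_zero] at h1 ⊢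
  intro ε hε
  have hε2 : 0 < ε / 2 := ENNReal.half_pos hε.ne'
  obtain ⟨δ, hδ, hball⟩ := Metric.eventually_nhds_iff_ball.1 (h1 (ε / 2) hε2)
  -- Small translations use continuity in L¹. Large ones use the trivial bound with a Chebyshev
  -- factor, whose average is the second moment 2ds/δ² and tends to 0 with s.
  have hpt : ∀ y, ∫⁻ x, ‖u (x - y) - u x‖ₑ ≤
      ε / 2 + 2 * D * ENNReal.ofReal (‖y‖ ^ 2 / δ ^ 2) := fun y => by
    by_cases hy : ‖y‖ < δ
    · exact (hball y (by simpa using hy)).trans le_self_add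
    · refine (hbd y).trans (le_add_left ?_)
      refine le_mul_of_one_le_right' ?_
      rw [ENNReal.one_le_ofReal, one_le_div (by positivity)]
      exact pow_le_pow_left₀ hδ.le (not_lt.1 hy) 2
  have hlim : Tendsto (fun s : ℝ => 2 * D * ENNReal.ofReal (2 * d * s / δ ^ 2)) (𝓝[>] 0) (𝓝 0) := by
    have t1 : Tendsto (fun s : ℝ => 2 * d * s / δ ^ 2) (𝓝[>] 0) (𝓝 0) := by
      have : Continuous fun s : ℝ => 2 * d * s / δ ^ 2 := by fun_prop
      simpa using (this.tendsto 0).mono_left nhdsWithin_le_nhds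
    have t2 := ENNReal.Tendsto.const_mul (a := 2 * D) (ENNReal.tendsto_ofReal t1)
      (Or.inr (by finiteness))
    simpa using t2
  filter_upwards [self_mem_nhdsWithin, (ENNReal.tendsto_nhds_zero.1 hlim) (ε / 2) hε2] with s hs hs2
  have hs : 0 < s := hs
  have hK := heat_isProbKernel (d := d) hs
  have key := lintegral_cv_sub_rpow_le hK hu.1 le_rfl
  simp only [ENNReal.rpow_one] at key
  refine key.trans ?_
  calc ∫⁻ y, ENNReal.ofReal (heat s y) * ∫⁻ x, ‖u (x - y) - u x‖ₑ
      ≤ ∫⁻ y, (ENNReal.ofReal (heat s y) * (ε / 2) +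
          2 * D * ENNReal.ofReal (‖y‖ ^ 2 * heat s y / δ ^ 2)) := by
        refine lintegral_mono fun y => (mul_le_mul_right (hpt y) _).trans (le_of_eq ?_)
        rw [mul_add, mul_left_comm, ← ENNReal.ofReal_mul (heat_pos hs y).le]
        congr 3
        ring
    _ = ε / 2 + 2 * D * ENNReal.ofReal (2 * d * s / δ ^ 2) := by
        rw [lintegral_add_left (hK.measurable.ennreal_ofReal.mul_const _),
          lintegral_mul_const _ hK.measurable.ennreal_ofReal,
          ← ofReal_integral_eq_lintegral_ofReal hK.integrable (.of_forall hK.nonneg),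
          hK.integral_eq_one, ENNReal.ofReal_one, one_mul, lintegral_const_mul' _ _ (by finiteness),
          ← ofReal_integral_eq_lintegral_ofReal ((integrable_norm_sq_mul_heat hs).div_const _)
            (.of_forall fun y => by have := heat_pos hs y; positivity), integral_div,
          integral_norm_sq_mul_heat hs]
    _ ≤ ε / 2 + ε / 2 := by gcongr
    _ = ε := ENNReal.add_halves ε

variable {p : Fin d → EuclideanSpace ℝ (Fin d) → ℝ}

/-- The entropy derivative is minus an integral weighted by `ddphi`, hence at least minus the Fisher
information; adding a primitive `b` of an upper bound makes the sum nondecreasing. -/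
lemma HasScore.entropy_add_monotoneOn (h : HasScore u p) (hε : 0 < ε) {b B : ℝ → ℝ}
    (hb : ∀ s, 0 < s → HasDerivAt b (B s) s)
    (hB : ∀ s, 0 < s → fisher (cv (Schrodinger.heat s) u) (heatScore s u) ≤ B s) :
    MonotoneOn (fun s => (∫ x, phi ε (cv (Schrodinger.heat s) u x)) + b s) (Set.Ioi 0) := by
  have hd := fun s (hs : 0 < s) => (hasDerivAt_integral_phi_cv_heat hε hs h.integrable h.nonneg
    h.integral_eq_one).add (hb s hs)
  refine monotoneOn_of_deriv_nonneg (convex_Ioi 0)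
    (fun s hs => (hd s hs).continuousAt.continuousWithinAt)
    (fun s hs => (hd s (interior_subset hs)).differentiableAt.differentiableWithinAt)
    fun s hs => ?_
  have hs : 0 < s := interior_subset hs
  have e := (hd s hs).deriv
  refine le_of_le_of_eq ?_ e.symm
  have : ∑ i, ∫ x, ddphi ε (cv (Schrodinger.heat s) u x) * cv (heatD i s) u x ^ 2
      ≤ fisher (cv (Schrodinger.heat s) u) (heatScore s u) := by
    refine Finset.sum_le_sum fun i _ => integral_mono_of_nonneg
      (.of_forall fun x => mul_nonneg (ddphi_nonneg hε (h.cv_pos hs x).le) (sq_nonneg _))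
      ((h.heat hs).integrable_sq i) (.of_forall fun x => ?_)
    simp only
    rw [h.heatScore_sq_mul i hs, div_eq_inv_mul, ← one_div]
    gcongr
    exact ddphi_le_inv hε (h.cv_pos hs x)
  linarith [hB s hs]

/-- The entropy dissipation inequality along the heat flow. -/
lemma HasScore.entropy_le (h : HasScore u p) (hε : 0 < ε) {b B : ℝ → ℝ} {b₀ : ℝ}
    (hb : ∀ s, 0 < s → HasDerivAt b (B s) s)
    (hB : ∀ s, 0 < s → fisher (cv (Schrodinger.heat s) u) (heatScore s u) ≤ B s)
    (hb0 : Tendsto b (𝓝[>] 0) (𝓝 b₀)) {S : ℝ} (hS : 0 < S) :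
    Integrable (fun x => phi ε (u x)) ∧
      ∫ x, phi ε (u x) ≤ (∫ x, phi ε (cv (Schrodinger.heat S) u x)) + b S - b₀ := by
  have hmono := h.entropy_add_monotoneOn hε hb hB
  -- Only L¹ convergence is known as s → 0, so an almost everywhere convergent subsequence of times
  -- is extracted for Fatou's lemma.
  have hs0 : Tendsto (fun n : ℕ => 1 / ((n : ℝ) + 1)) atTop (𝓝[>] 0) :=
    tendsto_nhdsWithin_iff.2 ⟨tendsto_one_div_add_atTop_nhds_zero_nat,
      .of_forall fun n => by simp only [Set.mem_Ioi]; positivity⟩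
  have hsp : ∀ n : ℕ, 0 < 1 / ((n : ℝ) + 1) := fun n => by positivity
  have hL1 := (tendsto_lintegral_cv_heat_sub h.integrable).comp hs0
  have hmeas : TendstoInMeasure volume
      (fun n : ℕ => cv (Schrodinger.heat (1 / ((n : ℝ) + 1))) u) atTop u := by
    refine tendstoInMeasure_of_tendsto_eLpNorm one_ne_zero
      (fun n => (cv_integrable (heat_isProbKernel (hsp n)).integrable h.integrable).1)
      h.integrable.1 ?_
    simp_rw [eLpNorm_one_eq_lintegral_enorm]
    exact hL1
  obtain ⟨ns, hns, hae⟩ := hmeas.exists_seq_tendsto_ae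
  set R := (∫ x, phi ε (cv (Schrodinger.heat S) u x)) + b S - b₀ with hR
  let σ : ℕ → ℝ := fun n => 1 / ((ns n : ℝ) + 1)
  have hσ : Tendsto σ atTop (𝓝[>] 0) := hs0.comp hns.tendsto_atTop
  have hσp : ∀ n, 0 < σ n := fun n => hsp _
  have hF : ∀ᶠ n in atTop, ∫ x, phi ε (cv (Schrodinger.heat (σ n)) u x) ≤
      (∫ x, phi ε (cv (Schrodinger.heat S) u x)) + b S - b (σ n) := by
    filter_upwards [(tendsto_nhdsWithin_iff.1 hσ).1.eventually_lt_const hS] with n hn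
    have := hmono (hσp n) hS hn.le
    simp only at this
    linarith
  have hlimR : Tendsto (fun n => (∫ x, phi ε (cv (Schrodinger.heat S) u x)) + b S - b (σ n))
      atTop (𝓝 R) := (hb0.comp hσ).const_sub _
  -- Nonnegativity is needed to return from `ENNReal.ofReal R` to a real inequality.
  have hR0 : 0 ≤ R := by
    refine ge_of_tendsto hlimR ?_
    filter_upwards [hF] with n hn
    exact (integral_nonneg fun x => phi_nonneg hε (h.cv_pos (hσp n) x).le).trans hn
  have hfatou : ∫⁻ x, ENNReal.ofReal (phi ε (u x)) ≤ ENNReal.ofReal R := by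
    calc ∫⁻ x, ENNReal.ofReal (phi ε (u x))
        = ∫⁻ x, liminf (fun n => ENNReal.ofReal
            (phi ε (cv (Schrodinger.heat (σ n)) u x))) atTop := by
          refine lintegral_congr_ae ?_
          filter_upwards [hae] with x hx
          have := (hasDerivAt_phi hε (h.nonneg x)).continuousAt.tendsto.comp hx
          exact (ENNReal.tendsto_ofReal this).liminf_eq.symm
      _ ≤ liminf (fun n => ∫⁻ x, ENNReal.ofReal
            (phi ε (cv (Schrodinger.heat (σ n)) u x))) atTop := by
          refine lintegral_liminf_le' fun n => ?_
          exact ((measurable_phi ε).comp_aemeasurable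
            (cv_integrable (heat_isProbKernel (hσp n)).integrable
              h.integrable).1.aemeasurable).ennreal_ofReal
      _ ≤ liminf (fun n => ENNReal.ofReal
            ((∫ x, phi ε (cv (Schrodinger.heat S) u x)) + b S - b (σ n))) atTop := by
          refine liminf_le_liminf ?_
          filter_upwards [hF] with n hn
          rw [← ofReal_integral_eq_lintegral_ofReal
            (integrable_phi_cv_heat hε (hσp n) h.integrable h.nonneg h.integral_eq_one)
            (.of_forall fun x => phi_nonneg hε (h.cv_pos (hσp n) x).le)]
          exact ENNReal.ofReal_le_ofReal hn
      _ = ENNReal.ofReal R := (ENNReal.tendsto_ofReal hlimR).liminf_eq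
  have hm : AEStronglyMeasurable (fun x => phi ε (u x)) :=
    ((measurable_phi ε).comp_aemeasurable h.integrable.1.aemeasurable).aestronglyMeasurable
  have hn : 0 ≤ᵐ[volume] fun x => phi ε (u x) := .of_forall fun x => phi_nonneg hε (h.nonneg x)
  refine ⟨⟨hm, ?_⟩, ?_⟩
  · rw [hasFiniteIntegral_iff_ofReal hn]
    exact hfatou.trans_lt ENNReal.ofReal_lt_top
  · rw [integral_eq_lintegral_of_nonneg_ae hn hm]
    exact ENNReal.toReal_le_of_le_ofReal hR0 hfatou

lemma continuous_phi_heat (hε : 0 < ε) (hs : 0 < s) :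
    Continuous fun x : EuclideanSpace ℝ (Fin d) => phi ε (heat s x) := by
  have h := heat_continuous (d := d) s
  refine h.mul ((continuous_const.add (h.div_const ε)).log fun x => ?_)
  exact (add_pos_of_pos_of_nonneg one_pos (div_nonneg (heat_pos hs x).le hε.le)).ne'

lemma phi_heat_le (hε : 0 < ε) (hs : 0 < s) (x : EuclideanSpace ℝ (Fin d)) :
    |phi ε (heat s x)| ≤ (4 * Real.pi * s) ^ (-(d / 2 : ℝ)) / ε * heat s x := by
  rw [abs_of_nonneg (phi_nonneg hε (heat_pos hs x).le)]
  exact phi_le hε (heat_pos hs x).le (heat_le hs x)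

lemma integrable_phi_heat (hε : 0 < ε) (hs : 0 < s) :
    Integrable fun x : EuclideanSpace ℝ (Fin d) => phi ε (heat s x) :=
  ((heat_isProbKernel hs).integrable.const_mul _).mono'
    (continuous_phi_heat hε hs).aestronglyMeasurable (.of_forall fun x => phi_heat_le hε hs x)

/-- Convolution with the heat kernel is more spread out than the heat kernel. -/
lemma integral_phi_cv_heat_le (hε : 0 < ε) (hs : 0 < s) (hu : Integrable u) (h0 : ∀ x, 0 ≤ u x)
    (h1 : ∫ x, u x = 1) :
    ∫ x, phi ε (cv (heat s) u x) ≤ ∫ x : EuclideanSpace ℝ (Fin d), phi ε (heat s x) := by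
  have hK := continuous_phi_heat (d := d) hε hs
  have e : ∫ x, cv (fun z => phi ε (heat s z)) u x
      = ∫ x : EuclideanSpace ℝ (Fin d), phi ε (heat s x) := by
    rw [integral_cv (integrable_phi_heat hε hs) hu, h1, mul_one]
  rw [← e]
  refine integral_mono (integrable_phi_cv_heat hε hs hu h0 h1)
    (cv_integrable (integrable_phi_heat hε hs) hu) fun x => ?_
  set a := cv (heat s) u x with ha
  have hp : 0 < a := cv_heat_pos hs hu h0 h1 x
  have j1 := cv_integrand_integrable hK (C := (4 * Real.pi * s) ^ (-(d / 2 : ℝ)) / ε *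
    (4 * Real.pi * s) ^ (-(d / 2 : ℝ))) (fun z => (phi_heat_le hε hs z).trans (by
      have := heat_const_pos (d := d) hs
      gcongr
      exact heat_le hs z)) hu x
  have j2 := cv_integrand_integrable (heat_continuous s) (abs_heat_le_self hs) hu x
  -- This is Jensen's inequality for the probability density u: the tangent line of `phi ε` at the
  -- mean a of heat(x - y) integrates to `phi ε a`.
  have h3 : ∫ y, ((phi ε a - dphi ε a * a) * u y + dphi ε a * (heat s (x - y) * u y)) = phi ε a := by
    rw [integral_add (hu.const_mul _) (j2.const_mul _), integral_const_mul, integral_const_mul, h1]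
    have : ∫ y, heat s (x - y) * u y = a := rfl
    rw [this]
    ring
  simp only
  rw [← h3]
  refine integral_mono ((hu.const_mul _).add (j2.const_mul _)) j1 fun y => ?_
  have := mul_le_mul_of_nonneg_right (phi_tangent hε hp.le (heat_pos hs (x - y)).le) (h0 y)
  simp only [smul_eq_mul]
  linarith

lemma log_heat (hs : 0 < s) (x : EuclideanSpace ℝ (Fin d)) :
    Real.log (heat s x) = -(d / 2) * Real.log (4 * Real.pi * s) - 1 / (4 * s) * ‖x‖ ^ 2 := by
  rw [heat, Real.log_mul (heat_const_pos hs).ne' (Real.exp_pos _).ne', Real.log_exp,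
    Real.log_rpow (by positivity)]
  ring

lemma integrable_heat_mul_log (hs : 0 < s) :
    Integrable fun x : EuclideanSpace ℝ (Fin d) => heat s x * Real.log (heat s x) := by
  have := ((heat_isProbKernel (d := d) hs).integrable.const_mul
    (-(d / 2) * Real.log (4 * Real.pi * s))).sub
    ((integrable_norm_sq_mul_heat hs).const_mul (1 / (4 * s)))
  refine this.congr (.of_forall fun x => ?_)
  simp only [Pi.sub_apply, log_heat hs]
  ring

lemma integral_heat_mul_log (hs : 0 < s) :
    ∫ x : EuclideanSpace ℝ (Fin d), heat s x * Real.log (heat s x) =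
      -(d / 2) * Real.log (4 * Real.pi * s) - d / 2 := by
  have e : ∀ x : EuclideanSpace ℝ (Fin d), heat s x * Real.log (heat s x) =
      -(d / 2) * Real.log (4 * Real.pi * s) * heat s x - 1 / (4 * s) * (‖x‖ ^ 2 * heat s x) :=
    fun x => by rw [log_heat hs]; ring
  simp_rw [e]
  rw [integral_sub ((heat_isProbKernel hs).integrable.const_mul _)
    ((integrable_norm_sq_mul_heat hs).const_mul _), integral_const_mul, integral_const_mul,
    (heat_isProbKernel hs).integral_eq_one, integral_norm_sq_mul_heat hs]
  field_simp
  ring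

/-- A quantity below all regularised entropies of the heat kernel is below its entropy. -/
lemma le_entropy_heat (hs : 0 < s) {c : ℝ}
    (hc : ∀ ε, 0 < ε → ε ≤ 1 →
      c ≤ (∫ x : EuclideanSpace ℝ (Fin d), phi ε (heat s x)) + Real.log ε) :
    c ≤ -(d / 2) * Real.log (4 * Real.pi * s) - d / 2 := by
  have hK := heat_isProbKernel (d := d) hs
  rw [← integral_heat_mul_log hs]
  let ε : ℕ → ℝ := fun n => 1 / ((n : ℝ) + 1)
  have hε : ∀ n, 0 < ε n := fun n => by simp only [ε]; positivity
  have hε1 : ∀ n, ε n ≤ 1 := fun n => by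
    simp only [ε]
    rw [div_le_one (by positivity)]
    linarith [(n.cast_nonneg : (0 : ℝ) ≤ n)]
  -- Since the kernel has mass one, log ε enters the integral and cancels the scaling, leaving r
  -- log(ε + r), which converges to r log r.
  have e : ∀ n, (∫ x : EuclideanSpace ℝ (Fin d), phi (ε n) (heat s x)) + Real.log (ε n) =
      ∫ x : EuclideanSpace ℝ (Fin d), heat s x * Real.log (ε n + heat s x) := fun n => by
    have : Real.log (ε n) = ∫ x : EuclideanSpace ℝ (Fin d), Real.log (ε n) * heat s x := by
      rw [integral_const_mul, hK.integral_eq_one, mul_one]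
    rw [this, ← integral_add (integrable_phi_heat (hε n) hs) (hK.integrable.const_mul _)]
    refine integral_congr_ae (.of_forall fun x => ?_)
    have h0 := heat_pos hs x
    have h1 := hε n
    simp only [phi]
    rw [show ε n + heat s x = ε n * (1 + heat s x / ε n) by field_simp,
      Real.log_mul h1.ne' (by positivity)]
    ring
  have hlim : Tendsto (fun n => ∫ x : EuclideanSpace ℝ (Fin d),
      heat s x * Real.log (ε n + heat s x)) atTop
      (𝓝 (∫ x : EuclideanSpace ℝ (Fin d), heat s x * Real.log (heat s x))) := by
    refine tendsto_integral_of_dominated_convergence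
      (fun x => |heat s x * Real.log (heat s x)| + (4 * Real.pi * s) ^ (-(d / 2 : ℝ)) * heat s x)
      (fun n => ?_) ((integrable_heat_mul_log hs).abs.add (hK.integrable.const_mul _))
      (fun n => .of_forall fun x => ?_) (.of_forall fun x => ?_)
    · exact (hK.measurable.mul
        ((measurable_const.add hK.measurable).log)).aestronglyMeasurable
    · have h0 := heat_pos hs x
      have h1 := hε n
      rw [Real.norm_eq_abs, abs_mul, abs_mul, abs_of_pos h0, mul_comm _ (heat s x), ← mul_add]
      gcongr
      -- For ε ≤ 1 the logarithm lies between log r and r, a bound independent of n.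
      have h2 : Real.log (heat s x) ≤ Real.log (ε n + heat s x) :=
        Real.log_le_log h0 (by linarith)
      have h3 : Real.log (ε n + heat s x) ≤ heat s x := by
        have := Real.log_le_sub_one_of_pos (by linarith : 0 < ε n + heat s x)
        linarith [hε1 n]
      have h4 := heat_le hs x
      have h5 := neg_abs_le (Real.log (heat s x))
      have h6 := abs_nonneg (Real.log (heat s x))
      rw [abs_le]
      constructor <;> linarith
    · have h0 := heat_pos hs x
      have t1 : Tendsto (fun n => ε n + heat s x) atTop (𝓝 (0 + heat s x)) :=
        tendsto_one_div_add_atTop_nhds_zero_nat.add_const _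
      rw [zero_add] at t1
      exact (t1.log h0.ne').const_mul _
  exact ge_of_tendsto' hlim fun n => (hc _ (hε n) (hε1 n)).trans (e n).le

/-! ### The sharp Euclidean logarithmic Sobolev inequality -/

/-- The primitive of the bound on the Fisher information of the heat flow. -/
noncomputable def flowBound (d : ℕ) (τ I s : ℝ) : ℝ :=
  -(τ ^ 2 * I / (s + τ)) + d / 2 * (Real.log (s + τ) + τ / (s + τ))

/-- The weights τ/(s+τ) and s/(s+τ) minimise α²I + β²d/(2s) when I = d/(2τ), the Fisher information
of the heat kernel at time τ. This is where sharpness comes from. -/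
lemma hasDerivAt_flowBound (d : ℕ) {τ I s : ℝ} (hτ : 0 < τ) (hs : 0 < s) :
    HasDerivAt (flowBound d τ I)
      ((τ / (s + τ)) ^ 2 * I + (s / (s + τ)) ^ 2 * (d / (2 * s))) s := by
  have h1 : HasDerivAt (fun s => s + τ) 1 s := (hasDerivAt_id s).add_const τ
  have h2 : s + τ ≠ 0 := by positivity
  refine (((hasDerivAt_const s (τ ^ 2 * I)).div h1 h2).neg.add
    (((h1.log h2).add ((hasDerivAt_const s τ).div h1 h2)).const_mul (d / 2 : ℝ))).congr_deriv ?_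
  field_simp
  ring

lemma tendsto_flowBound (d : ℕ) {τ I : ℝ} (hτ : 0 < τ) :
    Tendsto (flowBound d τ I) (𝓝[>] 0) (𝓝 (-(τ * I) + d / 2 * (Real.log τ + 1))) := by
  have h : ContinuousAt (flowBound d τ I) 0 := by
    unfold flowBound
    have : (0 : ℝ) + τ ≠ 0 := by positivity
    fun_prop (disch := assumption)
  have e : flowBound d τ I 0 = -(τ * I) + d / 2 * (Real.log τ + 1) := by
    unfold flowBound
    rw [zero_add, div_self hτ.ne']
    field_simp
  rw [← e]
  exact h.tendsto.mono_left nhdsWithin_le_nhds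

lemma HasScore.entropy_le_flowBound (h : HasScore u p) (hε : 0 < ε) {τ S : ℝ} (hτ : 0 < τ)
    (hS : 0 < S) :
    ∫ x, phi ε (u x) ≤ (∫ x, phi ε (cv (Schrodinger.heat S) u x)) +
      flowBound d τ (fisher u p) S - (-(τ * fisher u p) + d / 2 * (Real.log τ + 1)) :=
  (h.entropy_le hε (fun s hs => hasDerivAt_flowBound d hτ hs)
    (fun s hs => h.fisher_heat_le hs (by field_simp; ring)) (tendsto_flowBound d hτ) hS).2

/-- The sharp Euclidean logarithmic Sobolev inequality. -/
theorem HasScore.logSobolev (h : HasScore u p) {c τ : ℝ} (hτ : 0 < τ)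
    (hc : ∀ ε, 0 < ε → ε ≤ 1 → c ≤ (∫ x, phi ε (u x)) + Real.log ε) :
    c ≤ τ * fisher u p - d - d / 2 * Real.log (4 * Real.pi * τ) := by
  set I := fisher u p
  have h1 : ∀ S, 0 < S → c ≤ -(d / 2) * Real.log (4 * Real.pi * S) - d / 2 +
      flowBound d τ I S - (-(τ * I) + d / 2 * (Real.log τ + 1)) := fun S hS => by
    -- The shift collects everything independent of ε, so that ε → 0 is taken only for the explicit
    -- kernel.
    have := le_entropy_heat (d := d) (s := S) hS
      (c := c - (flowBound d τ I S - (-(τ * I) + d / 2 * (Real.log τ + 1)))) fun ε hε hε1 => by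
        have a1 := hc ε hε hε1
        have a2 := h.entropy_le_flowBound hε hτ hS
        have a3 := integral_phi_cv_heat_le hε hS h.integrable h.nonneg h.integral_eq_one
        linarith
    linarith
  -- As S → ∞ the term (d/2) log(S + τ) of `flowBound` cancels against -(d/2) log S from the entropy
  -- of the kernel.
  have hS : Tendsto (fun S : ℝ => τ / S) atTop (𝓝 0) := tendsto_const_nhds.div_atTop tendsto_id
  have h2 : Tendsto (fun S : ℝ => -(d / 2) * Real.log (4 * Real.pi) - d / 2 +
      (-(τ ^ 2 * I / (S + τ)) + d / 2 * (Real.log (1 + τ / S) + τ / (S + τ)))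
      - (-(τ * I) + d / 2 * (Real.log τ + 1))) atTop
      (𝓝 (-(d / 2) * Real.log (4 * Real.pi) - d / 2 +
        (-0 + d / 2 * (Real.log (1 + 0) + 0)) - (-(τ * I) + d / 2 * (Real.log τ + 1)))) := by
    have t1 : Tendsto (fun S : ℝ => S + τ) atTop atTop := tendsto_atTop_add_const_right _ _ tendsto_id
    have t2 : Tendsto (fun S : ℝ => τ ^ 2 * I / (S + τ)) atTop (𝓝 0) :=
      tendsto_const_nhds.div_atTop t1
    have t3 : Tendsto (fun S : ℝ => τ / (S + τ)) atTop (𝓝 0) := tendsto_const_nhds.div_atTop t1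
    have t4 : Tendsto (fun S : ℝ => Real.log (1 + τ / S)) atTop (𝓝 (Real.log (1 + 0))) :=
      (hS.const_add 1).log (by norm_num)
    exact ((t2.neg.add ((t4.add t3).const_mul _)).const_add _).sub_const _
  have h3 : c ≤ -(d / 2) * Real.log (4 * Real.pi) - d / 2 +
        (-0 + d / 2 * (Real.log (1 + 0) + 0)) - (-(τ * I) + d / 2 * (Real.log τ + 1)) := by
    refine ge_of_tendsto h2 ?_
    filter_upwards [eventually_gt_atTop 0] with S hS
    refine (h1 S hS).trans (le_of_eq ?_)
    have e1 : Real.log (4 * Real.pi * S) = Real.log (4 * Real.pi) + Real.log S :=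
      Real.log_mul (by positivity) hS.ne'
    have e2 : Real.log (S + τ) = Real.log S + Real.log (1 + τ / S) := by
      rw [← Real.log_mul hS.ne' (by positivity)]
      congr 1
      field_simp
    rw [flowBound, e1, e2]
    ring
  have e3 : Real.log (4 * Real.pi * τ) = Real.log (4 * Real.pi) + Real.log τ :=
    Real.log_mul (by positivity) hτ.ne'
  rw [e3]
  simp at h3
  linarith

/-- The score is affine in the equality case of the logarithmic Sobolev inequality. -/
lemma HasScore.score_eq_of_logSobolev_eq (h : HasScore u p) {c τ : ℝ} (hτ : 0 < τ)
    (hc : ∀ ε, 0 < ε → ε ≤ 1 → c ≤ (∫ x, phi ε (u x)) + Real.log ε)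
    (heq : τ * fisher u p - d - d / 2 * Real.log (4 * Real.pi * τ) ≤ c) (i : Fin d) :
    ∃ b : ℝ, ∀ᵐ y, p i y * u y = (b - y i) / (2 * τ) * u y := by
  set I := fisher u p with hI
  -- The flow runs up to time τ, where both weights equal 1/2. The inequality for the flowed density
  -- at parameter 2τ bounds its Fisher information below by exactly the Stam-Blachman upper bound.
  have h1 := (h.heat hτ).logSobolev (τ := τ + τ)
    (c := c - (flowBound d τ I τ - (-(τ * I) + d / 2 * (Real.log τ + 1)))) (by positivity)
    fun ε hε hε1 => by
      have a1 := hc ε hε hε1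
      have a2 := h.entropy_le_flowBound hε hτ hτ
      linarith
  have e1 : Real.log (4 * Real.pi * (τ + τ)) = Real.log (4 * Real.pi) + Real.log (τ + τ) :=
    Real.log_mul (by positivity) (by positivity)
  have e2 : Real.log (4 * Real.pi * τ) = Real.log (4 * Real.pi) + Real.log τ :=
    Real.log_mul (by positivity) hτ.ne'
  rw [e1, flowBound] at h1
  rw [e2] at heq
  have e3 : τ ^ 2 * I / (τ + τ) = τ * I / 2 := by field_simp; ring
  have e4 : τ / (τ + τ) = 1 / 2 := by field_simp; ring
  rw [e3, e4] at h1
  have h2 : τ * I / 2 + d / 4 ≤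
      (τ + τ) * fisher (cv (Schrodinger.heat τ) u) (heatScore τ u) := by linarith
  have h3 : (1 / 2 : ℝ) ^ 2 * I + (1 / 2) ^ 2 * (d / (2 * τ)) ≤
      fisher (cv (Schrodinger.heat τ) u) (heatScore τ u) := by
    have : (1 / 2 : ℝ) ^ 2 * I + (1 / 2) ^ 2 * (d / (2 * τ)) = (τ * I / 2 + d / 4) / (τ + τ) := by
      field_simp; ring
    rw [this, div_le_iff₀ (by positivity)]
    linarith
  obtain ⟨b, hb⟩ := h.eq_of_fisher_heat_eq hτ (by norm_num) h3 i
  -- Doubling (1/2) p u = (b - y/(4τ)) u gives the score (4τb - y)/(2τ).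
  refine ⟨2 * τ * (2 * b), ?_⟩
  filter_upwards [hb] with y hy
  have : (2 * τ * (2 * b) - y i) / (2 * τ) = 2 * (b - 1 / 2 * (y i / (2 * τ))) := by
    field_simp
  rw [this]
  linear_combination 2 * hy

/-- A density with affine score is Gaussian. -/
lemma HasScore.eq_gaussian (h : HasScore u p) {τ : ℝ} (hτ : 0 < τ) {b : EuclideanSpace ℝ (Fin d)}
    (hb : ∀ i, ∀ᵐ y, p i y * u y = (b i - y i) / (2 * τ) * u y) :
    ∃ C : ℝ, ∀ᵐ y, u y = C * Real.exp (-(1 / (4 * τ)) * ‖y - b‖ ^ 2) := by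
  -- The inverse Gaussian is an integrating factor: `w * u` has zero weak gradient. Although `w` is
  -- unbounded, η w is still a test function.
  let w : EuclideanSpace ℝ (Fin d) → ℝ := fun y => Real.exp (1 / (4 * τ) * ‖y - b‖ ^ 2)
  have hw : ContDiff ℝ ∞ w :=
    (contDiff_const.mul ((contDiff_norm_sq ℝ).comp (contDiff_id.sub contDiff_const))).exp
  have hdw : ∀ (i : Fin d) y, fderiv ℝ w y (EuclideanSpace.single i 1)
      = (y i - b i) / (2 * τ) * w y := fun i y => by
    have h1 := (hw.differentiable (by simp) y).hasFDerivAt.hasLineDerivAt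
      (EuclideanSpace.single i (1 : ℝ))
    rw [← h1.lineDeriv]
    have h2 := hasLineDerivAt_norm_sq i (y - b)
    unfold HasLineDerivAt at h2
    have h3 : HasLineDerivAt ℝ w ((y i - b i) / (2 * τ) * w y) y (EuclideanSpace.single i 1) := by
      unfold HasLineDerivAt
      have h4 := ((h2.const_mul (1 / (4 * τ))).exp)
      simp only [zero_smul, add_zero, PiLp.sub_apply] at h4
      refine (h4.congr_of_eventuallyEq (.of_forall fun t => ?_)).congr_deriv ?_
      · simp only [w]
        congr 4
        abel
      · simp only [w]
        field_simp
        ring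
    exact h3.lineDeriv
  have hl : LocallyIntegrable fun y => w y * u y := by
    rw [← locallyIntegrableOn_univ]
    exact (h.integrable.locallyIntegrable.locallyIntegrableOn Set.univ).continuousOn_mul
      hw.continuous.continuousOn isOpen_univ.isLocallyClosed
  have hz : ∀ i : Fin d, HasWeakDeriv (EuclideanSpace.single i 1) (fun y => w y * u y) 0 := by
    intro i η hη hc
    have hζ : ContDiff ℝ ∞ fun y => η y * w y := hη.mul hw
    have hζc : HasCompactSupport fun y => η y * w y := hc.mul_right
    have hd : ∀ y, fderiv ℝ (fun y => η y * w y) y (EuclideanSpace.single i 1)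
        = fderiv ℝ η y (EuclideanSpace.single i 1) * w y
          + η y * ((y i - b i) / (2 * τ) * w y) := fun y => by
      have a := (hη.differentiable (by simp) y).hasFDerivAt.mul
        (hw.differentiable (by simp) y).hasFDerivAt
      rw [show (fun y => η y * w y) = η * w from rfl, a.fderiv, ← hdw]
      simp
      ring
    have key := h.weakDeriv i _ hζ hζc
    simp_rw [hd] at key
    have i1 := integrable_smul_of_hasCompactSupport (continuous_fderiv_dir hη _)
        (hasCompactSupport_fderiv_dir hc (EuclideanSpace.single i 1)) hl
    have i2 : Integrable fun y => (η y * ((y i - b i) / (2 * τ) * w y)) * u y :=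
      integrable_smul_of_hasCompactSupport (η := fun y => η y * ((y i - b i) / (2 * τ) * w y))
        (by have := hη.continuous; have := hw.continuous; fun_prop) hc.mul_right
        h.integrable.locallyIntegrable
    have e1 : ∫ y, (η y * w y) • (p i y * u y) = - ∫ y, (η y * ((y i - b i) / (2 * τ) * w y)) * u y := by
      rw [← integral_neg]
      refine integral_congr_ae ?_
      filter_upwards [hb i] with y hy
      rw [hy, smul_eq_mul]
      ring
    have e2 : ∫ y, (fderiv ℝ η y (EuclideanSpace.single i 1) * w y
          + η y * ((y i - b i) / (2 * τ) * w y)) • u y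
        = (∫ y, fderiv ℝ η y (EuclideanSpace.single i 1) • (w y * u y))
          + ∫ y, (η y * ((y i - b i) / (2 * τ) * w y)) * u y := by
      rw [← integral_add i1 i2]
      refine integral_congr_ae (.of_forall fun y => ?_)
      simp only [smul_eq_mul]
      ring
    rw [e2, e1] at key
    simp only [Pi.zero_apply, smul_zero, integral_zero, neg_zero]
    linarith
  obtain ⟨C, hC⟩ := ae_const_of_hasWeakDeriv_zero hl fun v => by
    have h1 := HasWeakDeriv.sum_dir Finset.univ (v := fun i => v i • EuclideanSpace.single i (1 : ℝ))
      (f := fun y => w y * u y) (g := fun i => v i • (0 : EuclideanSpace ℝ (Fin d) → ℝ)) hl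
      (fun i _ => by simpa using! locallyIntegrable_zero) fun i _ => (hz i).smul_dir (v i)
    have h2 : ∑ i, v i • EuclideanSpace.single i (1 : ℝ) = v := by
      ext j
      simp [Finset.sum_apply, Pi.single_apply]
    simpa [h2] using h1
  refine ⟨C, ?_⟩
  filter_upwards [hC] with y hy
  rw [← hy, mul_right_comm, ← Real.exp_add]
  simp

end Schrodinger

namespace Schrodinger
open Filter Topology
open scoped ENNReal

variable {d : ℕ} {ψ : EuclideanSpace ℝ (Fin d) → ℂ}
  {G : EuclideanSpace ℝ (Fin d) → EuclideanSpace ℂ (Fin d)}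

/-! ### Weak gradients and densities -/

lemma hasWeakGradient_iff : HasWeakGradient ψ G ↔
    ∀ i, HasWeakDeriv (EuclideanSpace.single i 1) ψ fun x => G x i := by
  have e1 : ∀ (η : EuclideanSpace ℝ (Fin d) → ℝ) (i : Fin d),
      ∫ x, ψ x * ((fderiv ℝ η x (EuclideanSpace.single i 1) : ℝ) : ℂ)
        = ∫ x, fderiv ℝ η x (EuclideanSpace.single i 1) • ψ x := fun η i =>
    integral_congr_ae (.of_forall fun x => by simp only [Complex.real_smul, mul_comm])
  have e2 : ∀ (η : EuclideanSpace ℝ (Fin d) → ℝ) (i : Fin d),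
      ∫ x, G x i * (η x : ℂ) = ∫ x, η x • G x i := fun η i =>
    integral_congr_ae (.of_forall fun x => by simp only [Complex.real_smul, mul_comm])
  simp only [HasWeakGradient, HasWeakDeriv, e1, e2]
  exact ⟨fun h i η hη hc => h η hη hc i, fun h η hη hc i => h i η hη hc⟩

lemma memLp_coord (hG : MemLp G 2) (i : Fin d) : MemLp (fun x => G x i) 2 :=
  (EuclideanSpace.proj i : EuclideanSpace ℂ (Fin d) →L[ℂ] ℂ).comp_memLp' hG

lemma integrable_norm_sq {F : Type*} [NormedAddCommGroup F] {f : EuclideanSpace ℝ (Fin d) → F}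
    (hf : MemLp f 2) : Integrable fun x => ‖f x‖ ^ 2 := by
  simpa using hf.integrable_norm_pow (p := 2) (by norm_num)

lemma HasWeakGradient.const_mul (h : HasWeakGradient ψ G) (c : ℂ) :
    HasWeakGradient (fun x => c * ψ x) (fun x => c • G x) := by
  intro η hη hc i
  simp only [PiLp.smul_apply, smul_eq_mul, mul_assoc, integral_const_mul]
  rw [h η hη hc i, mul_neg]

/-- The logarithmic gradient of `|ψ|²`. -/
noncomputable def score (ψ : EuclideanSpace ℝ (Fin d) → ℂ)
    (G : EuclideanSpace ℝ (Fin d) → EuclideanSpace ℂ (Fin d)) (i : Fin d)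
    (x : EuclideanSpace ℝ (Fin d)) : ℝ := 2 * (starRingEnd ℂ (ψ x) * G x i).re / ‖ψ x‖ ^ 2

/-- At zeros of ψ the quotient has the default value 0, and both sides vanish there. -/
lemma score_mul (i : Fin d) (x : EuclideanSpace ℝ (Fin d)) :
    score ψ G i x * ‖ψ x‖ ^ 2 = 2 * (starRingEnd ℂ (ψ x) * G x i).re := by
  unfold score
  by_cases h : ψ x = 0
  · simp [h]
  · field_simp

/-- Cauchy-Schwarz for the real part: the gradient of |ψ|² sees only part of ∇ψ. This is what lets
the kinetic energy dominate the Fisher information. -/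
lemma score_sq_mul_le (i : Fin d) (x : EuclideanSpace ℝ (Fin d)) :
    score ψ G i x ^ 2 * ‖ψ x‖ ^ 2 ≤ 4 * ‖G x i‖ ^ 2 := by
  unfold score
  by_cases h : ψ x = 0
  · simp [h]
  · have h1 : |(starRingEnd ℂ (ψ x) * G x i).re| ≤ ‖ψ x‖ * ‖G x i‖ := by
      refine (Complex.abs_re_le_norm _).trans ?_
      simp
    have h2 : (starRingEnd ℂ (ψ x) * G x i).re ^ 2 ≤ (‖ψ x‖ * ‖G x i‖) ^ 2 := by
      rw [← sq_abs]; gcongr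
    have h3 : 0 < ‖ψ x‖ := norm_pos_iff.2 h
    rw [div_pow, div_mul_eq_mul_div, div_le_iff₀ (by positivity)]
    nlinarith [sq_nonneg ‖ψ x‖]

lemma hasScore_norm_sq (hψ : MemLp ψ 2) (hG : MemLp G 2) (h : HasWeakGradient ψ G)
    (h1 : ∫ x, ‖ψ x‖ ^ 2 = 1) : HasScore (fun x => ‖ψ x‖ ^ 2) (score ψ G) := by
  have hm : ∀ i, AEStronglyMeasurable (score ψ G i) := fun i => by
    have a1 := hψ.1.aemeasurable
    have a2 := (memLp_coord hG i).1.aemeasurable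
    have a3 : AEMeasurable fun x => (starRingEnd ℂ (ψ x) * G x i).re :=
      Complex.measurable_re.comp_aemeasurable
        ((Complex.continuous_conj.measurable.comp_aemeasurable a1).mul a2)
    exact ((a3.const_mul 2).div (a1.norm.pow_const 2)).aestronglyMeasurable
  refine ⟨fun x => sq_nonneg _, integrable_norm_sq hψ, h1, hm, fun i => ?_, fun i => ?_⟩
  · refine ((integrable_norm_sq (memLp_coord hG i)).const_mul 4).mono'
      (((hm i).pow 2).mul (integrable_norm_sq hψ).1) (.of_forall fun x => ?_)
    rw [Real.norm_of_nonneg (by positivity)]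
    exact score_sq_mul_le i x
  · simp_rw [score_mul]
    exact (hasWeakGradient_iff.1 h i).norm_sq hψ (memLp_coord hG i)

lemma fisher_norm_sq_le (hψ : MemLp ψ 2) (hG : MemLp G 2) (h : HasWeakGradient ψ G)
    (h1 : ∫ x, ‖ψ x‖ ^ 2 = 1) :
    fisher (fun x => ‖ψ x‖ ^ 2) (score ψ G) ≤ 4 * ∫ x, ‖G x‖ ^ 2 := by
  have e : ∫ x, ‖G x‖ ^ 2 = ∑ i, ∫ x, ‖G x i‖ ^ 2 := by
    simp_rw [EuclideanSpace.norm_sq_eq]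
    exact integral_finsetSum _ fun i _ => integrable_norm_sq (memLp_coord hG i)
  rw [e, Finset.mul_sum]
  refine Finset.sum_le_sum fun i _ => ?_
  rw [← integral_const_mul]
  exact integral_mono ((hasScore_norm_sq hψ hG h h1).integrable_sq i)
    ((integrable_norm_sq (memLp_coord hG i)).const_mul 4) fun x => score_sq_mul_le i x

/-- With α = 1 and β = 0 the Fisher information does not increase along the flow. The time S is
free, and small S makes the gradient term arbitrarily small. -/
lemma HasScore.entropy_one_le {u : EuclideanSpace ℝ (Fin d) → ℝ}
    {p : Fin d → EuclideanSpace ℝ (Fin d) → ℝ} (h : HasScore u p) {ε : ℝ} (hε : 0 < ε) {S : ℝ}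
    (hS : 0 < S) :
    Integrable (fun x => phi ε (u x)) ∧ ∫ x, phi ε (u x) ≤
      (∫ x : EuclideanSpace ℝ (Fin d), phi ε (Schrodinger.heat S x)) + S * fisher u p := by
  have h1 := h.entropy_le hε (b := fun s => s * fisher u p) (B := fun _ => fisher u p) (b₀ := 0)
    (fun s _ => by simpa using (hasDerivAt_id s).mul_const (fisher u p))
    (fun s hs => by simpa using h.fisher_heat_le hs (α := 1) (β := 0) (by norm_num))
    (by
      have : Continuous fun s => s * fisher u p := by fun_prop
      simpa using (this.tendsto 0).mono_left nhdsWithin_le_nhds) hS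
  have h2 := integral_phi_cv_heat_le hε hS h.integrable h.nonneg h.integral_eq_one
  exact ⟨h1.1, by linarith [h1.2]⟩

/-! ### The Gibbs variational principle -/

/-- Young's inequality for the Legendre pair r log r - r and exp; it is x + 1 ≤ exp x at x = b - log
r. -/
lemma mul_le_entropy_add_exp {r : ℝ} (hr : 0 ≤ r) (b : ℝ) :
    r * b ≤ r * Real.log r - r + Real.exp b := by
  rcases hr.eq_or_lt with rfl | hr
  · simpa using (Real.exp_pos b).le
  · have h1 := Real.add_one_le_exp (b - Real.log r)
    rw [Real.exp_sub, Real.exp_log hr, le_div_iff₀ hr] at h1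
    linarith

lemma eq_exp_of_entropy_eq {r b : ℝ} (hr : 0 ≤ r)
    (h : r * Real.log r - r + Real.exp b - r * b = 0) : r = Real.exp b := by
  rcases hr.eq_or_lt with rfl | hr
  · simp at h
  · by_contra hne
    have hne' : b - Real.log r ≠ 0 := fun h0 => hne (by
      rw [← Real.exp_log hr, ← sub_eq_zero.1 h0])
    have h1 := Real.add_one_lt_exp hne'
    rw [Real.exp_sub, Real.exp_log hr, lt_div_iff₀ hr] at h1
    linarith

section potential
variable {V : EuclideanSpace ℝ (Fin d) → ℝ} {t : ℝ}

/-- Measurability of V is not assumed; it is recovered from that of the exponential by taking a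
logarithm. -/
lemma aemeasurable_potential (ht : 0 < t) (hV : Integrable fun x => Real.exp (-t * V x)) :
    AEMeasurable V := by
  have h : V = fun x => -t⁻¹ * Real.log (Real.exp (-t * V x)) := by
    ext x
    rw [Real.log_exp]
    field_simp
  rw [h]
  exact (Real.measurable_log.comp_aemeasurable hV.1.aemeasurable).const_mul _

lemma mul_negPart_le (v : ℝ) {r : ℝ} (hr : 0 ≤ r) :
    t * (max (-v) 0 * r) ≤ phi 1 r + Real.exp (-t * v) := by
  rcases le_total 0 v with hv | hv
  · rw [max_eq_right (by linarith), zero_mul, mul_zero]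
    have := phi_nonneg one_pos hr
    positivity
  · rw [max_eq_left (by linarith)]
    have h1 := mul_le_entropy_add_exp hr (-t * v)
    have h2 : r * Real.log r ≤ phi 1 r := by
      unfold phi
      rcases hr.eq_or_lt with rfl | hr
      · simp
      · gcongr
        simp
    linarith

/-- Controls the negative part of the entropy density, so that u log u is integrable for every
normalised u of finite energy. -/
lemma neg_entropy_le (ht : 0 < t) (v : ℝ) {r : ℝ} (hr : 0 ≤ r) :
    -(r * Real.log r) ≤ t * (max v 0 * r) + Real.exp (-t * v) := by
  have h1 := mul_le_entropy_add_exp hr (-t * v)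
  have h2 := mul_le_mul_of_nonneg_left (mul_le_mul_of_nonneg_right (le_max_left v 0) hr) ht.le
  linarith

lemma entropy_le_phi {ε r : ℝ} (hε : 0 < ε) (hr : 0 ≤ r) :
    r * Real.log r ≤ phi ε r + Real.log ε * r := by
  unfold phi
  rcases hr.eq_or_lt with rfl | hr
  · simp
  · have : Real.log r ≤ Real.log (1 + r / ε) + Real.log ε := by
      rw [← Real.log_mul (by positivity) hε.ne']
      refine Real.log_le_log hr ?_
      field_simp
      linarith
    nlinarith

/-- The negative part of the potential is infinitesimally form bounded, up to constants. -/
lemma negPart_bound_normalized (ht : 0 < t) (hV : Integrable fun x => Real.exp (-t * V x))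
    (hψ : MemLp ψ 2) (hG : MemLp G 2) (h : HasWeakGradient ψ G) (h1 : ∫ x, ‖ψ x‖ ^ 2 = 1)
    {S : ℝ} (hS : 0 < S) :
    Integrable (fun x => max (-V x) 0 * ‖ψ x‖ ^ 2) ∧
    t * ∫ x, max (-V x) 0 * ‖ψ x‖ ^ 2 ≤ 4 * S * (∫ x, ‖G x‖ ^ 2) +
      ((∫ x : EuclideanSpace ℝ (Fin d), phi 1 (heat S x)) + ∫ x, Real.exp (-t * V x)) := by
  have hs := hasScore_norm_sq hψ hG h h1
  obtain ⟨hi, hle⟩ := hs.entropy_one_le one_pos hS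
  have hf := fisher_norm_sq_le hψ hG h h1
  have hm := aemeasurable_potential ht hV
  have hbd : ∀ x, t * (max (-V x) 0 * ‖ψ x‖ ^ 2) ≤ phi 1 (‖ψ x‖ ^ 2) + Real.exp (-t * V x) :=
    fun x => mul_negPart_le (V x) (sq_nonneg _)
  have hint : Integrable fun x => t * (max (-V x) 0 * ‖ψ x‖ ^ 2) := by
    refine (hi.add hV).mono' ?_ (.of_forall fun x => ?_)
    · exact (((hm.neg.max aemeasurable_const).mul
        (hψ.1.aemeasurable.norm.pow_const 2)).const_mul t).aestronglyMeasurable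
    · rw [Real.norm_of_nonneg (by positivity)]
      exact hbd x
  refine ⟨(hint.const_mul t⁻¹).congr (.of_forall fun x => by field_simp), ?_⟩
  rw [← integral_const_mul]
  refine (integral_mono hint (hi.add hV) hbd).trans ?_
  rw [integral_add' hi hV]
  nlinarith

lemma normalize (hψ : MemLp ψ 2) (hG : MemLp G 2) (h : HasWeakGradient ψ G) {N : ℝ} (hN : 0 < N)
    (h1 : ∫ x, ‖ψ x‖ ^ 2 = N) :
    MemLp (fun x => ((Real.sqrt N)⁻¹ : ℂ) * ψ x) 2 ∧ MemLp (fun x => ((Real.sqrt N)⁻¹ : ℂ) • G x) 2 ∧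
    HasWeakGradient (fun x => ((Real.sqrt N)⁻¹ : ℂ) * ψ x) (fun x => ((Real.sqrt N)⁻¹ : ℂ) • G x) ∧
    (∀ x, ‖((Real.sqrt N)⁻¹ : ℂ) * ψ x‖ ^ 2 = N⁻¹ * ‖ψ x‖ ^ 2) ∧
    (∀ x, ‖((Real.sqrt N)⁻¹ : ℂ) • G x‖ ^ 2 = N⁻¹ * ‖G x‖ ^ 2) ∧
    ∫ x, ‖((Real.sqrt N)⁻¹ : ℂ) * ψ x‖ ^ 2 = 1 := by
  have e0 : ‖((Real.sqrt N)⁻¹ : ℂ)‖ ^ 2 = N⁻¹ := by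
    rw [norm_inv, Complex.norm_real, Real.norm_of_nonneg (Real.sqrt_nonneg N), inv_pow,
      Real.sq_sqrt hN.le]
  have e1 : ∀ x, ‖((Real.sqrt N)⁻¹ : ℂ) * ψ x‖ ^ 2 = N⁻¹ * ‖ψ x‖ ^ 2 := fun x => by
    rw [norm_mul, mul_pow, e0]
  have hG' : MemLp (fun x => ((Real.sqrt N)⁻¹ : ℂ) • G x) 2 := by
    have := hG.const_smul ((Real.sqrt N : ℂ)⁻¹)
    exact this
  refine ⟨hψ.const_mul _, hG', h.const_mul _, e1, fun x => ?_, ?_⟩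
  · rw [norm_smul, mul_pow, e0]
  · simp_rw [e1]
    rw [integral_const_mul, h1, inv_mul_cancel₀ hN.ne']

/-- The negative part of the potential is infinitesimally form bounded. -/
lemma negPart_bound (ht : 0 < t) (hV : Integrable fun x => Real.exp (-t * V x)) {a : ℝ}
    (ha : 0 < a) : ∃ C : ℝ, 0 ≤ C ∧ ∀ (ψ : EuclideanSpace ℝ (Fin d) → ℂ)
      (G : EuclideanSpace ℝ (Fin d) → EuclideanSpace ℂ (Fin d)), MemLp ψ 2 → MemLp G 2 →
      HasWeakGradient ψ G → Integrable (fun x => max (-V x) 0 * ‖ψ x‖ ^ 2) ∧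
      ∫ x, max (-V x) 0 * ‖ψ x‖ ^ 2 ≤ a * (∫ x, ‖G x‖ ^ 2) + C * ∫ x, ‖ψ x‖ ^ 2 := by
  -- The coefficient of the gradient term is 4S/t, which is now a.
  set S := a * t / 4 with hS
  have hS0 : 0 < S := by positivity
  set D := (∫ x : EuclideanSpace ℝ (Fin d), phi 1 (heat S x)) + ∫ x, Real.exp (-t * V x) with hD
  have hD0 : 0 ≤ D := add_nonneg (integral_nonneg fun x => phi_nonneg one_pos (heat_pos hS0 x).le)
    (integral_nonneg fun x => (Real.exp_pos _).le)
  refine ⟨t⁻¹ * D, by positivity, fun ψ G hψ hG h => ?_⟩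
  set N := ∫ x, ‖ψ x‖ ^ 2 with hN
  have hN0 : 0 ≤ N := integral_nonneg fun x => sq_nonneg _
  rcases hN0.eq_or_lt with hz | hp
  · have hae : (fun x => ‖ψ x‖ ^ 2) =ᵐ[volume] 0 :=
      (integral_eq_zero_iff_of_nonneg (fun x => sq_nonneg _) (integrable_norm_sq hψ)).1 hz.symm
    have hae2 : (fun x => max (-V x) 0 * ‖ψ x‖ ^ 2) =ᵐ[volume] 0 := by
      filter_upwards [hae] with x hx
      simp only [Pi.zero_apply] at hx ⊢
      rw [hx, mul_zero]
    refine ⟨(integrable_zero _ _ _).congr hae2.symm, ?_⟩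
    rw [integral_congr_ae hae2, ← hz]
    simp only [Pi.zero_apply, integral_zero, mul_zero, add_zero]
    exact mul_nonneg ha.le (integral_nonneg fun x => sq_nonneg _)
  · obtain ⟨b1, b2, b3, b4, b5, b6⟩ := normalize hψ hG h hp hN.symm
    obtain ⟨c1, c2⟩ := negPart_bound_normalized ht hV b1 b2 b3 b6 hS0
    have e : ∀ x, max (-V x) 0 * ‖((Real.sqrt N)⁻¹ : ℂ) * ψ x‖ ^ 2
        = N⁻¹ * (max (-V x) 0 * ‖ψ x‖ ^ 2) := fun x => by rw [b4]; ring
    simp_rw [e, b5] at c1 c2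
    rw [integral_const_mul, integral_const_mul, ← hD] at c2
    refine ⟨(c1.const_mul N).congr (.of_forall fun x => by field_simp), ?_⟩
    have c3 := mul_le_mul_of_nonneg_left c2 (by positivity : 0 ≤ t⁻¹ * N)
    have e2 : t⁻¹ * N * (t * (N⁻¹ * ∫ x, max (-V x) 0 * ‖ψ x‖ ^ 2))
        = ∫ x, max (-V x) 0 * ‖ψ x‖ ^ 2 := by field_simp
    have e3 : t⁻¹ * N * (4 * S * (N⁻¹ * ∫ x, ‖G x‖ ^ 2) + D)
        = a * (∫ x, ‖G x‖ ^ 2) + t⁻¹ * D * N := by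
      rw [hS]; field_simp
    rwa [e2, e3] at c3

/-- The lower bound for the quadratic form, with its case of equality. -/
lemma form_lower_bound (ht : 0 < t) (hV : Integrable fun x => Real.exp (-t * V x))
    (hψ : MemLp ψ 2) (hG : MemLp G 2) (h : HasWeakGradient ψ G) (h1 : ∫ x, ‖ψ x‖ ^ 2 = 1)
    (hVp : Integrable fun x => max (V x) 0 * ‖ψ x‖ ^ 2) :
    -t⁻¹ * Real.log (∫ x, Real.exp (-t * V x)) + d * t⁻¹ * (1 + 1 / 2 * Real.log (Real.pi * t))
      ≤ (∫ x, ‖G x‖ ^ 2) + ∫ x, V x * ‖ψ x‖ ^ 2 ∧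
    ((∫ x, ‖G x‖ ^ 2) + ∫ x, V x * ‖ψ x‖ ^ 2 ≤
      -t⁻¹ * Real.log (∫ x, Real.exp (-t * V x)) + d * t⁻¹ * (1 + 1 / 2 * Real.log (Real.pi * t)) →
      ∃ (b : EuclideanSpace ℝ (Fin d)) (c : ℝ),
          ∀ᵐ x ∂volume, V x = (t ^ 2)⁻¹ * ‖x - b‖ ^ 2 + c) := by
  set u : EuclideanSpace ℝ (Fin d) → ℝ := fun x => ‖ψ x‖ ^ 2 with hu
  set Z := ∫ x, Real.exp (-t * V x) with hZ
  have hZ0 : 0 < Z := integral_exp_pos hV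
  have hs : HasScore u (score ψ G) := hasScore_norm_sq hψ hG h h1
  have hf : fisher u (score ψ G) ≤ 4 * ∫ x, ‖G x‖ ^ 2 := fisher_norm_sq_le hψ hG h h1
  have hVm := (negPart_bound_normalized ht hV hψ hG h h1 one_pos).1
  have hVu : Integrable fun x => V x * u x := (hVp.sub hVm).congr (.of_forall fun x => by
    simp only [Pi.sub_apply, ← sub_mul]
    rcases le_total 0 (V x) with hv | hv
    · rw [max_eq_left hv, max_eq_right (by linarith)]; simp [hu]
    · rw [max_eq_right hv, max_eq_left (by linarith)]; simp [hu])
  have hphi := fun ε (hε : 0 < ε) => (hs.entropy_one_le hε one_pos).1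
  have hent : Integrable fun x => u x * Real.log (u x) := by
    refine (((hphi 1 one_pos).add (hVp.const_mul t)).add hV).mono' ?_ (.of_forall fun x => ?_)
    · have := hs.integrable.1.aemeasurable
      exact (this.mul this.log).aestronglyMeasurable
    · have a1 := neg_entropy_le ht (V x) (hs.nonneg x)
      have a2 := entropy_le_phi one_pos (hs.nonneg x)
      have a3 := phi_nonneg one_pos (hs.nonneg x)
      have a4 : 0 ≤ t * (max (V x) 0 * u x) :=
        mul_nonneg ht.le (mul_nonneg (le_max_right _ _) (hs.nonneg x))
      have a5 := (Real.exp_pos (-t * V x)).le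
      rw [Real.log_one, zero_mul, add_zero] at a2
      rw [Real.norm_eq_abs, abs_le]
      simp only [Pi.add_apply]
      constructor <;> linarith
  set c := ∫ x, u x * Real.log (u x) with hc
  have hcle : ∀ ε, 0 < ε → ε ≤ 1 → c ≤ (∫ x, phi ε (u x)) + Real.log ε := fun ε hε _ => by
    have : Real.log ε = ∫ x, Real.log ε * u x := by
      rw [integral_const_mul, hs.integral_eq_one, mul_one]
    rw [this, ← integral_add (hphi ε hε) (hs.integrable.const_mul _)]
    exact integral_mono hent ((hphi ε hε).add (hs.integrable.const_mul _)) fun x =>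
      entropy_le_phi hε (hs.nonneg x)
  -- Since the Fisher information is at most 4∫|∇ψ|², the parameter t/4 produces t∫|∇ψ|².
  have hlsi := hs.logSobolev (τ := t / 4) (by positivity) hcle
  -- `g` is the gap in Young's inequality against the logarithm of the Gibbs density e^{-tV}/Z; its
  -- integral is the relative entropy.
  let g : EuclideanSpace ℝ (Fin d) → ℝ := fun x =>
    u x * Real.log (u x) - u x + Real.exp (-t * V x - Real.log Z) - u x * (-t * V x - Real.log Z)
  have hg0 : ∀ x, 0 ≤ g x := fun x =>
    sub_nonneg.2 (mul_le_entropy_add_exp (hs.nonneg x) _)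
  have hge : g = fun x => (u x * Real.log (u x) - u x + Z⁻¹ * Real.exp (-t * V x))
      + (t * (V x * u x) + Real.log Z * u x) := by
    ext x
    simp only [g]
    rw [Real.exp_sub, Real.exp_log hZ0]
    ring
  have i1 := (hent.sub hs.integrable).add (hV.const_mul Z⁻¹)
  have i2 := (hVu.const_mul t).add (hs.integrable.const_mul (Real.log Z))
  have hgi : Integrable g := by rw [hge]; exact i1.add i2
  have hgv : ∫ x, g x = c + t * (∫ x, V x * u x) + Real.log Z := by
    rw [hge]
    refine (integral_add' i1 i2).trans ?_
    rw [integral_add' (hent.sub hs.integrable) (hV.const_mul Z⁻¹),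
      integral_sub' hent hs.integrable, integral_add' (hVu.const_mul t) (hs.integrable.const_mul _),
      integral_const_mul, integral_const_mul, integral_const_mul, hs.integral_eq_one, ← hZ,
      inv_mul_cancel₀ hZ0.ne']
    ring
  have hgn : 0 ≤ ∫ x, g x := integral_nonneg hg0
  have e4 : 4 * Real.pi * (t / 4) = Real.pi * t := by ring
  rw [e4] at hlsi
  set A := ∫ x, ‖G x‖ ^ 2
  set B := ∫ x, V x * u x
  have hft : t / 4 * fisher u (score ψ G) ≤ t * A := by nlinarith
  have ebd : -t⁻¹ * Real.log Z + d * t⁻¹ * (1 + 1 / 2 * Real.log (Real.pi * t))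
      = t⁻¹ * (-Real.log Z + d + d / 2 * Real.log (Real.pi * t)) := by ring
  have etq : A + B = t⁻¹ * (t * A + t * B) := by field_simp
  rw [ebd, etq]
  refine ⟨?_, fun hle => ?_⟩
  · refine mul_le_mul_of_nonneg_left ?_ (inv_pos.2 ht).le
    linarith
  -- Both inequalities must now be equalities. Zero relative entropy makes u the Gibbs density and
  -- equality in log-Sobolev makes it Gaussian; comparing logarithms gives V.
  · have hle' := le_of_mul_le_mul_left hle (inv_pos.2 ht)
    have hgz : ∫ x, g x = 0 := by linarith
    have hue : ∀ᵐ x, u x = Real.exp (-t * V x - Real.log Z) := by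
      filter_upwards [(integral_eq_zero_iff_of_nonneg hg0 hgi).1 hgz] with x hx
      exact eq_exp_of_entropy_eq (hs.nonneg x) hx
    have hsc := hs.score_eq_of_logSobolev_eq (τ := t / 4) (by positivity) hcle (by
      rw [e4]; linarith)
    choose b hb using hsc
    obtain ⟨C, hC⟩ := hs.eq_gaussian (τ := t / 4) (by positivity) (b := WithLp.toLp 2 b) hb
    refine ⟨WithLp.toLp 2 b, -t⁻¹ * (Real.log Z + Real.log C), ?_⟩
    filter_upwards [hue, hC] with x hx hx'
    have hCpos : 0 < C := by
      by_contra hn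
      have : u x ≤ 0 := by
        rw [hx']
        exact mul_nonpos_of_nonpos_of_nonneg (not_lt.1 hn) (Real.exp_pos _).le
      rw [hx] at this
      exact absurd (Real.exp_pos _) (not_lt.2 this)
    have hlog := congrArg Real.log (hx.symm.trans hx')
    rw [Real.log_exp, Real.log_mul hCpos.ne' (Real.exp_pos _).ne', Real.log_exp] at hlog
    field_simp
    field_simp at hlog
    linarith

end potential

end Schrodinger

namespace Schrodinger
open Filter Topology
open scoped ENNReal

/-! ### Abstract minimisation of a Rayleigh quotient -/

section minimization
variable {K H₁ H₂ L : Type*} [NormedAddCommGroup K] [NormedSpace ℂ K]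
  [NormedAddCommGroup H₁] [InnerProductSpace ℂ H₁] [NormedAddCommGroup H₂]
  [InnerProductSpace ℂ H₂] [NormedAddCommGroup L] [InnerProductSpace ℂ L]
  {P : K →L[ℂ] H₁} {B : K →L[ℂ] H₂} {J : K →L[ℂ] L}

/-- The discriminant of the quadratic is β², and it cannot be positive. -/
lemma eq_zero_of_forall_quadratic_nonneg {β γ : ℝ} (h : ∀ s : ℝ, 0 ≤ s * β + s ^ 2 * γ) :
    β = 0 := by
  have h1 := discrim_le_zero (a := γ) (b := β) (c := 0) fun s => by nlinarith [h s]
  unfold discrim at h1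
  nlinarith [sq_nonneg β]

/-- `hcpt` makes the images under J of a minimising sequence converge; coercivity and the
parallelogram law upgrade this to convergence in K, so weak lower semicontinuity is not needed. -/
lemma exists_rayleigh_minimizer [CompleteSpace K] {c C : ℝ} (hc : 0 < c)
    (hcoer : ∀ k, c * ‖k‖ ^ 2 ≤ ‖P k‖ ^ 2 - ‖B k‖ ^ 2 + C * ‖J k‖ ^ 2)
    (hcpt : ∀ u : ℕ → K, (∃ R, ∀ n, ‖u n‖ ≤ R) → (∀ n, ‖J (u n)‖ = 1) →
      ∃ φ : ℕ → ℕ, StrictMono φ ∧ ∃ l, Tendsto (fun n => J (u (φ n))) atTop (𝓝 l))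
    (hne : ∃ k, J k ≠ 0) :
    ∃ (k₀ : K) (E : ℝ), ‖J k₀‖ = 1 ∧ ‖P k₀‖ ^ 2 - ‖B k₀‖ ^ 2 = E ∧
      ∀ k, E * ‖J k‖ ^ 2 ≤ ‖P k‖ ^ 2 - ‖B k‖ ^ 2 := by
  set q : K → ℝ := fun k => ‖P k‖ ^ 2 - ‖B k‖ ^ 2 with hq
  have hqc : Continuous q := by fun_prop
  have hsmul : ∀ (z : ℂ) k, q (z • k) = ‖z‖ ^ 2 * q k := fun z k => by
    simp only [hq, map_smul, norm_smul]; ring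
  set S := q '' {k | ‖J k‖ = 1} with hS
  have hunit : ∀ k, J k ≠ 0 → ‖J ((‖J k‖⁻¹ : ℂ) • k)‖ = 1 := fun k hk => by
    rw [map_smul, norm_smul, norm_inv, Complex.norm_real, norm_norm,
      inv_mul_cancel₀ (norm_ne_zero_iff.2 hk)]
  have hSn : S.Nonempty := by
    obtain ⟨k, hk⟩ := hne
    exact ⟨_, _, hunit k hk, rfl⟩
  have hSb : BddBelow S := by
    refine ⟨-C, ?_⟩
    rintro _ ⟨k, hk, rfl⟩
    have h1 := hcoer k
    rw [Set.mem_ofPred_eq] at hk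
    rw [hk] at h1
    have : 0 ≤ c * ‖k‖ ^ 2 := by positivity
    simp only [hq]
    linarith
  set E := sInf S with hE
  have hmin : ∀ k, E * ‖J k‖ ^ 2 ≤ q k := fun k => by
    by_cases hk : J k = 0
    · have h1 := hcoer k
      have : 0 ≤ c * ‖k‖ ^ 2 := by positivity
      simp only [hk, norm_zero] at h1 ⊢
      simp only [hq]
      linarith
    · have h1 : E ≤ q ((‖J k‖⁻¹ : ℂ) • k) := csInf_le hSb ⟨_, hunit k hk, rfl⟩
      rw [hsmul, norm_inv, Complex.norm_real, norm_norm, inv_pow, ← div_eq_inv_mul,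
        le_div_iff₀ (by have := norm_pos_iff.2 hk; positivity)] at h1
      exact h1
  obtain ⟨w, -, hw, hwS⟩ := exists_seq_tendsto_sInf hSn hSb
  choose u hu huw using hwS
  have hqu : Tendsto (fun n => q (u n)) atTop (𝓝 E) := by simpa only [huw] using hw
  have hbd : ∃ R, ∀ n, ‖u n‖ ≤ R := by
    obtain ⟨M, hM⟩ := hqu.bddAbove_range
    refine ⟨Real.sqrt ((M + C) / c), fun n => Real.le_sqrt_of_sq_le ?_⟩
    have h1 := hcoer (u n)
    have h2 : ‖J (u n)‖ = 1 := hu n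
    have h3 : q (u n) ≤ M := hM ⟨n, rfl⟩
    rw [h2] at h1
    rw [le_div_iff₀ hc]
    simp only [hq] at h3
    linarith
  obtain ⟨φ, hφ, l, hl⟩ := hcpt u hbd hu
  set v : ℕ → K := fun n => u (φ n) with hv
  have hqv : Tendsto (fun n => q (v n)) atTop (𝓝 E) := hqu.comp hφ.tendsto_atTop
  -- The difference is bounded by coercivity, and the form at the sum is at least E times ‖J(vₘ +
  -- vₙ)‖² = 4 - ‖J(vₘ - vₙ)‖².
  have hkey : ∀ m n, ‖v m - v n‖ ^ 2 ≤
      (2 * (q (v m) - E) + 2 * (q (v n) - E) + (E + C) * ‖J (v m) - J (v n)‖ ^ 2) / c := by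
    intro m n
    rw [le_div_iff₀ hc]
    have h1 := hcoer (v m - v n)
    have h2 := hmin (v m + v n)
    have hJm : ‖J (v m)‖ = 1 := hu _
    have hJn : ‖J (v n)‖ = 1 := hu _
    simp only [hq, map_sub, map_add] at h1 h2 ⊢
    have p1 := parallelogram_law_with_norm ℂ (P (v m)) (P (v n))
    have p2 := parallelogram_law_with_norm ℂ (B (v m)) (B (v n))
    have p3 := parallelogram_law_with_norm ℂ (J (v m)) (J (v n))
    rw [hJm, hJn] at p3
    have p4 : ‖J (v m) + J (v n)‖ ^ 2 = 4 - ‖J (v m) - J (v n)‖ ^ 2 := by linarith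
    rw [p4] at h2
    linarith
  have hcau : CauchySeq v := by
    rw [cauchySeq_iff_tendsto_dist_atTop_0]
    have t1 : Tendsto (fun n : ℕ × ℕ => (2 * (q (v n.1) - E) + 2 * (q (v n.2) - E)
        + (E + C) * ‖J (v n.1) - J (v n.2)‖ ^ 2) / c) atTop (𝓝 0) := by
      rw [← prod_atTop_atTop_eq]
      have a1 := hqv.comp (tendsto_fst (f := atTop) (g := (atTop : Filter ℕ)))
      have a2 := hqv.comp (tendsto_snd (f := (atTop : Filter ℕ)) (g := atTop))
      have a3 := hl.comp (tendsto_fst (f := atTop) (g := (atTop : Filter ℕ)))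
      have a4 := hl.comp (tendsto_snd (f := (atTop : Filter ℕ)) (g := atTop))
      have := ((((a1.sub_const E).const_mul 2).add ((a2.sub_const E).const_mul 2)).add
        (((a3.sub a4).norm.pow 2).const_mul (E + C))).div_const c
      simpa using this
    have t2 : Tendsto (fun n : ℕ × ℕ => ‖v n.1 - v n.2‖ ^ 2) atTop (𝓝 0) :=
      squeeze_zero (fun _ => sq_nonneg _) (fun n => hkey n.1 n.2) t1
    have t3 := t2.sqrt
    simpa [dist_eq_norm, Real.sqrt_sq] using t3
  obtain ⟨k₀, hk₀⟩ := cauchySeq_tendsto_of_complete hcau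
  refine ⟨k₀, E, ?_, ?_, hmin⟩
  · have h1 := ((J.continuous.tendsto k₀).comp hk₀).norm
    refine tendsto_nhds_unique h1 (tendsto_const_nhds.congr fun n => ?_)
    exact (hu (φ n)).symm
  · exact tendsto_nhds_unique ((hqc.tendsto k₀).comp hk₀) hqv

/-- Vanishing first variation along k₀ + s l for real s gives the real part of the equation. -/
lemma eulerLagrange {k₀ : K} {E : ℝ} (h1 : ‖J k₀‖ = 1) (h2 : ‖P k₀‖ ^ 2 - ‖B k₀‖ ^ 2 = E)
    (hmin : ∀ k, E * ‖J k‖ ^ 2 ≤ ‖P k‖ ^ 2 - ‖B k‖ ^ 2) (l : K) :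
    inner ℂ (P l) (P k₀) - inner ℂ (B l) (B k₀) = (E : ℂ) * inner ℂ (J l) (J k₀) := by
  set a : K → ℂ := fun l =>
    inner ℂ (P l) (P k₀) - inner ℂ (B l) (B k₀) - (E : ℂ) * inner ℂ (J l) (J k₀) with ha
  have hre : ∀ l, (a l).re = 0 := fun l => by
    suffices 2 * (a l).re = 0 by linarith
    refine eq_zero_of_forall_quadratic_nonneg
      (γ := ‖P l‖ ^ 2 - ‖B l‖ ^ 2 - E * ‖J l‖ ^ 2) fun s => ?_
    have h3 := hmin ((s : ℂ) • l + k₀)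
    simp only [map_add, map_smul] at h3
    rw [norm_add_sq (𝕜 := ℂ), norm_add_sq (𝕜 := ℂ), norm_add_sq (𝕜 := ℂ)] at h3
    simp only [norm_smul, inner_smul_left, Complex.conj_ofReal, RCLike.re_eq_complex_re,
      Complex.re_ofReal_mul, Complex.norm_real, mul_pow, Real.norm_eq_abs, sq_abs, h1] at h3
    simp only [ha, Complex.sub_re, Complex.re_ofReal_mul]
    linarith
  -- Replacing l by i l turns the imaginary part into a real part.
  have him : (a l).im = 0 := by
    have h3 := hre (Complex.I • l)
    have h4 : a (Complex.I • l) = -Complex.I * a l := by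
      simp only [ha, map_smul, inner_smul_left, Complex.conj_I]
      ring
    rw [h4] at h3
    simpa using h3
  have h0 : a l = 0 := Complex.ext (hre l) him
  exact sub_eq_zero.1 h0

end minimization

end Schrodinger

namespace Schrodinger
open Filter Topology
open scoped ENNReal

variable {d : ℕ} {ψ : EuclideanSpace ℝ (Fin d) → ℂ}
  {G : EuclideanSpace ℝ (Fin d) → EuclideanSpace ℂ (Fin d)}

/-! ### Compactness -/

lemma HasWeakGradient.hasWeakDeriv (hψ : MemLp ψ 2) (hG : MemLp G 2) (h : HasWeakGradient ψ G)
    (v : EuclideanSpace ℝ (Fin d)) : HasWeakDeriv v ψ (∑ i, v i • fun x => G x i) := by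
  have hl : ∀ i, LocallyIntegrable fun x => G x i := fun i =>
    (memLp_coord hG i).locallyIntegrable (by norm_num)
  have e : v = ∑ i, v i • EuclideanSpace.single i (1 : ℝ) := by
    ext j
    simp [Finset.sum_apply, Pi.single_apply]
  have := HasWeakDeriv.sum_dir Finset.univ (v := fun i => v i • EuclideanSpace.single i (1 : ℝ))
    (g := fun i => v i • fun x => G x i) (hψ.locallyIntegrable (by norm_num))
    (fun i _ => (hl i).smul (v i)) (fun i _ => (hasWeakGradient_iff.1 h i).smul_dir (v i))
  rwa [← e] at this

lemma norm_sum_smul_coord_le (v : EuclideanSpace ℝ (Fin d)) (w : EuclideanSpace ℂ (Fin d)) :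
    ‖∑ i, v i • w i‖ ≤ ‖v‖ * ‖w‖ := by
  have h1 : ‖∑ i, v i • w i‖ ≤ ∑ i, ‖v i‖ * ‖w i‖ :=
    (norm_sum_le _ _).trans (Finset.sum_le_sum fun i _ => (norm_smul_le _ _))
  refine h1.trans ?_
  have h2 := Real.sum_mul_le_sqrt_mul_sqrt Finset.univ (fun i => ‖v i‖) (fun i => ‖w i‖)
  rwa [← EuclideanSpace.norm_eq, ← EuclideanSpace.norm_eq] at h2

lemma eLpNorm_translate_sub_le (hψ : MemLp ψ 2) (hG : MemLp G 2) (h : HasWeakGradient ψ G)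
    (v : EuclideanSpace ℝ (Fin d)) :
    ∫⁻ x, ‖ψ (x + v) - ψ x‖ₑ ^ (2 : ℝ) ≤ ‖v‖ₑ ^ (2 : ℝ) * ∫⁻ x, ‖G x‖ₑ ^ (2 : ℝ) := by
  have hl : LocallyIntegrable (∑ i, v i • fun x => G x i) :=
    locallyIntegrable_finsetSum fun i _ =>
      ((memLp_coord hG i).locallyIntegrable (by norm_num)).smul (v i)
  refine ((h.hasWeakDeriv hψ hG v).lintegral_translate_le
    (hψ.locallyIntegrable (by norm_num)) hl (q := 2) (by norm_num)).trans ?_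
  rw [← lintegral_const_mul' _ _ (by simp)]
  refine lintegral_mono fun x => ?_
  rw [← ENNReal.mul_rpow_of_nonneg _ _ (by norm_num)]
  gcongr
  rw [← enorm_norm (v : EuclideanSpace ℝ (Fin d)), ← enorm_norm (G x), ← enorm_mul]
  rw [enorm_le_iff_norm_le, norm_mul, norm_norm, norm_norm]
  simpa [Finset.sum_apply] using norm_sum_smul_coord_le v (G x)

/-- Unlike convergence for a fixed function, this rate depends on ψ only through the norm of its
gradient, so it is uniform on bounded sets. -/
lemma eLpNorm_cv_moll_sub_le (hψ : MemLp ψ 2) (hG : MemLp G 2) (h : HasWeakGradient ψ G) (n : ℕ) :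
    eLpNorm (cv (moll d n) ψ - ψ) 2 volume
      ≤ ENNReal.ofReal (1 / ((n : ℝ) + 1)) * eLpNorm G 2 volume := by
  have h1 : ∫⁻ x, ‖cv (moll d n) ψ x - ψ x‖ₑ ^ (2 : ℝ) ≤
      ENNReal.ofReal (1 / ((n : ℝ) + 1)) ^ (2 : ℝ) * ∫⁻ x, ‖G x‖ₑ ^ (2 : ℝ) := by
    refine (lintegral_cv_sub_rpow_le (moll_isProbKernel d n) hψ.1 (by norm_num)).trans
      (lintegral_moll_mul_le fun y hy => ?_)
    have h2 := eLpNorm_translate_sub_le hψ hG h (-y)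
    simp only [← sub_eq_add_neg] at h2
    refine h2.trans ?_
    gcongr
    rw [enorm_neg, ← ofReal_norm]
    exact ENNReal.ofReal_le_ofReal hy.le
  rw [eLpNorm_eq_lintegral_rpow_enorm_toReal (by norm_num) (by norm_num),
    eLpNorm_eq_lintegral_rpow_enorm_toReal (by norm_num) (by norm_num)]
  simp only [ENNReal.toReal_ofNat, Pi.sub_apply]
  calc _ ≤ (ENNReal.ofReal (1 / ((n : ℝ) + 1)) ^ (2 : ℝ) * ∫⁻ x, ‖G x‖ₑ ^ (2 : ℝ)) ^ (1 / (2:ℝ)) := by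
        gcongr
    _ = _ := by
        rw [ENNReal.mul_rpow_of_nonneg _ _ (by norm_num), ← ENNReal.rpow_mul]
        norm_num

lemma exists_setIntegral_compl_ball_le {g : EuclideanSpace ℝ (Fin d) → ℝ} (hg : Integrable g)
    {ε : ℝ} (hε : 0 < ε) :
    ∃ N : ℕ, ∀ n ≥ N, ∫ x in (Metric.ball 0 (n : ℝ))ᶜ, g x ≤ ε := by
  have h1 := tendsto_setIntegral_of_antitone (μ := volume) (f := g)
    (s := fun n : ℕ => (Metric.ball (0 : EuclideanSpace ℝ (Fin d)) (n : ℝ))ᶜ)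
    (fun n => Metric.isOpen_ball.measurableSet.compl)
    (fun m n hmn => Set.compl_subset_compl.2 (Metric.ball_subset_ball (by exact_mod_cast hmn)))
    ⟨0, hg.integrableOn⟩
  have h2 : (⋂ n : ℕ, (Metric.ball (0 : EuclideanSpace ℝ (Fin d)) (n : ℝ))ᶜ) = ∅ := by
    rw [← Set.compl_iUnion, Metric.iUnion_ball_nat, Set.compl_univ]
  rw [h2, setIntegral_empty] at h1
  exact eventually_atTop.1 (h1.eventually_le_const hε)

/-- Young's inequality with b = k - tV bounds k|ψ|² by tV₊|ψ|², the regularised entropy and e^k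
e^{-tV}. The first two have integrals bounded by the energy; the last is small far out. Dividing by
a large k controls the tail without pointwise growth of V. -/
lemma exists_tail_le {V : EuclideanSpace ℝ (Fin d) → ℝ} {t : ℝ} (ht : 0 < t)
    (hV : Integrable fun x => Real.exp (-t * V x)) {M : ℝ} (hM : 0 ≤ M) {ε : ℝ} (hε : 0 < ε) :
    ∃ N : ℕ, ∀ n ≥ N, ∀ (ψ : EuclideanSpace ℝ (Fin d) → ℂ)
      (G : EuclideanSpace ℝ (Fin d) → EuclideanSpace ℂ (Fin d)), MemLp ψ 2 → MemLp G 2 →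
      HasWeakGradient ψ G → ∫ x, ‖ψ x‖ ^ 2 = 1 → ∫ x, ‖G x‖ ^ 2 ≤ M →
      Integrable (fun x => max (V x) 0 * ‖ψ x‖ ^ 2) →
      ∫ x, max (V x) 0 * ‖ψ x‖ ^ 2 ≤ M →
      ∫ x in (Metric.ball 0 (n : ℝ))ᶜ, ‖ψ x‖ ^ 2 ≤ ε := by
  set D := ∫ x : EuclideanSpace ℝ (Fin d), phi 1 (heat 1 x) with hD
  have hD0 : 0 ≤ D := integral_nonneg fun x => phi_nonneg one_pos (heat_pos one_pos x).le
  -- The numerator adds the potential bound, the entropy bound at flow time 1, and 1 for the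
  -- exponential tail.
  set k := (t * M + (D + 4 * M) + 1) / ε with hk
  have hk0 : 0 < k := by positivity
  obtain ⟨N, hN⟩ := exists_setIntegral_compl_ball_le hV (Real.exp_pos (-k))
  refine ⟨N, fun n hn ψ G hψ hG h h1 hGM hVi hVM => ?_⟩
  have hs := hasScore_norm_sq hψ hG h h1
  obtain ⟨hi, hle⟩ := hs.entropy_one_le one_pos one_pos
  have hf := fisher_norm_sq_le hψ hG h h1
  have hpt : ∀ x, k * ‖ψ x‖ ^ 2 ≤ (t * (max (V x) 0 * ‖ψ x‖ ^ 2) + phi 1 (‖ψ x‖ ^ 2))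
      + Real.exp k * Real.exp (-t * V x) := fun x => by
    have a1 := mul_le_entropy_add_exp (sq_nonneg ‖ψ x‖) (k - t * V x)
    have a2 := entropy_le_phi one_pos (sq_nonneg ‖ψ x‖)
    rw [Real.log_one, zero_mul, add_zero] at a2
    have a3 : Real.exp k * Real.exp (-t * V x) = Real.exp (k - t * V x) := by
      rw [← Real.exp_add]; ring_nf
    have a4 := mul_le_mul_of_nonneg_left
      (mul_le_mul_of_nonneg_right (le_max_left (V x) 0) (sq_nonneg ‖ψ x‖)) ht.le
    have a5 := sq_nonneg ‖ψ x‖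
    rw [a3]
    linarith
  set T : Set (EuclideanSpace ℝ (Fin d)) := (Metric.ball 0 (n : ℝ))ᶜ
  have i1 := hVi.const_mul t
  have i2 : Integrable fun x => t * (max (V x) 0 * ‖ψ x‖ ^ 2) + phi 1 (‖ψ x‖ ^ 2) := i1.add hi
  have i3 := hV.const_mul (Real.exp k)
  have hint : k * ∫ x in T, ‖ψ x‖ ^ 2 ≤
      (∫ x in T, (t * (max (V x) 0 * ‖ψ x‖ ^ 2) + phi 1 (‖ψ x‖ ^ 2)))
        + Real.exp k * ∫ x in T, Real.exp (-t * V x) := by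
    rw [← integral_const_mul, ← integral_const_mul,
      ← integral_add (i2.integrableOn (s := T)) (i3.integrableOn (s := T))]
    exact integral_mono ((integrable_norm_sq hψ).const_mul k).integrableOn
      (i2.add i3).integrableOn hpt
  have hT1 : (∫ x in T, (t * (max (V x) 0 * ‖ψ x‖ ^ 2) + phi 1 (‖ψ x‖ ^ 2))) ≤
      t * M + (D + 4 * M) := by
    refine (setIntegral_le_integral i2 (.of_forall fun x => ?_)).trans ?_
    · have := phi_nonneg one_pos (sq_nonneg ‖ψ x‖)
      exact add_nonneg (mul_nonneg ht.le (mul_nonneg (le_max_right _ _) (sq_nonneg _))) this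
    · refine (integral_add i1 hi).trans_le ?_
      rw [integral_const_mul]
      have := mul_le_mul_of_nonneg_left hVM ht.le
      linarith
  have hT2 : Real.exp k * ∫ x in T, Real.exp (-t * V x) ≤ 1 := by
    have := mul_le_mul_of_nonneg_left (hN n hn) (Real.exp_pos k).le
    rwa [← Real.exp_add, add_neg_cancel, Real.exp_zero] at this
  have hfin : k * ∫ x in T, ‖ψ x‖ ^ 2 ≤ k * ε := by
    have : k * ε = t * M + (D + 4 * M) + 1 := by rw [hk]; field_simp
    linarith
  exact le_of_mul_le_mul_left hfin hk0

lemma eLpNorm_restrict_le_of_integral {F : Type*} [NormedAddCommGroup F]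
    {f : EuclideanSpace ℝ (Fin d) → F} (hf : MemLp f 2)
    {T : Set (EuclideanSpace ℝ (Fin d))} {ε : ℝ} (hε : 0 ≤ ε) (h : ∫ x in T, ‖f x‖ ^ 2 ≤ ε ^ 2) :
    eLpNorm f 2 (volume.restrict T) ≤ ENNReal.ofReal ε := by
  rw [(hf.restrict T).eLpNorm_eq_integral_rpow_norm (by norm_num) (by norm_num)]
  refine ENNReal.ofReal_le_ofReal ?_
  simp only [ENNReal.toReal_ofNat, Real.rpow_two]
  rw [← one_div, ← Real.sqrt_eq_rpow]
  exact Real.sqrt_le_iff.2 ⟨hε, h⟩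

/-- Sequential Banach-Alaoglu in a separable space, carried over by the Riesz isomorphism. -/
lemma exists_weakly_convergent_subseq {H : Type*} [NormedAddCommGroup H] [InnerProductSpace ℂ H]
    [CompleteSpace H] [SecondCountableTopology H] {f : ℕ → H} {R : ℝ} (hf : ∀ n, ‖f n‖ ≤ R) :
    ∃ (g : H) (φ : ℕ → ℕ), StrictMono φ ∧
      ∀ h, Tendsto (fun n => inner ℂ h (f (φ n))) atTop (𝓝 (inner ℂ h g)) := by
  have hc := WeakDual.isSeqCompact_closedBall ℂ H 0 R
  obtain ⟨a, -, φ, hφ, hlim⟩ := hc (x := fun n =>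
    StrongDual.toWeakDual (InnerProductSpace.toDual ℂ H (f n))) (fun n => by
      simpa [Metric.mem_closedBall, dist_zero_right] using hf n)
  refine ⟨(InnerProductSpace.toDual ℂ H).symm (WeakDual.toStrongDual a), φ, hφ, fun h => ?_⟩
  have h1 := ((WeakBilin.eval_continuous (topDualPairing ℂ H) h).tendsto a).comp hlim
  have h2 := (Complex.continuous_conj.tendsto _).comp h1
  have e : ∀ y : H, starRingEnd ℂ (inner ℂ y h) = inner ℂ h y := fun y => inner_conj_symm _ _
  rw [← e, InnerProductSpace.toDual_symm_apply]
  refine h2.congr fun n => ?_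
  rw [← e]
  rfl

/-- The mollification at x is an inner product with a fixed L² function, so weak convergence becomes
pointwise convergence. The values are uniformly bounded and T has finite measure, so dominated
convergence applies. -/
lemma tendsto_eLpNorm_cv_moll_of_weak {f : ℕ → Lp ℂ 2 (volume : Measure (EuclideanSpace ℝ (Fin d)))}
    {g : Lp ℂ 2 (volume : Measure (EuclideanSpace ℝ (Fin d)))} {R : ℝ} (hf : ∀ k, ‖f k‖ ≤ R)
    (hw : ∀ h, Tendsto (fun k => inner ℂ h (f k)) atTop (𝓝 (inner ℂ h g))) (n : ℕ)
    {T : Set (EuclideanSpace ℝ (Fin d))} (hT : volume T ≠ ⊤) :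
    Tendsto (fun k => eLpNorm (cv (moll d n) (f k) - cv (moll d n) g) 2 (volume.restrict T)) atTop
      (𝓝 0) := by
  set κ : EuclideanSpace ℝ (Fin d) → ℂ := fun y => (moll d n y : ℂ) with hκ
  have hκm : MemLp κ 2 := (Complex.continuous_ofReal.comp
    (moll_contDiff d n).continuous).memLp_of_hasCompactSupport
    ((moll_hasCompactSupport d n).comp_left (g := Complex.ofReal) rfl)
  have hκx : ∀ x, MemLp (fun y => κ (x - y)) 2 := fun x =>
    hκm.comp_measurePreserving (Measure.measurePreserving_sub_left volume x)
  have hcv : ∀ (x) (u : Lp ℂ 2 (volume : Measure (EuclideanSpace ℝ (Fin d)))),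
      cv (moll d n) u x = inner ℂ (hκx x).toLp u := fun x u => by
    rw [L2.inner_def]
    refine integral_congr_ae ?_
    filter_upwards [(hκx x).coeFn_toLp] with y hy
    rw [hy, RCLike.inner_apply]
    simp [hκ, mul_comm]
  have hnorm : ∀ x, ‖(hκx x).toLp‖ = ‖hκm.toLp‖ := fun x => by
    rw [Lp.norm_toLp, Lp.norm_toLp,
      ← eLpNorm_comp_measurePreserving hκm.1 (Measure.measurePreserving_sub_left volume x)]
    rfl
  set B := ‖hκm.toLp‖ * (R + ‖g‖)
  have hbd : ∀ k x, ‖cv (moll d n) (f k) x - cv (moll d n) g x‖ ≤ B := fun k x => by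
    rw [hcv, hcv, ← inner_sub_right]
    refine (norm_inner_le_norm _ _).trans ?_
    rw [hnorm]
    exact mul_le_mul_of_nonneg_left ((norm_sub_le _ _).trans (by linarith [hf k])) (norm_nonneg _)
  have hcont : ∀ u : Lp ℂ 2 (volume : Measure (EuclideanSpace ℝ (Fin d))),
      Continuous (cv (moll d n) u) := fun u =>
    (contDiff_cv_moll ((Lp.memLp u).locallyIntegrable (by norm_num)) n).continuous
  have hlim := tendsto_lintegral_of_dominated_convergence (μ := volume.restrict T)
    (F := fun k x => ‖cv (moll d n) (f k) x - cv (moll d n) g x‖ₑ ^ (2 : ℝ))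
    (f := fun _ => 0) (fun _ => ENNReal.ofReal B ^ (2 : ℝ))
    (fun k => (((hcont _).sub (hcont _)).enorm.measurable).pow_const _)
    (fun k => .of_forall fun x => by
      refine ENNReal.rpow_le_rpow ?_ (by norm_num)
      rw [← ofReal_norm]
      exact ENNReal.ofReal_le_ofReal (hbd k x))
    (by simp [ENNReal.mul_eq_top, hT])
    (.of_forall fun x => by
      have h1 : Tendsto (fun k => cv (moll d n) (f k) x - cv (moll d n) g x) atTop (𝓝 0) := by
        simp_rw [hcv]
        simpa using (hw (hκx x).toLp).sub_const (inner ℂ (hκx x).toLp g)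
      have h2 := (ENNReal.continuous_rpow_const (y := 2)).tendsto _ |>.comp h1.enorm
      simpa [Function.comp_def] using h2)
  have hlim2 := (ENNReal.continuous_rpow_const (y := 1 / 2)).tendsto _ |>.comp hlim
  simp only [lintegral_zero] at hlim2
  rw [ENNReal.zero_rpow_of_pos (by norm_num)] at hlim2
  refine hlim2.congr fun k => ?_
  rw [eLpNorm_eq_lintegral_rpow_enorm_toReal (by norm_num) (by norm_num)]
  simp

lemma eLpNorm_le_restrict_add {f : EuclideanSpace ℝ (Fin d) → ℂ} (hf : AEStronglyMeasurable f)
    {T : Set (EuclideanSpace ℝ (Fin d))} (hT : MeasurableSet T) :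
    eLpNorm f 2 volume ≤ eLpNorm f 2 (volume.restrict T) + eLpNorm f 2 (volume.restrict Tᶜ) := by
  rw [← eLpNorm_indicator_eq_eLpNorm_restrict hT, ← eLpNorm_indicator_eq_eLpNorm_restrict hT.compl]
  conv_lhs => rw [← Set.indicator_self_add_compl T f]
  exact eLpNorm_add_le (hf.indicator hT) (hf.indicator hT.compl) (by norm_num)

/-- Two of the five errors are tails outside T; the other three come from passing through the
mollifications on T. -/
lemma eLpNorm_sub_le_of_smooth_approx {f g : EuclideanSpace ℝ (Fin d) → ℂ} (hf : MemLp f 2)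
    (hg : MemLp g 2) (n : ℕ) {T : Set (EuclideanSpace ℝ (Fin d))} (hT : MeasurableSet T)
    {ε : ℝ≥0∞} (b1 : eLpNorm f 2 (volume.restrict Tᶜ) ≤ ε)
    (b2 : eLpNorm g 2 (volume.restrict Tᶜ) ≤ ε)
    (b3 : eLpNorm (cv (moll d n) f - f) 2 volume ≤ ε)
    (b4 : eLpNorm (cv (moll d n) g - g) 2 volume ≤ ε)
    (b5 : eLpNorm (cv (moll d n) f - cv (moll d n) g) 2 (volume.restrict T) ≤ ε) :
    eLpNorm (f - g) 2 volume ≤ ε * 5 := by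
  have m1 := hf.1
  have m2 := hg.1
  have m3 := (memLp_cv_moll hf n).1
  have m4 := (memLp_cv_moll hg n).1
  have c1 : eLpNorm (f - g) 2 (volume.restrict Tᶜ) ≤ ε + ε :=
    (eLpNorm_sub_le m1.restrict m2.restrict (by norm_num)).trans (add_le_add b1 b2)
  have c2 : eLpNorm (f - g) 2 (volume.restrict T) ≤ ε + ε + ε := by
    have e : f - g = (cv (moll d n) f - cv (moll d n) g) - (cv (moll d n) f - f)
        + (cv (moll d n) g - g) := by abel
    rw [e]
    refine (eLpNorm_add_le ((m3.sub m4).sub (m3.sub m1)).restrict (m4.sub m2).restrict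
      (by norm_num)).trans (add_le_add ?_ ?_)
    · refine (eLpNorm_sub_le (m3.sub m4).restrict (m3.sub m1).restrict
        (by norm_num)).trans (add_le_add b5 ?_)
      exact (eLpNorm_mono_measure _ Measure.restrict_le_self).trans b3
    · exact (eLpNorm_mono_measure _ Measure.restrict_le_self).trans b4
  refine (eLpNorm_le_restrict_add (m1.sub m2) hT).trans ((add_le_add c2 c1).trans (le_of_eq ?_))
  ring

/-- Compactness of the form domain in `L²`. -/
lemma exists_convergent_subseq {V : EuclideanSpace ℝ (Fin d) → ℝ} {t : ℝ} (ht : 0 < t)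
    (hV : Integrable fun x => Real.exp (-t * V x)) {M : ℝ}
    {f : ℕ → Lp ℂ 2 (volume : Measure (EuclideanSpace ℝ (Fin d)))}
    {G : ℕ → EuclideanSpace ℝ (Fin d) → EuclideanSpace ℂ (Fin d)} (hG : ∀ n, MemLp (G n) 2)
    (h : ∀ n, HasWeakGradient (f n) (G n)) (h1 : ∀ n, ∫ x, ‖f n x‖ ^ 2 = 1)
    (hGM : ∀ n, ∫ x, ‖G n x‖ ^ 2 ≤ M)
    (hVi : ∀ n, Integrable fun x => max (V x) 0 * ‖f n x‖ ^ 2)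
    (hVM : ∀ n, ∫ x, max (V x) 0 * ‖f n x‖ ^ 2 ≤ M) :
    ∃ φ : ℕ → ℕ, StrictMono φ ∧ ∃ g, Tendsto (fun n => f (φ n)) atTop (𝓝 g) := by
  have hM : 0 ≤ M := (integral_nonneg fun x => sq_nonneg _).trans (hGM 0)
  have hf : ∀ n, ‖f n‖ ≤ 1 := fun n => by
    have := eLpNorm_restrict_le_of_integral (Lp.memLp (f n)) zero_le_one (T := Set.univ)
      (by rw [setIntegral_univ, h1]; norm_num)
    rw [Measure.restrict_univ] at this
    rw [Lp.norm_def]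
    simpa using ENNReal.toReal_mono ENNReal.ofReal_ne_top this
  have hGn : ∀ n, eLpNorm (G n) 2 volume ≤ ENNReal.ofReal (Real.sqrt M) := fun n => by
    have := eLpNorm_restrict_le_of_integral (hG n) (Real.sqrt_nonneg M) (T := Set.univ)
      (by rw [setIntegral_univ, Real.sq_sqrt hM]; exact hGM n)
    rwa [Measure.restrict_univ] at this
  have : Fact ((2 : ℝ≥0∞) ≠ ⊤) := ⟨by norm_num⟩
  obtain ⟨g, φ, hφ, hw⟩ := exists_weakly_convergent_subseq hf
  refine ⟨φ, hφ, g, ?_⟩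
  have key : Tendsto (fun n => eLpNorm ((f (φ n) : EuclideanSpace ℝ (Fin d) → ℂ) -
      (g : EuclideanSpace ℝ (Fin d) → ℂ)) 2 volume) atTop
      (𝓝 0) := by
    rw [ENNReal.tendsto_nhds_zero]
    intro δ hδ
    obtain ⟨ε', hε', hεδ⟩ : ∃ ε : ℝ, 0 < ε ∧ ENNReal.ofReal ε * 5 ≤ δ := by
      rcases eq_or_ne δ ⊤ with rfl | hδt
      · exact ⟨1, one_pos, le_top⟩
      · refine ⟨δ.toReal / 5, div_pos (ENNReal.toReal_pos hδ.ne' hδt) (by norm_num), ?_⟩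
        rw [ENNReal.ofReal_div_of_pos (by norm_num), ENNReal.ofReal_toReal hδt]
        simpa using (ENNReal.div_mul_cancel (a := 5) (b := δ) (by norm_num) (by norm_num)).le
    set ε := ENNReal.ofReal ε' with hε
    -- Order of choices: the ball T for all tails, then the mollification index n uniformly in the
    -- sequence, and only then the index k.
    obtain ⟨N₁, hN₁⟩ := exists_tail_le ht hV hM (pow_pos hε' 2)
    obtain ⟨N₂, hN₂⟩ := exists_setIntegral_compl_ball_le (integrable_norm_sq (Lp.memLp g))
      (pow_pos hε' 2)
    set T : Set (EuclideanSpace ℝ (Fin d)) := Metric.ball 0 ((max N₁ N₂ : ℕ) : ℝ)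
    have hT : MeasurableSet T := Metric.isOpen_ball.measurableSet
    have hTv : volume T ≠ ⊤ := measure_ball_lt_top.ne
    have b1 : ∀ k, eLpNorm (f k) 2 (volume.restrict Tᶜ) ≤ ε := fun k =>
      eLpNorm_restrict_le_of_integral (Lp.memLp _) hε'.le
        (hN₁ _ (le_max_left _ _) _ _ (Lp.memLp _) (hG k) (h k) (h1 k) (hGM k) (hVi k) (hVM k))
    have b2 : eLpNorm g 2 (volume.restrict Tᶜ) ≤ ε :=
      eLpNorm_restrict_le_of_integral (Lp.memLp _) hε'.le (hN₂ _ (le_max_right _ _))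
    have hεpos : 0 < ε := ENNReal.ofReal_pos.2 hε'
    have l1 : Tendsto (fun n : ℕ => ENNReal.ofReal (1 / ((n : ℝ) + 1)) *
        ENNReal.ofReal (Real.sqrt M)) atTop (𝓝 0) := by
      have := ENNReal.tendsto_ofReal
        ((tendsto_one_div_add_atTop_nhds_zero_nat (𝕜 := ℝ)).mul_const (Real.sqrt M))
      simpa only [zero_mul, ENNReal.ofReal_zero, ENNReal.ofReal_mul' (Real.sqrt_nonneg M)]
        using this
    obtain ⟨n, hn1, hn2⟩ := ((l1.eventually_le_const hεpos).and
      ((tendsto_eLpNorm_cv_moll_sub (Lp.memLp g)).eventually_le_const hεpos)).exists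
    have b3 : ∀ k, eLpNorm (cv (moll d n) (f k) -
        (f k : EuclideanSpace ℝ (Fin d) → ℂ)) 2 volume ≤ ε := fun k =>
      (eLpNorm_cv_moll_sub_le (Lp.memLp _) (hG k) (h k) n).trans
        ((mul_le_mul_right (hGn k) _).trans hn1)
    have l2 := tendsto_eLpNorm_cv_moll_of_weak (f := fun k => f (φ k)) (fun k => hf _) hw n hTv
    filter_upwards [l2.eventually_le_const hεpos] with k hk
    exact (eLpNorm_sub_le_of_smooth_approx (Lp.memLp _) (Lp.memLp _) n hT (b1 _) b2 (b3 _) hn2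
      hk).trans hεδ
  exact (Lp.tendsto_Lp_iff_tendsto_eLpNorm' (fun n => f (φ n)) g).2 key

end Schrodinger

namespace Schrodinger
open Filter Topology
open scoped ENNReal

variable {d : ℕ}

/-! ### The form domain as a Hilbert space -/

lemma norm_sq_eq_integral {F : Type*} [NormedAddCommGroup F] [InnerProductSpace ℂ F]
    (f : Lp F 2 (volume : Measure (EuclideanSpace ℝ (Fin d)))) : ‖f‖ ^ 2 = ∫ x, ‖f x‖ ^ 2 := by
  have h1 := inner_self_eq_norm_sq_to_K (𝕜 := ℂ) f
  rw [L2.inner_def] at h1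
  simp_rw [inner_self_eq_norm_sq_to_K] at h1
  have h2 : ((∫ x, ‖f x‖ ^ 2 : ℝ) : ℂ) = ((‖f‖ ^ 2 : ℝ) : ℂ) := by
    rw [← integral_complex_ofReal]
    simpa using h1
  exact_mod_cast h2.symm

lemma memLp_testFun {η : EuclideanSpace ℝ (Fin d) → ℝ} (hη : Continuous η)
    (hc : HasCompactSupport η) : MemLp (fun x => (η x : ℂ)) 2 :=
  (Complex.continuous_ofReal.comp hη).memLp_of_hasCompactSupport
    (hc.comp_left (g := Complex.ofReal) rfl)

lemma memLp_testVec {η : EuclideanSpace ℝ (Fin d) → ℝ} (hη : Continuous η)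
    (hc : HasCompactSupport η) (i : Fin d) :
    MemLp (fun x => (EuclideanSpace.single i (η x : ℂ) : EuclideanSpace ℂ (Fin d))) 2 := by
  have h := (ContinuousLinearMap.toSpanSingleton ℂ
    (EuclideanSpace.single i (1 : ℂ))).comp_memLp' (memLp_testFun hη hc)
  refine h.ae_eq (.of_forall fun x => ?_)
  ext j
  simp

/-- In terms of inner products with fixed vectors the condition is visibly linear and closed in (f,
G). -/
lemma hasWeakGradient_iff_inner (f : Lp ℂ 2 (volume : Measure (EuclideanSpace ℝ (Fin d))))
    (G : Lp (EuclideanSpace ℂ (Fin d)) 2 (volume : Measure (EuclideanSpace ℝ (Fin d)))) :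
    HasWeakGradient f G ↔ ∀ (η : EuclideanSpace ℝ (Fin d) → ℝ) (hη : ContDiff ℝ ∞ η)
      (hc : HasCompactSupport η) (i : Fin d),
      inner ℂ (memLp_testFun (continuous_fderiv_dir hη (EuclideanSpace.single i 1))
        (hasCompactSupport_fderiv_dir hc (EuclideanSpace.single i 1))).toLp f
        = - inner ℂ (memLp_testVec hη.continuous hc i).toLp G := by
  refine forall_congr' fun η => forall_congr' fun hη => forall_congr' fun hc =>
    forall_congr' fun i => ?_
  rw [L2.inner_def, L2.inner_def]
  have e1 : ∫ x, inner ℂ ((memLp_testFun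
      (continuous_fderiv_dir hη (EuclideanSpace.single i 1))
      (hasCompactSupport_fderiv_dir hc (EuclideanSpace.single i 1))).toLp _ x) (f x)
      = ∫ x, f x * ((fderiv ℝ η x (EuclideanSpace.single i 1) : ℝ) : ℂ) := by
    refine integral_congr_ae ?_
    filter_upwards [(memLp_testFun (continuous_fderiv_dir hη (EuclideanSpace.single i 1))
      (hasCompactSupport_fderiv_dir hc (EuclideanSpace.single i 1))).coeFn_toLp] with x hx
    rw [hx, RCLike.inner_apply, Complex.conj_ofReal]
  have e2 : ∫ x, inner ℂ ((memLp_testVec hη.continuous hc i).toLp _ x) (G x)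
      = ∫ x, G x i * (η x : ℂ) := by
    refine integral_congr_ae ?_
    filter_upwards [(memLp_testVec hη.continuous hc i).coeFn_toLp] with x hx
    rw [hx, EuclideanSpace.inner_single_left, Complex.conj_ofReal, mul_comm]
  rw [e1, e2]

/-- The weight may be unbounded, so continuity of multiplication is unavailable; almost everywhere
convergent subsequences are used instead. -/
lemma isClosed_mul_graph (w : EuclideanSpace ℝ (Fin d) → ℝ) :
    IsClosed {p : Lp ℂ 2 (volume : Measure (EuclideanSpace ℝ (Fin d))) ×
      Lp ℂ 2 (volume : Measure (EuclideanSpace ℝ (Fin d))) |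
      p.2 =ᵐ[volume] fun x => (w x : ℂ) * p.1 x} := by
  refine IsSeqClosed.isClosed fun p q hp hpq => ?_
  have h1 : Tendsto (fun n => (p n).1) atTop (𝓝 q.1) := (continuous_fst.tendsto q).comp hpq
  obtain ⟨φ, hφ, hae1⟩ := (tendstoInMeasure_of_tendsto_Lp h1).exists_seq_tendsto_ae
  have h2 : Tendsto (fun n => (p (φ n)).2) atTop (𝓝 q.2) :=
    ((continuous_snd.tendsto q).comp hpq).comp hφ.tendsto_atTop
  obtain ⟨ξ, hξ, hae2⟩ := (tendstoInMeasure_of_tendsto_Lp h2).exists_seq_tendsto_ae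
  have hall : ∀ᵐ x, ∀ n, (p n).2 x = (w x : ℂ) * (p n).1 x := ae_all_iff.2 hp
  filter_upwards [hae1, hae2, hall] with x a1 a2 a3
  refine tendsto_nhds_unique a2 ?_
  simp_rw [a3]
  exact (a1.comp hξ.tendsto_atTop).const_mul _

/-- The space of quadruples in which the form domain is realised. -/
abbrev FormAmbient (d : ℕ) :=
    Lp ℂ 2 (volume : Measure (EuclideanSpace ℝ (Fin d))) ×
      Lp (EuclideanSpace ℂ (Fin d)) 2 (volume : Measure (EuclideanSpace ℝ (Fin d))) ×
      Lp ℂ 2 (volume : Measure (EuclideanSpace ℝ (Fin d))) ×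
      Lp ℂ 2 (volume : Measure (EuclideanSpace ℝ (Fin d)))

/-- The form domain, as a space of quadruples `(ψ, ∇ψ, √V₊ ψ, √V₋ ψ)` of `L²` functions. -/
def formSpace (V : EuclideanSpace ℝ (Fin d) → ℝ) :
    Submodule ℂ (FormAmbient d) where
  carrier := {k | HasWeakGradient k.1 k.2.1 ∧
    (k.2.2.1 =ᵐ[volume] fun x => (Real.sqrt (max (V x) 0) : ℂ) * k.1 x) ∧
    k.2.2.2 =ᵐ[volume] fun x => (Real.sqrt (max (-V x) 0) : ℂ) * k.1 x}
  zero_mem' := by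
    have h0 : ∀ w : EuclideanSpace ℝ (Fin d) → ℝ,
        (0 : Lp ℂ 2 (volume : Measure (EuclideanSpace ℝ (Fin d)))) =ᵐ[volume]
        fun x => (w x : ℂ) * (0 : Lp ℂ 2 (volume : Measure (EuclideanSpace ℝ (Fin d)))) x :=
      fun w => by
        filter_upwards [Lp.coeFn_zero ℂ 2 (volume : Measure (EuclideanSpace ℝ (Fin d)))] with x hx
        rw [hx, Pi.zero_apply, mul_zero]
    refine ⟨?_, h0 _, h0 _⟩
    rw [hasWeakGradient_iff_inner]
    simp
  add_mem' := by
    rintro k l ⟨h1, h2, h3⟩ ⟨h1', h2', h3'⟩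
    have hadd : ∀ {w : EuclideanSpace ℝ (Fin d) → ℝ}
        {a b a' b' : Lp ℂ 2 (volume : Measure (EuclideanSpace ℝ (Fin d)))},
        (b =ᵐ[volume] fun x => (w x : ℂ) * a x) → (b' =ᵐ[volume] fun x => (w x : ℂ) * a' x) →
        (b + b' : Lp ℂ 2 (volume : Measure (EuclideanSpace ℝ (Fin d)))) =ᵐ[volume]
          fun x => (w x : ℂ) *
            (a + a' : Lp ℂ 2 (volume : Measure (EuclideanSpace ℝ (Fin d)))) x := by
      intro w a b a' b' g1 g2
      filter_upwards [g1, g2, Lp.coeFn_add a a', Lp.coeFn_add b b'] with x e1 e2 e3 e4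
      rw [e3, e4, Pi.add_apply, Pi.add_apply, e1, e2, mul_add]
    refine ⟨?_, hadd h2 h2', hadd h3 h3'⟩
    rw [hasWeakGradient_iff_inner] at h1 h1' ⊢
    intro η hη hc i
    rw [Prod.fst_add, Prod.snd_add, Prod.fst_add, inner_add_right, inner_add_right,
      h1 η hη hc i, h1' η hη hc i, neg_add]
  smul_mem' := by
    rintro c k ⟨h1, h2, h3⟩
    have hsm : ∀ {w : EuclideanSpace ℝ (Fin d) → ℝ}
        {a b : Lp ℂ 2 (volume : Measure (EuclideanSpace ℝ (Fin d)))},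
        (b =ᵐ[volume] fun x => (w x : ℂ) * a x) →
        (c • b : Lp ℂ 2 (volume : Measure (EuclideanSpace ℝ (Fin d)))) =ᵐ[volume]
          fun x => (w x : ℂ) *
            (c • a : Lp ℂ 2 (volume : Measure (EuclideanSpace ℝ (Fin d)))) x := by
      intro w a b g1
      filter_upwards [g1, Lp.coeFn_smul c a, Lp.coeFn_smul c b] with x e1 e3 e4
      rw [e3, e4, Pi.smul_apply, Pi.smul_apply, e1, smul_eq_mul, smul_eq_mul]
      ring
    refine ⟨?_, hsm h2, hsm h3⟩
    rw [hasWeakGradient_iff_inner] at h1 ⊢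
    intro η hη hc i
    rw [Prod.smul_fst, Prod.smul_snd, Prod.smul_fst, inner_smul_right, inner_smul_right,
      h1 η hη hc i, mul_neg]

lemma isClosed_formSpace (V : EuclideanSpace ℝ (Fin d) → ℝ) :
    IsClosed (formSpace V : Set (FormAmbient d)) := by
  have c1 : IsClosed {k : FormAmbient d | HasWeakGradient k.1 k.2.1} := by
    simp_rw [hasWeakGradient_iff_inner, Set.ofPred_forall]
    exact isClosed_iInter fun η => isClosed_iInter fun hη => isClosed_iInter fun hc =>
      isClosed_iInter fun i => isClosed_eq (by fun_prop) (by fun_prop)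
  have c2 : ∀ w : EuclideanSpace ℝ (Fin d) → ℝ, IsClosed {k : FormAmbient d |
      k.2.2.1 =ᵐ[volume] fun x => (w x : ℂ) * k.1 x} := fun w =>
    (isClosed_mul_graph w).preimage (f := fun k : FormAmbient d => (k.1, k.2.2.1)) (by fun_prop)
  have c3 : ∀ w : EuclideanSpace ℝ (Fin d) → ℝ, IsClosed {k : FormAmbient d |
      k.2.2.2 =ᵐ[volume] fun x => (w x : ℂ) * k.1 x} := fun w =>
    (isClosed_mul_graph w).preimage (f := fun k : FormAmbient d => (k.1, k.2.2.2)) (by fun_prop)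
  exact c1.inter ((c2 _).inter (c3 _))

lemma norm_sqrt_mul_sq {r : ℝ} (hr : 0 ≤ r) (z : ℂ) : ‖(Real.sqrt r : ℂ) * z‖ ^ 2 = r * ‖z‖ ^ 2 := by
  rw [norm_mul, Complex.norm_real, Real.norm_of_nonneg (Real.sqrt_nonneg r), mul_pow,
    Real.sq_sqrt hr]

lemma HasWeakGradient.congr {ψ ψ' : EuclideanSpace ℝ (Fin d) → ℂ}
    {G G' : EuclideanSpace ℝ (Fin d) → EuclideanSpace ℂ (Fin d)} (h : HasWeakGradient ψ G)
    (h1 : ψ =ᵐ[volume] ψ') (h2 : G =ᵐ[volume] G') : HasWeakGradient ψ' G' := by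
  intro η hη hc i
  have e1 : ∫ x, ψ' x * ((fderiv ℝ η x (EuclideanSpace.single i 1) : ℝ) : ℂ)
      = ∫ x, ψ x * ((fderiv ℝ η x (EuclideanSpace.single i 1) : ℝ) : ℂ) :=
    integral_congr_ae (by filter_upwards [h1] with x hx; rw [hx])
  have e2 : ∫ x, G' x i * (η x : ℂ) = ∫ x, G x i * (η x : ℂ) :=
    integral_congr_ae (by filter_upwards [h2] with x hx; rw [hx])
  rw [e1, e2, h η hη hc i]

lemma HasWeakGradient.ae_unique {ψ : EuclideanSpace ℝ (Fin d) → ℂ}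
    {G G' : EuclideanSpace ℝ (Fin d) → EuclideanSpace ℂ (Fin d)} (h : HasWeakGradient ψ G)
    (h' : HasWeakGradient ψ G') (hG : MemLp G 2) (hG' : MemLp G' 2) : G =ᵐ[volume] G' := by
  have h1 : ∀ᵐ x, ∀ i, G x i = G' x i := ae_all_iff.2 fun i =>
    (hasWeakGradient_iff.1 h i).ae_unique ((memLp_coord hG i).locallyIntegrable (by norm_num))
      ((memLp_coord hG' i).locallyIntegrable (by norm_num)) (hasWeakGradient_iff.1 h' i)
  filter_upwards [h1] with x hx
  ext i
  exact hx i

lemma weakGradient_spec {ψ : EuclideanSpace ℝ (Fin d) → ℂ} (h : MemH1 ψ) :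
    MemLp (weakGradient ψ) 2 ∧ HasWeakGradient ψ (weakGradient ψ) := by
  have h' := h.2
  rw [weakGradient, dif_pos h']
  exact h'.choose_spec

lemma memLp_sqrt_mul {ψ : EuclideanSpace ℝ (Fin d) → ℂ} {w : EuclideanSpace ℝ (Fin d) → ℝ}
    (hψ : AEStronglyMeasurable ψ) (hwm : AEMeasurable w) (hw : ∀ x, 0 ≤ w x)
    (hi : Integrable fun x => w x * ‖ψ x‖ ^ 2) : MemLp (fun x => (Real.sqrt (w x) : ℂ) * ψ x) 2 := by
  rw [memLp_two_iff_integrable_sq_norm]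
  · simpa only [norm_sqrt_mul_sq (hw _)] using hi
  · exact ((Complex.measurable_ofReal.comp_aemeasurable hwm.sqrt).mul
      hψ.aemeasurable).aestronglyMeasurable

section
variable {V : EuclideanSpace ℝ (Fin d) → ℝ} {t : ℝ}

/-- The domain only controls V₊; that √V₋ ψ lies in L² comes from form boundedness of the negative
part. -/
lemma exists_formSpace_of_mem_formDomain (ht : 0 < t)
    (hV : Integrable fun x => Real.exp (-t * V x)) {ψ : EuclideanSpace ℝ (Fin d) → ℂ}
    (hψ : ψ ∈ formDomain V) :
    ∃ k ∈ formSpace V, k.1 =ᵐ[volume] ψ ∧ k.2.1 =ᵐ[volume] weakGradient ψ := by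
  obtain ⟨hG, hw⟩ := weakGradient_spec hψ.1
  have hm := aemeasurable_potential ht hV
  obtain ⟨C, -, hC⟩ := negPart_bound ht hV one_pos
  have m1 := memLp_sqrt_mul hψ.1.1.1 (hm.max aemeasurable_const) (fun x => le_max_right _ _) hψ.2
  have m2 := memLp_sqrt_mul hψ.1.1.1 (hm.neg.max aemeasurable_const) (fun x => le_max_right _ _)
    (hC ψ _ hψ.1.1 hG hw).1
  have e := hψ.1.1.coeFn_toLp
  refine ⟨(hψ.1.1.toLp, hG.toLp, m1.toLp, m2.toLp), ⟨?_, ?_, ?_⟩, e, hG.coeFn_toLp⟩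
  · exact hw.congr e.symm hG.coeFn_toLp.symm
  · filter_upwards [e, m1.coeFn_toLp] with x h1 h2
    rw [h1, h2]
  · filter_upwards [e, m2.coeFn_toLp] with x h1 h2
    rw [h1, h2]
    rfl

lemma norm_sq_posPart {k} (hk : k ∈ formSpace V) :
    Integrable (fun x => max (V x) 0 * ‖k.1 x‖ ^ 2) ∧
      ‖k.2.2.1‖ ^ 2 = ∫ x, max (V x) 0 * ‖k.1 x‖ ^ 2 := by
  have e : (fun x => ‖k.2.2.1 x‖ ^ 2) =ᵐ[volume] fun x => max (V x) 0 * ‖k.1 x‖ ^ 2 := by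
    filter_upwards [hk.2.1] with x hx
    rw [hx, norm_sqrt_mul_sq (le_max_right _ _)]
  exact ⟨(integrable_norm_sq (Lp.memLp _)).congr e,
    (norm_sq_eq_integral _).trans (integral_congr_ae e)⟩

lemma norm_sq_negPart {k} (hk : k ∈ formSpace V) :
    Integrable (fun x => max (-V x) 0 * ‖k.1 x‖ ^ 2) ∧
      ‖k.2.2.2‖ ^ 2 = ∫ x, max (-V x) 0 * ‖k.1 x‖ ^ 2 := by
  have e : (fun x => ‖k.2.2.2 x‖ ^ 2) =ᵐ[volume] fun x => max (-V x) 0 * ‖k.1 x‖ ^ 2 := by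
    filter_upwards [hk.2.2] with x hx
    rw [hx, norm_sqrt_mul_sq (le_max_right _ _)]
  exact ⟨(integrable_norm_sq (Lp.memLp _)).congr e,
    (norm_sq_eq_integral _).trans (integral_congr_ae e)⟩

lemma posPart_sub_negPart (v : ℝ) : max v 0 - max (-v) 0 = v := by
  rcases le_total 0 v with hv | hv
  · rw [max_eq_left hv, max_eq_right (by linarith), sub_zero]
  · rw [max_eq_right hv, max_eq_left (by linarith)]; ring

lemma integral_potential {k} (hk : k ∈ formSpace V) :
    ∫ x, V x * ‖k.1 x‖ ^ 2 = ‖k.2.2.1‖ ^ 2 - ‖k.2.2.2‖ ^ 2 := by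
  rw [(norm_sq_posPart hk).2, (norm_sq_negPart hk).2,
    ← integral_sub (norm_sq_posPart hk).1 (norm_sq_negPart hk).1]
  refine integral_congr_ae (.of_forall fun x => ?_)
  simp only [← sub_mul, posPart_sub_negPart]

lemma mem_formDomain_of_formSpace {k} (hk : k ∈ formSpace V) :
    (k.1 : EuclideanSpace ℝ (Fin d) → ℂ) ∈ formDomain V ∧ k.2.1 =ᵐ[volume] weakGradient k.1 := by
  have h : MemH1 (k.1 : EuclideanSpace ℝ (Fin d) → ℂ) := ⟨Lp.memLp _, _, Lp.memLp _, hk.1⟩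
  obtain ⟨hG, hw⟩ := weakGradient_spec h
  exact ⟨⟨h, (norm_sq_posPart hk).1⟩, hk.1.ae_unique hw (Lp.memLp _) hG⟩

lemma inner_ae_eq_integral {F : Type*} [NormedAddCommGroup F] [InnerProductSpace ℂ F]
    {f g : Lp F 2 (volume : Measure (EuclideanSpace ℝ (Fin d)))}
    {f' g' : EuclideanSpace ℝ (Fin d) → F} (h1 : f =ᵐ[volume] f') (h2 : g =ᵐ[volume] g') :
    inner ℂ f g = ∫ x, inner ℂ (f' x) (g' x) := by
  rw [L2.inner_def]
  refine integral_congr_ae ?_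
  filter_upwards [h1, h2] with x e1 e2
  rw [e1, e2]

lemma form_eq {k l} (hk : k ∈ formSpace V) (hl : l ∈ formSpace V)
    {φ ψ : EuclideanSpace ℝ (Fin d) → ℂ} (hψ : k.1 =ᵐ[volume] ψ)
    (hψ' : k.2.1 =ᵐ[volume] weakGradient ψ) (hφ : l.1 =ᵐ[volume] φ)
    (hφ' : l.2.1 =ᵐ[volume] weakGradient φ) :
    form V φ ψ = inner ℂ l.2.1 k.2.1 + inner ℂ l.2.2.1 k.2.2.1 - inner ℂ l.2.2.2 k.2.2.2 := by
  rw [form, inner_ae_eq_integral hφ' hψ', add_sub_assoc, L2.inner_def, L2.inner_def,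
    ← integral_sub (L2.integrable_inner _ _) (L2.integrable_inner _ _)]
  congr 1
  refine integral_congr_ae ?_
  filter_upwards [hψ, hφ, hk.2.1, hk.2.2, hl.2.1, hl.2.2] with x e1 e2 e3 e4 e5 e6
  have s1 := Real.mul_self_sqrt (le_max_right (V x) 0)
  have s2 := Real.mul_self_sqrt (le_max_right (-V x) 0)
  have s3 : (V x : ℂ) = (Real.sqrt (max (V x) 0) : ℂ) * Real.sqrt (max (V x) 0)
      - (Real.sqrt (max (-V x) 0) : ℂ) * Real.sqrt (max (-V x) 0) := by
    rw [← Complex.ofReal_mul, ← Complex.ofReal_mul, s1, s2, ← Complex.ofReal_sub,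
      posPart_sub_negPart]
  rw [e3, e4, e5, e6, e1, e2, RCLike.inner_apply, RCLike.inner_apply, s3]
  simp only [map_mul, Complex.conj_ofReal]
  ring

end

end Schrodinger

namespace Schrodinger
open Filter Topology
open scoped ENNReal

variable {d : ℕ} {V : EuclideanSpace ℝ (Fin d) → ℝ} {t : ℝ}

/-! ### The ground state -/

/-- The function `ψ` of a quadruple in the form space. -/
noncomputable def formVal (V : EuclideanSpace ℝ (Fin d) → ℝ) :
    formSpace V →L[ℂ] Lp ℂ 2 (volume : Measure (EuclideanSpace ℝ (Fin d))) :=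
  (ContinuousLinearMap.fst ℂ _ _).comp (formSpace V).subtypeL

/-- The components `(∇ψ, √V₊ ψ)` of a quadruple in the form space. -/
noncomputable def formPos (V : EuclideanSpace ℝ (Fin d) → ℝ) :
    formSpace V →L[ℂ] WithLp 2
      (Lp (EuclideanSpace ℂ (Fin d)) 2 (volume : Measure (EuclideanSpace ℝ (Fin d))) ×
        Lp ℂ 2 (volume : Measure (EuclideanSpace ℝ (Fin d)))) :=
  (WithLp.prodContinuousLinearEquiv 2 ℂ
    (Lp (EuclideanSpace ℂ (Fin d)) 2 (volume : Measure (EuclideanSpace ℝ (Fin d))))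
    (Lp ℂ 2 (volume : Measure (EuclideanSpace ℝ (Fin d))))).symm.toContinuousLinearMap.comp
    ((((ContinuousLinearMap.fst ℂ _ _).comp (ContinuousLinearMap.snd ℂ _ _)).prod
      ((ContinuousLinearMap.fst ℂ _ _).comp
        ((ContinuousLinearMap.snd ℂ _ _).comp (ContinuousLinearMap.snd ℂ _ _)))).comp
      (formSpace V).subtypeL)

/-- The component `√V₋ ψ` of a quadruple in the form space. -/
noncomputable def formNeg (V : EuclideanSpace ℝ (Fin d) → ℝ) :
    formSpace V →L[ℂ] Lp ℂ 2 (volume : Measure (EuclideanSpace ℝ (Fin d))) :=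
  ((ContinuousLinearMap.snd ℂ _ _).comp ((ContinuousLinearMap.snd ℂ _ _).comp
    (ContinuousLinearMap.snd ℂ _ _))).comp (formSpace V).subtypeL

lemma formVal_apply (k : formSpace V) : formVal V k = k.1.1 := rfl

lemma formNeg_apply (k : formSpace V) : formNeg V k = k.1.2.2.2 := rfl

lemma norm_sq_formPos (k : formSpace V) :
    ‖formPos V k‖ ^ 2 = ‖k.1.2.1‖ ^ 2 + ‖k.1.2.2.1‖ ^ 2 :=
  WithLp.prod_norm_sq_eq_of_L2 _

lemma inner_formPos (k l : formSpace V) : inner ℂ (formPos V l) (formPos V k)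
    = inner ℂ l.1.2.1 k.1.2.1 + inner ℂ l.1.2.2.1 k.1.2.2.1 :=
  WithLp.prod_inner_apply _ _

/-- The product carries the supremum norm, so the squared norm is one of the four terms. -/
lemma norm_sq_formAmbient_le (k : FormAmbient d) :
    ‖k‖ ^ 2 ≤ ‖k.1‖ ^ 2 + ‖k.2.1‖ ^ 2 + ‖k.2.2.1‖ ^ 2 + ‖k.2.2.2‖ ^ 2 := by
  have n1 := sq_nonneg ‖k.1‖
  have n2 := sq_nonneg ‖k.2.1‖
  have n3 := sq_nonneg ‖k.2.2.1‖
  have n4 := sq_nonneg ‖k.2.2.2‖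
  rw [Prod.norm_def, Prod.norm_def, Prod.norm_def]
  rcases max_choice ‖k.1‖ (max ‖k.2.1‖ (max ‖k.2.2.1‖ ‖k.2.2.2‖)) with h | h <;> rw [h]
  · linarith
  rcases max_choice ‖k.2.1‖ (max ‖k.2.2.1‖ ‖k.2.2.2‖) with h | h <;> rw [h]
  · linarith
  rcases max_choice ‖k.2.2.1‖ ‖k.2.2.2‖ with h | h <;> rw [h] <;> linarith

/-- Relative bound 1/2 leaves enough of the gradient term to control every component, including √V₋
ψ. -/
lemma exists_coercive (ht : 0 < t) (hV : Integrable fun x => Real.exp (-t * V x)) :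
    ∃ C : ℝ, ∀ k : formSpace V, 1 / 4 * ‖k‖ ^ 2 ≤
      ‖formPos V k‖ ^ 2 - ‖formNeg V k‖ ^ 2 + C * ‖formVal V k‖ ^ 2 := by
  obtain ⟨C, hC0, hC⟩ := negPart_bound ht hV (a := 1 / 2) (by norm_num)
  refine ⟨2 * C + 1, fun k => ?_⟩
  have h2 := (hC k.1.1 k.1.2.1 (Lp.memLp _) (Lp.memLp _) k.2.1).2
  rw [← norm_sq_eq_integral, ← norm_sq_eq_integral, ← (norm_sq_negPart k.2).2] at h2
  have h1 := norm_sq_formAmbient_le k.1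
  rw [norm_sq_formPos, formVal_apply, formNeg_apply, Submodule.coe_norm]
  have n1 := sq_nonneg ‖k.1.1‖
  have n2 := sq_nonneg ‖k.1.2.1‖
  have n3 := sq_nonneg ‖k.1.2.2.1‖
  have n4 : 0 ≤ C * ‖k.1.1‖ ^ 2 := mul_nonneg hC0 n1
  linarith

lemma formVal_compact (ht : 0 < t) (hV : Integrable fun x => Real.exp (-t * V x))
    (u : ℕ → formSpace V) (hR : ∃ R, ∀ n, ‖u n‖ ≤ R) (hu : ∀ n, ‖formVal V (u n)‖ = 1) :
    ∃ φ : ℕ → ℕ, StrictMono φ ∧ ∃ l, Tendsto (fun n => formVal V (u (φ n))) atTop (𝓝 l) := by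
  obtain ⟨R, hR⟩ := hR
  have c2 : ∀ n, ‖(u n).1.2.1‖ ^ 2 ≤ R ^ 2 := fun n => pow_le_pow_left₀ (norm_nonneg _)
    (((norm_fst_le (u n).1.2).trans (norm_snd_le (u n).1)).trans (hR n)) 2
  have c3 : ∀ n, ‖(u n).1.2.2.1‖ ^ 2 ≤ R ^ 2 := fun n => pow_le_pow_left₀ (norm_nonneg _)
    (((norm_fst_le (u n).1.2.2).trans
      ((norm_snd_le (u n).1.2).trans (norm_snd_le (u n).1))).trans (hR n)) 2
  refine exists_convergent_subseq ht hV (M := R ^ 2) (f := fun n => formVal V (u n))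
    (G := fun n => (u n).1.2.1) (fun n => Lp.memLp _) (fun n => (u n).2.1) (fun n => ?_)
    (fun n => ?_) (fun n => (norm_sq_posPart (u n).2).1) (fun n => ?_)
  · rw [← norm_sq_eq_integral, hu, one_pow]
  · rw [← norm_sq_eq_integral]
    exact c2 n
  · exact (norm_sq_posPart (u n).2).2.symm.trans_le (c3 n)

lemma exists_groundState (ht : 0 < t) (hV : Integrable fun x => Real.exp (-t * V x))
    (hdom : ∃ φ ∈ formDomain V, ¬ φ =ᵐ[volume] 0) :
    ∃ k ∈ formSpace V, ∃ E : ℝ, ‖k.1‖ = 1 ∧ ‖k.2.1‖ ^ 2 + ‖k.2.2.1‖ ^ 2 - ‖k.2.2.2‖ ^ 2 = E ∧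
      ∀ l ∈ formSpace V,
        E * ‖l.1‖ ^ 2 ≤ ‖l.2.1‖ ^ 2 + ‖l.2.2.1‖ ^ 2 - ‖l.2.2.2‖ ^ 2 ∧
        inner ℂ l.2.1 k.2.1 + inner ℂ l.2.2.1 k.2.2.1 - inner ℂ l.2.2.2 k.2.2.2
          = (E : ℂ) * inner ℂ l.1 k.1 := by
  have : CompleteSpace (formSpace V) := (isClosed_formSpace V).completeSpace_coe
  obtain ⟨C, hC⟩ := exists_coercive ht hV
  have hne : ∃ k, formVal V k ≠ 0 := by
    obtain ⟨φ, hφ, hφ0⟩ := hdom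
    obtain ⟨k, hk, h1, -⟩ := exists_formSpace_of_mem_formDomain ht hV hφ
    refine ⟨⟨k, hk⟩, fun h0 => hφ0 ?_⟩
    rw [formVal_apply] at h0
    simp only at h0
    rw [h0] at h1
    exact h1.symm.trans (Lp.coeFn_zero _ _ _)
  obtain ⟨k, E, e1, e2, e3⟩ := exists_rayleigh_minimizer (by norm_num) hC
    (formVal_compact ht hV) hne
  have a1 : ∀ l : formSpace V,
      E * ‖l.1.1‖ ^ 2 ≤ ‖l.1.2.1‖ ^ 2 + ‖l.1.2.2.1‖ ^ 2 - ‖l.1.2.2.2‖ ^ 2 := fun l => by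
    rw [← norm_sq_formPos]
    exact e3 l
  have a2 : ∀ l : formSpace V, inner ℂ l.1.2.1 k.1.2.1 + inner ℂ l.1.2.2.1 k.1.2.2.1
      - inner ℂ l.1.2.2.2 k.1.2.2.2 = (E : ℂ) * inner ℂ l.1.1 k.1.1 := fun l => by
    rw [← inner_formPos]
    exact eulerLagrange e1 e2 e3 l
  refine ⟨k.1, k.2, E, e1, ?_, fun l hl => ⟨a1 ⟨l, hl⟩, a2 ⟨l, hl⟩⟩⟩
  rw [← e2, norm_sq_formPos, formNeg_apply]

lemma isLeast_eigenvalues (ht : 0 < t) (hV : Integrable fun x => Real.exp (-t * V x)) {k}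
    (hk : k ∈ formSpace V) {E : ℝ} (h1 : ‖k.1‖ = 1)
    (hmin : ∀ l ∈ formSpace V,
        E * ‖l.1‖ ^ 2 ≤ ‖l.2.1‖ ^ 2 + ‖l.2.2.1‖ ^ 2 - ‖l.2.2.2‖ ^ 2 ∧
        inner ℂ l.2.1 k.2.1 + inner ℂ l.2.2.1 k.2.2.1 - inner ℂ l.2.2.2 k.2.2.2
          = (E : ℂ) * inner ℂ l.1 k.1) : IsLeast (eigenvalues V) E := by
  obtain ⟨hkd, hkg⟩ := mem_formDomain_of_formSpace hk
  refine ⟨⟨k.1, fun h0 => ?_, hkd, (Lp.memLp k.1).const_mul _, fun φ hφ => ?_⟩, ?_⟩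
  · rw [(Lp.eq_zero_iff_ae_eq_zero).2 h0, norm_zero] at h1
    exact zero_ne_one h1
  · obtain ⟨l, hl, l1, l2⟩ := exists_formSpace_of_mem_formDomain ht hV hφ
    rw [form_eq hk hl (Filter.EventuallyEq.refl _ _) hkg l1 l2, (hmin l hl).2,
      inner_ae_eq_integral l1 (Filter.EventuallyEq.refl _ _), ← integral_const_mul]
    refine integral_congr_ae (.of_forall fun x => ?_)
    simp only [RCLike.inner_apply]
    ring
  -- Testing the eigenvalue equation with the eigenfunction itself shows that E' is a Rayleigh
  -- quotient, hence at least the minimum.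
  · rintro E' ⟨ψ, hψ0, hψd, -, himg⟩
    obtain ⟨l, hl, l1, l2⟩ := exists_formSpace_of_mem_formDomain ht hV hψd
    have h2 := himg ψ hψd
    rw [form_eq hl hl l1 l2 l1 l2] at h2
    have h3 : ∫ x, starRingEnd ℂ (ψ x) * ((E' : ℂ) * ψ x) = (E' : ℂ) * inner ℂ l.1 l.1 := by
      rw [inner_ae_eq_integral l1 l1, ← integral_const_mul]
      refine integral_congr_ae (.of_forall fun x => ?_)
      simp only [RCLike.inner_apply]
      ring
    rw [h3] at h2
    simp only [inner_self_eq_norm_sq_to_K] at h2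
    have h4 : ‖l.2.1‖ ^ 2 + ‖l.2.2.1‖ ^ 2 - ‖l.2.2.2‖ ^ 2 = E' * ‖l.1‖ ^ 2 := by
      have h2' : ((‖l.2.1‖ ^ 2 + ‖l.2.2.1‖ ^ 2 - ‖l.2.2.2‖ ^ 2 : ℝ) : ℂ)
          = ((E' * ‖l.1‖ ^ 2 : ℝ) : ℂ) := by
        push_cast
        exact h2
      exact Complex.ofReal_injective h2'
    have h5 : 0 < ‖l.1‖ := norm_pos_iff.2 fun h0 => hψ0 (by
      rw [h0] at l1
      exact l1.symm.trans (Lp.coeFn_zero _ _ _))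
    have h6 := (hmin l hl).1
    rw [h4] at h6
    exact le_of_mul_le_mul_right h6 (by positivity)

/-! ### The harmonic oscillator -/

/-- Squaring a Gaussian halves its time, so the moments of the trial density below reduce to those
of the heat kernel at time t/4. -/
lemma heat_sq (ht : 0 < t) (y : EuclideanSpace ℝ (Fin d)) :
    heat (t / 2) y ^ 2 = ((4 * Real.pi * (t / 2)) ^ (-(d / 2 : ℝ))) ^ 2
      / (4 * Real.pi * (t / 4)) ^ (-(d / 2 : ℝ)) * heat (t / 4) y := by
  have h := (heat_const_pos (d := d) (s := t / 4) (by positivity)).ne'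
  have e : Real.exp (-(1 / (4 * (t / 4))) * ‖y‖ ^ 2)
      = Real.exp (-(1 / (4 * (t / 2))) * ‖y‖ ^ 2) ^ 2 := by
    rw [← Real.exp_nat_mul]
    congr 1
    push_cast
    field_simp
    ring
  unfold heat
  rw [e]
  field_simp

/-- The gradient of the shifted Gaussian. -/
noncomputable def gaussGrad (s : ℝ) (b x : EuclideanSpace ℝ (Fin d)) : EuclideanSpace ℂ (Fin d) :=
  WithLp.toLp 2 fun i => (heatD i s (x - b) : ℂ)

lemma norm_sq_gaussGrad (s : ℝ) (b x : EuclideanSpace ℝ (Fin d)) :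
    ‖gaussGrad s b x‖ ^ 2 = ((2 * s) ^ 2)⁻¹ * (‖x - b‖ ^ 2 * heat s (x - b) ^ 2) := by
  rw [EuclideanSpace.norm_sq_eq, EuclideanSpace.norm_sq_eq, Finset.sum_mul, Finset.mul_sum]
  refine Finset.sum_congr rfl fun i _ => ?_
  simp only [gaussGrad, Complex.norm_real, heatD, Real.norm_eq_abs, sq_abs]
  rw [mul_pow, neg_sq, div_pow]
  ring

lemma hasWeakGradient_gauss {s : ℝ} (hs : 0 < s) (b : EuclideanSpace ℝ (Fin d)) :
    HasWeakGradient (fun x => (heat s (x - b) : ℂ)) (gaussGrad s b) := by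
  intro η hη hc i
  have hcont : Continuous fun x : EuclideanSpace ℝ (Fin d) => heat s (x - b) :=
    (heat_continuous s).comp (by fun_prop)
  have hcont' : Continuous fun x : EuclideanSpace ℝ (Fin d) => heatD i s (x - b) :=
    (heatD_continuous i s).comp (by fun_prop)
  have hηc := continuous_fderiv_dir hη (EuclideanSpace.single i 1)
  have hηs := hasCompactSupport_fderiv_dir hc (EuclideanSpace.single i 1)
  have i1 := integrable_smul_of_hasCompactSupport hη.continuous hc hcont'.locallyIntegrable
  have i2 := integrable_smul_of_hasCompactSupport hηc hηs hcont.locallyIntegrable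
  have i3 := integrable_smul_of_hasCompactSupport hη.continuous hc hcont.locallyIntegrable
  have h := integral_bilinear_hasLineDerivAt_right_eq_neg_left_of_integrable (μ := volume)
    (f := fun x => heat s (x - b)) (f' := fun x => heatD i s (x - b)) (g := η)
    (g' := fun x => fderiv ℝ η x (EuclideanSpace.single i 1)) (v := EuclideanSpace.single i 1)
    (B := ContinuousLinearMap.mul ℝ ℝ)
    (i1.congr (.of_forall fun x => by simp [mul_comm]))
    (i2.congr (.of_forall fun x => by simp [mul_comm]))
    (i3.congr (.of_forall fun x => by simp [mul_comm]))
    (fun x _ => by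
      have h1 := hasLineDerivAt_heat i hs (x - b)
      unfold HasLineDerivAt at h1 ⊢
      refine h1.congr_of_eventuallyEq (.of_forall fun r => ?_)
      simp only [add_sub_right_comm])
    (fun x _ => (hη.differentiable (by simp) x).hasFDerivAt.hasLineDerivAt _)
  simp only [ContinuousLinearMap.mul_apply'] at h
  simp only [gaussGrad, ← Complex.ofReal_mul]
  rw [integral_complex_ofReal, integral_complex_ofReal, h, Complex.ofReal_neg]

/-- The trial function is the oscillator ground state, proportional to exp(-|x - b|²/(2t)). Per unit
mass its kinetic energy is d/(2t) and its potential energy d/(2t) + c; κ is its squared norm. -/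
lemma groundState_le_of_quadratic (ht : 0 < t) (hV : Integrable fun x => Real.exp (-t * V x))
    {E : ℝ} (hmin : ∀ l ∈ formSpace V,
        E * ‖l.1‖ ^ 2 ≤ ‖l.2.1‖ ^ 2 + ‖l.2.2.1‖ ^ 2 - ‖l.2.2.2‖ ^ 2)
    {b : EuclideanSpace ℝ (Fin d)} {c : ℝ}
    (hq : ∀ᵐ x, V x = (t ^ 2)⁻¹ * ‖x - b‖ ^ 2 + c) : E ≤ d / t + c := by
  set κ := ((4 * Real.pi * (t / 2)) ^ (-(d / 2 : ℝ))) ^ 2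
      / (4 * Real.pi * (t / 4)) ^ (-(d / 2 : ℝ)) with hκ
  have hs : 0 < t / 4 := by positivity
  have hκ0 : 0 < κ := by
    have h1 := heat_const_pos (d := d) (s := t / 2) (by positivity)
    have h2 := heat_const_pos (d := d) hs
    positivity
  have hK := heat_isProbKernel (d := d) hs
  have i1 : Integrable fun x => heat (t / 4) (x - b) := hK.integrable.comp_sub_right b
  have i2 : Integrable fun x => ‖x - b‖ ^ 2 * heat (t / 4) (x - b) :=
    (integrable_norm_sq_mul_heat hs).comp_sub_right b
  have v1 : ∫ x, heat (t / 4) (x - b) = 1 :=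
    (integral_sub_right_eq_self _ b).trans hK.integral_eq_one
  have v2 : ∫ x, ‖x - b‖ ^ 2 * heat (t / 4) (x - b) = 2 * d * (t / 4) :=
    (integral_sub_right_eq_self (fun x => ‖x‖ ^ 2 * heat (t / 4) x) b).trans
      (integral_norm_sq_mul_heat hs)
  set ψ : EuclideanSpace ℝ (Fin d) → ℂ := fun x => (heat (t / 2) (x - b) : ℂ)
  have hn : ∀ x, ‖ψ x‖ ^ 2 = κ * heat (t / 4) (x - b) := fun x => by
    simp only [ψ, Complex.norm_real, Real.norm_eq_abs, sq_abs]
    exact heat_sq ht _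
  have hcont : Continuous fun x : EuclideanSpace ℝ (Fin d) => heat (t / 2) (x - b) :=
    (heat_continuous _).comp (by fun_prop)
  have hψ : MemLp ψ 2 := by
    have hm : AEStronglyMeasurable ψ volume :=
      (Complex.continuous_ofReal.comp hcont).aestronglyMeasurable
    rw [memLp_two_iff_integrable_sq_norm hm]
    simp_rw [hn]
    exact i1.const_mul κ
  have hg : ∀ x, ‖gaussGrad (t / 2) b x‖ ^ 2
      = (t ^ 2)⁻¹ * (κ * (‖x - b‖ ^ 2 * heat (t / 4) (x - b))) := fun x => by
    rw [norm_sq_gaussGrad, heat_sq ht, ← hκ, mul_div_cancel₀ t two_ne_zero]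
    ring
  have hG : MemLp (gaussGrad (t / 2) b) 2 := by
    have hgc : Continuous (gaussGrad (t / 2) b) := by
      refine (PiLp.continuous_toLp 2 _).comp (continuous_pi fun i => ?_)
      exact Complex.continuous_ofReal.comp ((heatD_continuous i _).comp (by fun_prop))
    rw [memLp_two_iff_integrable_sq_norm hgc.aestronglyMeasurable]
    simp_rw [hg]
    exact (i2.const_mul κ).const_mul _
  have hw : HasWeakGradient ψ (gaussGrad (t / 2) b) := hasWeakGradient_gauss (by positivity) b
  have hVψ : (fun x => V x * ‖ψ x‖ ^ 2) =ᵐ[volume] fun x =>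
      (t ^ 2)⁻¹ * (κ * (‖x - b‖ ^ 2 * heat (t / 4) (x - b)))
        + c * (κ * heat (t / 4) (x - b)) := by
    filter_upwards [hq] with x hx
    rw [hn, hx]
    ring
  have j1 := (i2.const_mul κ).const_mul (t ^ 2)⁻¹
  have j2 := (i1.const_mul κ).const_mul c
  have hVi : Integrable fun x => V x * ‖ψ x‖ ^ 2 := (j1.add j2).congr hVψ.symm
  have hVp : Integrable fun x => max (V x) 0 * ‖ψ x‖ ^ 2 :=
    hVi.pos_part.congr (.of_forall fun x => by
      simp only [max_mul_of_nonneg _ _ (sq_nonneg ‖ψ x‖), zero_mul])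
  have hdom : ψ ∈ formDomain V := ⟨⟨hψ, _, hG, hw⟩, hVp⟩
  obtain ⟨k, hk, k1, k2⟩ := exists_formSpace_of_mem_formDomain ht hV hdom
  have hgrad : k.2.1 =ᵐ[volume] gaussGrad (t / 2) b :=
    k2.trans ((weakGradient_spec hdom.1).2.ae_unique hw (weakGradient_spec hdom.1).1 hG)
  have w1 : ‖k.1‖ ^ 2 = κ := by
    rw [norm_sq_eq_integral]
    refine (integral_congr_ae (g := fun x => κ * heat (t / 4) (x - b)) ?_).trans ?_
    · filter_upwards [k1] with x hx
      rw [hx, hn]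
    · rw [integral_const_mul, v1, mul_one]
  have w2 : ‖k.2.1‖ ^ 2 = κ * (d / (2 * t)) := by
    rw [norm_sq_eq_integral]
    refine (integral_congr_ae
      (g := fun x => (t ^ 2)⁻¹ * (κ * (‖x - b‖ ^ 2 * heat (t / 4) (x - b)))) ?_).trans ?_
    · filter_upwards [hgrad] with x hx
      rw [hx, hg]
    · rw [integral_const_mul, integral_const_mul, v2]
      field_simp
      ring
  have w3 : ‖k.2.2.1‖ ^ 2 - ‖k.2.2.2‖ ^ 2 = κ * (d / (2 * t) + c) := by
    rw [← integral_potential hk]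
    refine (integral_congr_ae (g := fun x => V x * ‖ψ x‖ ^ 2) ?_).trans ?_
    · filter_upwards [k1] with x hx
      rw [hx]
    · rw [integral_congr_ae hVψ, integral_add j1 j2, integral_const_mul, integral_const_mul,
        integral_const_mul, integral_const_mul, v1, v2]
      field_simp
      ring
  have h := hmin k hk
  rw [w1, add_sub_assoc, w2, w3] at h
  have h' : κ * E ≤ κ * (d / t + c) := by
    have e : κ * (d / t + c) = κ * (d / (2 * t)) + κ * (d / (2 * t) + c) := by
      field_simp
      ring
    linarith
  exact le_of_mul_le_mul_left h' hκ0

lemma bound_of_quadratic (ht : 0 < t) {b : EuclideanSpace ℝ (Fin d)} {c : ℝ}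
    (hq : ∀ᵐ x, V x = (t ^ 2)⁻¹ * ‖x - b‖ ^ 2 + c) :
    -t⁻¹ * Real.log (∫ x, Real.exp (-t * V x)) + d * t⁻¹ * (1 + 1 / 2 * Real.log (Real.pi * t))
      = d / t + c := by
  have h1 : ∫ x, Real.exp (-t * V x) = Real.exp (-t * c) * (Real.pi * t) ^ (d / 2 : ℝ) := by
    have e : (fun x => Real.exp (-t * V x)) =ᵐ[volume] fun x =>
        Real.exp (-t * c) * Real.exp (-t⁻¹ * ‖x - b‖ ^ 2) := by
      filter_upwards [hq] with x hx
      rw [hx, ← Real.exp_add]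
      congr 1
      field_simp
      ring
    rw [integral_congr_ae e, integral_const_mul,
      integral_sub_right_eq_self (fun x => Real.exp (-t⁻¹ * ‖x‖ ^ 2)) b,
      integral_exp_neg_mul_sq (inv_pos.2 ht), div_inv_eq_mul]
  have hpt : 0 < Real.pi * t := by positivity
  rw [h1, Real.log_mul (Real.exp_pos _).ne' (Real.rpow_pos_of_pos hpt _).ne', Real.log_exp,
    Real.log_rpow hpt]
  field_simp
  ring

end Schrodinger

theorem mainTheorem2 (d : ℕ) (hd : 1 ≤ d) (t : ℝ) (ht : 0 < t)
    (V : EuclideanSpace ℝ (Fin d) → ℝ)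
    (hV : Integrable (fun x => Real.exp (-t * V x)) volume)
    (hdom : ∃ φ ∈ Schrodinger.formDomain V, ¬ φ =ᵐ[volume] 0) :
    ∃ E₀ : ℝ, IsLeast (Schrodinger.eigenvalues V) E₀ ∧
      -t⁻¹ * Real.log (∫ x, Real.exp (-t * V x)) + d * t⁻¹ * (1 + 1 / 2 * Real.log (Real.pi * t))
        ≤ E₀ ∧
      (E₀ = -t⁻¹ * Real.log (∫ x, Real.exp (-t * V x))
          + d * t⁻¹ * (1 + 1 / 2 * Real.log (Real.pi * t)) ↔
        ∃ (b : EuclideanSpace ℝ (Fin d)) (c : ℝ),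
          ∀ᵐ x ∂volume, V x = (t ^ 2)⁻¹ * ‖x - b‖ ^ 2 + c) := by
  obtain ⟨k, hk, E, h1, hE, hmin⟩ := Schrodinger.exists_groundState ht hV hdom
  have hn : ∫ x, ‖k.1 x‖ ^ 2 = 1 := by
    rw [← Schrodinger.norm_sq_eq_integral, h1, one_pow]
  -- Applied to the minimiser, whose form value is E itself; thus equality for E is equality in the
  -- form bound.
  have hb := Schrodinger.form_lower_bound ht hV (Lp.memLp k.1) (Lp.memLp k.2.1) hk.1 hn
    (Schrodinger.norm_sq_posPart hk).1
  rw [← Schrodinger.norm_sq_eq_integral, Schrodinger.integral_potential hk, ← add_sub_assoc, hE]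
    at hb
  refine ⟨E, Schrodinger.isLeast_eigenvalues ht hV hk h1 hmin, hb.1, fun he => hb.2 he.le, ?_⟩
  rintro ⟨b, c, hq⟩
  -- For quadratic V the bound evaluates to d/t + c, which the Gaussian trial function shows is not
  -- exceeded by E.
  refine le_antisymm ?_ hb.1
  rw [Schrodinger.bound_of_quadratic ht hq]
  exact Schrodinger.groundState_le_of_quadratic ht hV (fun l hl => (hmin l hl).1) hq
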